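/- Let $1\le k\le n$ be integers. A *closed convex hypersurface* $M\subset\mathbb R^{n+1}$ is the boundary of a compact convex set with nonempty interior, assumed here to be an embedded hypersurface of class $C^4$ (for instance smooth). Let $\nu(X)$ be its unit outer normal at $X\in M$, and let $\kappa(X)=(\kappa_1(X),\dots,\kappa_n(X))$ be its principal curvatures, i.e. the eigenvalues, with multiplicity, of the map $v\mapsto D_v\nu$ on the tangent space $T_XM$. Write $\sigma_k(\kappa)=\sum_{i_1<\dots<i_k}\kappa_{i_1}\cdots\kappa_{i_k}$ and $N(M)=\{(X,\nu(X)):X\in M\}\subset\mathbb R^{n+1}\times\mathbb S^n$ for the unit normal bundle. **Theorem (Guan–Ren–Wang).** For all $1\le k\le n$ and all real numbers $\Lambda$, $m>0$ and $F$ there is a constant $C=C(n,k,\Lambda,m,F)$ with the following property. Let $M\subset\mathbb R^{n+1}$ be a closed convex hypersurface satisfying $$\sigma_k(\kappa(X))=f(X,\nu(X))\qquad\text{for all }X\in M,$$ where $f\in C^2(\Gamma)$ is positive and $\Gamma$ is an open neighbourhood of $N(M)$ in $\mathbb R^{n+1}\times\mathbb S^n$. Suppose that 1. $\|M\|_{C^1}\le\Lambda$,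 in the sense that for some point $z$ in the interior of the region bounded by $M$, the radial function $\rho:\mathbb S^n\to(0,\infty)$, defined by $M=\{z+\rho(\theta)\theta:\theta\in\mathbb S^n\}$, satisfies $\rho\le\Lambda$ and $|\nabla\rho|\le\Lambda$ on $\mathbb S^n$; 2. $f\ge m$ on $N(M)$; 3. $\|f\|_{C^2}\le F$ on $N(M)$, in the sense that at the points of $N(M)$ the function $\tilde f(X,v)=f(X,v/|v|)$ and its first and second derivatives on $\mathbb R^{n+1}\times(\mathbb R^{n+1}\setminus\{0\})$ have norm at most $F$ (for the norm $\max(|X|,|v|)$ on $\mathbb R^{n+1}\times\mathbb R^{n+1}$ and the operator norms it induces). Then $$\max_{X\in M,\ i=1,\dots,n}\kappa_i(X)\le C.$$ -/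

import Mathlib

open Metric Set
open scoped Manifold ContDiff RealInnerProductSpace

/-- `M` is an embedded hypersurface (without boundary) of class `C^r` in the real normed space `E`:
near each of its points it is the zero set of a `C^r` function with nowhere vanishing differential. -/
def IsHypersurface {E : Type*} [NormedAddCommGroup E] [NormedSpace ℝ E] (r : WithTop ℕ∞)
    (M : Set E) : Prop :=
  ∀ p ∈ M, ∃ U : Set E, IsOpen U ∧ p ∈ U ∧ ∃ φ : E → ℝ,
    ContDiffOn ℝ r φ U ∧ (∀ x ∈ U, fderiv ℝ φ x ≠ 0) ∧ M ∩ U = {x ∈ U | φ x = 0}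

/-- `M` is a closed convex hypersurface: the boundary of a compact convex set with nonempty
interior, which is a hypersurface of class `C⁴`, so that the second fundamental form can be
differentiated twice. Smooth hypersurfaces are included. -/
def IsClosedConvexHypersurface {E : Type*} [NormedAddCommGroup E] [NormedSpace ℝ E]
    (M : Set E) : Prop :=
  IsHypersurface 4 M ∧
    ∃ K : Set E, Convex ℝ K ∧ IsCompact K ∧ (interior K).Nonempty ∧ M = frontier K

section InnerProduct

variable {E : Type*} [NormedAddCommGroup E] [InnerProductSpace ℝ E]

/-- On `M`, the map `ν` is the unit outer normal: `M` lies in the half-space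
`{Y | ⟪ν X, Y - X⟫ ≤ 0}` for every `X ∈ M`. On a closed convex hypersurface this determines
`ν` at all points of `M`. The values of `ν` outside `M` are irrelevant. -/
def IsOuterUnitNormal (M : Set E) (ν : E → sphere (0 : E) 1) : Prop :=
  ∀ X ∈ M, ∀ Y ∈ M, ⟪(ν X : E), Y - X⟫ ≤ 0

/-- The tangent hyperplane at `X`, the orthogonal complement of the normal line. -/
noncomputable abbrev tangentHyperplane (ν : E → sphere (0 : E) 1) (X : E) : Submodule ℝ E :=
  (ℝ ∙ (ν X : E))ᗮ

/-- The Weingarten map `v ↦ D_v ν` of `M` at `X`, an endomorphism of the tangent hyperplane.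
The derivative of `ν` within `M` is determined on tangent vectors, and maps them to tangent
vectors, so the projection only records that the values are tangent.
With the outer normal, round spheres have positive curvature. -/
noncomputable def weingartenMap (M : Set E) (ν : E → sphere (0 : E) 1) (X : E) :
    tangentHyperplane ν X →ₗ[ℝ] tangentHyperplane ν X :=
  ((tangentHyperplane ν X).orthogonalProjectionOnto ∘L
    fderivWithin ℝ (fun Y => (ν Y : E)) M X ∘L (tangentHyperplane ν X).subtypeL :
    tangentHyperplane ν X →L[ℝ] tangentHyperplane ν X)

/-- The principal curvatures of `M` at `X`: the eigenvalues of the Weingarten map, with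
multiplicity. -/
noncomputable def principalCurvatures [FiniteDimensional ℝ E] (M : Set E) (ν : E → sphere (0 : E) 1) (X : E) :
    Multiset ℝ :=
  (weingartenMap M ν X).charpoly.roots

/-- The radial function of `M` about `z`, extended from unit vectors to be homogeneous of
degree zero: for `z` in the region bounded by a closed convex hypersurface `M` and `θ` a unit
vector, it is the `t > 0` with `z + t θ ∈ M`. -/
noncomputable def radialFunction (M : Set E) (z : E) (v : E) : ℝ :=
  sSup {t : ℝ | 0 ≤ t ∧ z + t • (‖v‖⁻¹ • v) ∈ M}

/-- The `C¹` norm of the radial function of `M` about `z`, over the unit sphere, is at most `Λ`.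
At unit vectors the differential of the degree-zero extension is the spherical gradient. -/
def C1NormLE (M : Set E) (z : E) (Λ : ℝ) : Prop :=
  ∀ θ ∈ sphere (0 : E) 1, ‖radialFunction M z θ‖ ≤ Λ ∧ ‖fderiv ℝ (radialFunction M z) θ‖ ≤ Λ

open scoped Classical in
/-- The extension of `f : E × S → ℝ`, with `S` the unit sphere, to a function of
`(X, v) ∈ E × (E \ {0})` that is homogeneous of degree zero in `v`. -/
noncomputable def homogeneousExtension (f : E × sphere (0 : E) 1 → ℝ) (p : E × E) : ℝ :=
  if h : p.2 = 0 then 0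
  else f (p.1, ⟨‖p.2‖⁻¹ • p.2, by
    rw [mem_sphere_zero_iff_norm, norm_smul, norm_inv, norm_norm,
      inv_mul_cancel₀ (norm_ne_zero_iff.mpr h)]⟩)

/-- The `C²` norm of `f` on the set `N ⊆ E × S` is at most `F`: the function and its first two
derivatives, computed by means of the degree-zero extension, are bounded by `F` on `N`. -/
def C2NormLE (f : E × sphere (0 : E) 1 → ℝ) (N : Set (E × sphere (0 : E) 1)) (F : ℝ) : Prop :=
  ∀ p ∈ N, ∀ j : ℕ, j ≤ 2 →
    ‖iteratedFDeriv ℝ j (homogeneousExtension f) (p.1, (p.2 : E))‖ ≤ F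

/-- The unit normal bundle `{(X, ν(X)) : X ∈ M}`. -/
def unitNormalBundle (M : Set E) (ν : E → sphere (0 : E) 1) : Set (E × sphere (0 : E) 1) :=
  (fun X => (X, ν X)) '' M

end InnerProduct

/-! ### Second order Taylor expansions along curves -/

section Jets

open Asymptotics Filter Topology

/-! For k = 1 the bound is immediate: convexity makes the principal curvatures nonnegative and their
sum is f ≤ F. For k ≥ 2 the maximum principle is applied to log h(ξ,ξ) − N log u on the unit tangent
bundle. Here h(ξ,ξ) is the normal curvature, u(X) = ⟨X − z₀, ν⟩ is the support function about a
suitable point z₀, and N is large depending on m and F. Since u lies between positive constants, a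
bound for the largest curvature κ₁ at a maximum point gives a bound everywhere.

The obstacle is that f depends on ν: the twice differentiated equation contains terms of size κ₁²,
hence of size κ₁ after division by κ₁. They are beaten by (N − 1) Σ σ^{ii} κ_i², which u contributes
and which is at least (N − 1) κ₁ m / 2, because κ₁ σ^{11} ≥ σ_k / 2 once κ₁ is large
(`half_esymmOn_le`). The remaining dangerous terms are −(1 − 1/N) Σ σ^{ii} h_{11i}² / κ₁². For i ≠ 1
they are absorbed by the off-diagonal part of the second derivative of σ_k together with the gain
from letting ξ vary along the curve (`second_order_condition_of_variation`,
`sum_gradient_terms_le`). For i = 1 they are absorbed by the concavity inequality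
`esymmOn_concavity_inequality`. All this is assembled in `largest_le_of_maximum_conditions`.

The concavity inequality comes from σ_k = A (κ₁ + B/A), where A and B are σ_{k−1} and σ_k of the
other entries. Log-concavity of A and concavity of B/A (Marcus–Lopes, `esymmQuot_superadditive`)
give −σ_k'' + (σ_k')² / σ_k ≥ A² (ξ₁ + d)² / σ_k, with d the derivative of B/A along ξ. As σ_k is
bounded and κ₁ is the largest entry, B is at most a constant times A, so σ_k is close to κ₁ A, and
d² A is controlled by the components of ξ other than ξ₁ (`esymmQuot_derivative_sq_le`).

The geometry is done at one point at a time, in the graph of −w over the tangent hyperplane in a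
principal frame. Partial derivatives of w commute, which replaces the Codazzi equation and the
commutation formulas; the curvature terms come from the area element. Only expansions to second
order along coordinate lines are needed, which is what `HasJet` records.

The bound on ρ and its gradient has no lower bound on ρ, so z itself may be close to M. A ball of
controlled radius in the region is found in `exists_le_inner_normal`: at the point farthest from z
all curvatures are at least 1/R, so the equation bounds R from below, and the gradient bound keeps ρ
≥ R/2 near that direction. -/

/-- `f t = a + t b + t² c + o(t²)` as `t → 0`. -/
def HasJet {G : Type*} [NormedAddCommGroup G] [NormedSpace ℝ G] (f : ℝ → G) (a b c : G) : Prop :=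
  (fun t : ℝ => f t - (a + t • b + t ^ 2 • c)) =o[𝓝 0] fun t : ℝ => t ^ 2

variable {G H : Type*} [NormedAddCommGroup G] [NormedSpace ℝ G] [NormedAddCommGroup H]
  [NormedSpace ℝ H]

namespace HasJet

variable {f g : ℝ → G} {a b c a' b' c' : G}

theorem congr_coeff (h : HasJet f a b c) (ha : a = a') (hb : b = b') (hc : c = c') :
    HasJet f a' b' c' := by subst ha hb hc; exact h

theorem congr_fun (h : HasJet f a b c) (hfg : f =ᶠ[𝓝 0] g) : HasJet g a b c :=
  IsLittleO.congr' h (hfg.mono fun t ht => by simp only [ht]) EventuallyEq.rfl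

theorem apply_zero (h : HasJet f a b c) : f 0 = a := by
  have h0 := (h.bound one_pos).self_of_nhds
  have : ‖f 0 - a‖ ≤ 0 := by simpa using h0
  exact sub_eq_zero.1 (norm_le_zero_iff.1 this)

theorem const (a : G) : HasJet (fun _ => a) a 0 0 := by
  simp [HasJet]

theorem ident : HasJet (fun t : ℝ => t) 0 1 0 := by
  simp [HasJet]

theorem add (hf : HasJet f a b c) (hg : HasJet g a' b' c') :
    HasJet (fun t => f t + g t) (a + a') (b + b') (c + c') := by
  refine (IsLittleO.add hf hg).congr_left fun t => ?_
  simp only [smul_add]; abel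

theorem clm (L : G →L[ℝ] H) (hf : HasJet f a b c) :
    HasJet (fun t => L (f t)) (L a) (L b) (L c) := by
  refine ((L.isBigO_comp (fun t : ℝ => f t - (a + t • b + t ^ 2 • c)) (𝓝 0)).trans_isLittleO
    hf).congr_left fun t => ?_
  simp

theorem neg (hf : HasJet f a b c) : HasJet (fun t => -f t) (-a) (-b) (-c) :=
  hf.clm (-ContinuousLinearMap.id ℝ G)

theorem sub (hf : HasJet f a b c) (hg : HasJet g a' b' c') :
    HasJet (fun t => f t - g t) (a - a') (b - b') (c - c') := by
  simpa [sub_eq_add_neg] using hf.add hg.neg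

theorem sum {ι : Type*} (s : Finset ι) {f : ι → ℝ → G} {a b c : ι → G}
    (h : ∀ i ∈ s, HasJet (f i) (a i) (b i) (c i)) :
    HasJet (fun t => ∑ i ∈ s, f i t) (∑ i ∈ s, a i) (∑ i ∈ s, b i) (∑ i ∈ s, c i) := by
  classical
  induction s using Finset.induction_on with
  | empty => simpa using const (0 : G)
  | insert i s hi ih =>
    simp only [Finset.sum_insert hi]
    exact (h i (by simp)).add (ih fun j hj => h j (by simp [hj]))

theorem tendsto (hf : HasJet f a b c) : Tendsto f (𝓝 0) (𝓝 a) := by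
  have h1 : Tendsto (fun t : ℝ => f t - (a + t • b + t ^ 2 • c)) (𝓝 0) (𝓝 0) := by
    refine hf.trans_tendsto ?_
    exact ((continuous_id.pow 2).tendsto' (0 : ℝ) 0 (by simp))
  have h2 : Tendsto (fun t : ℝ => a + t • b + t ^ 2 • c) (𝓝 0) (𝓝 a) :=
    Continuous.tendsto' (by fun_prop) _ _ (by simp)
  simpa using h1.add h2

theorem sub_isBigO (hf : HasJet f a b c) : (fun t => f t - a) =O[𝓝 0] fun t : ℝ => t := by
  have h2 : (fun t : ℝ => t ^ 2) =O[𝓝 0] fun t : ℝ => t := by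
    simpa [pow_two] using
      ((continuous_id.tendsto (0 : ℝ)).isBigO_one ℝ).mul (isBigO_refl (fun t : ℝ => t) (𝓝 0))
  have h1 := hf.isBigO.trans h2
  have hb : (fun t : ℝ => t • b) =O[𝓝 0] fun t : ℝ => t := by
    refine IsBigO.of_bound ‖b‖ (Eventually.of_forall fun t => ?_)
    rw [norm_smul, mul_comm]
  have hc : (fun t : ℝ => t ^ 2 • c) =O[𝓝 0] fun t : ℝ => t := by
    refine IsBigO.trans (IsBigO.of_bound ‖c‖ (Eventually.of_forall fun t => ?_)) h2
    rw [norm_smul, mul_comm]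
  refine ((h1.add hb).add hc).congr_left fun t => ?_
  abel

theorem smul {φ : ℝ → ℝ} {x y z : ℝ} (hφ : HasJet φ x y z) (hf : HasJet f a b c) :
    HasJet (fun t => φ t • f t) (x • a) (x • b + y • a) (x • c + y • b + z • a) := by
  have e1 : (fun t => (φ t - (x + t • y + t ^ 2 • z)) • f t) =o[𝓝 0] fun t : ℝ => t ^ 2 := by
    simpa using IsLittleO.smul_isBigO hφ (hf.tendsto.isBigO_one ℝ)
  have e2 : (fun t => (x + t • y + t ^ 2 • z) • (f t - (a + t • b + t ^ 2 • c)))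
      =o[𝓝 0] fun t : ℝ => t ^ 2 := by
    have : Continuous fun t : ℝ => (x + t • y + t ^ 2 • z) := by fun_prop
    simpa using IsBigO.smul_isLittleO ((this.tendsto 0).isBigO_one ℝ) hf
  have e3 : (fun t : ℝ => t ^ 2 • (t • (y • c + z • b) + t ^ 2 • z • c))
      =o[𝓝 0] fun t : ℝ => t ^ 2 := by
    have h0 : (fun t : ℝ => t • (y • c + z • b) + t ^ 2 • z • c) =o[𝓝 0] fun _ : ℝ => (1 : ℝ) := by
      rw [isLittleO_one_iff]
      exact Continuous.tendsto' (by fun_prop) _ _ (by simp)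
    simpa using (isBigO_refl (fun t : ℝ => t ^ 2) (𝓝 0)).smul_isLittleO h0
  refine ((e1.add e2).add e3).congr_left fun t => ?_
  simp only [smul_sub, smul_add, sub_smul, add_smul, smul_smul, smul_eq_mul]
  module

theorem mul {φ ψ : ℝ → ℝ} {x y z x' y' z' : ℝ} (hφ : HasJet φ x y z) (hψ : HasJet ψ x' y' z') :
    HasJet (fun t => φ t * ψ t) (x * x') (x * y' + y * x') (x * z' + y * y' + z * x') :=
  hφ.smul hψ

/-- The first and second derivative tests at a local maximum. A Peano expansion suffices, so f need
not be differentiable away from 0. -/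
theorem nonpos_of_le {f : ℝ → ℝ} {a b c : ℝ} (h : HasJet f a b c) (hle : ∀ᶠ t in 𝓝 0, f t ≤ a) :
    b = 0 ∧ c ≤ 0 := by
  have key : ∀ ε > 0, ∀ᶠ t : ℝ in 𝓝 0, t * b + t ^ 2 * c ≤ ε * t ^ 2 := by
    intro ε hε
    filter_upwards [h.bound hε, hle] with t h1 h2
    rw [Real.norm_eq_abs, Real.norm_eq_abs, abs_of_nonneg (sq_nonneg t)] at h1
    have := (abs_le.1 h1).1
    simp only [smul_eq_mul] at this
    linarith
  have hb : b = 0 := by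
    obtain ⟨δ, hδ, h1⟩ := Metric.eventually_nhds_iff.1 (key 1 one_pos)
    by_contra hb
    set M := |c| + 1 with hM
    have hMpos : 0 < M := by positivity
    have hbp : 0 < |b| := abs_pos.2 hb
    -- At a point ±r, with the sign of b, the linear term r |b| would have to be at most r² (|c| +
    -- 1), while r (|c| + 1) ≤ |b| / 2.
    set r := min (δ / 2) (|b| / (2 * M)) with hr
    have hrpos : 0 < r := by positivity
    have hr1 : r < δ := lt_of_le_of_lt (min_le_left _ _) (by linarith)
    have hr2 : r * (2 * M) ≤ |b| := (le_div_iff₀ (by positivity)).1 (min_le_right _ _)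
    have hk : r * |b| + r ^ 2 * c ≤ 1 * r ^ 2 := by
      rcases abs_choice b with hh | hh
      · have := h1 (y := r) (by simpa [abs_of_pos hrpos] using hr1)
        rw [hh]; linarith
      · have := h1 (y := -r) (by simpa [abs_of_pos hrpos] using hr1)
        rw [hh]; nlinarith
    have h3 : -|c| ≤ c := neg_abs_le c
    have h4 : |b| ≤ r * M := by
      have : r * |b| ≤ r * (r * M) := by rw [hM]; nlinarith [sq_nonneg r]
      exact le_of_mul_le_mul_left this hrpos
    nlinarith
  refine ⟨hb, le_of_forall_pos_le_add fun ε hε => ?_⟩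
  obtain ⟨δ, hδ, h1⟩ := Metric.eventually_nhds_iff.1 (key ε hε)
  have := h1 (y := δ / 2) (by simp [abs_of_pos hδ, hδ])
  rw [hb] at this
  have hpos : 0 < (δ / 2) ^ 2 := by positivity
  have : (δ / 2) ^ 2 * c ≤ (δ / 2) ^ 2 * ε := by linarith
  simpa using le_of_mul_le_mul_left this hpos

/-- Tested on linear functionals, the difference is a jet of the zero function, to which the
derivative tests apply with both signs. This is how identities are differentiated below: both sides
are expanded and coefficients compared. -/
theorem unique (h : HasJet f a b c) (h' : HasJet f a' b' c') : a = a' ∧ b = b' ∧ c = c' := by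
  have h0 : a = a' := h.apply_zero.symm.trans h'.apply_zero
  have hd : HasJet (fun _ : ℝ => (0 : G)) (a - a') (b - b') (c - c') := by
    simpa using h.sub h'
  have hL : ∀ L : G →L[ℝ] ℝ, L (b - b') = 0 ∧ L (c - c') = 0 := by
    intro L
    have h1 := hd.clm L
    have h2 := h1.neg
    have hz : L (a - a') = 0 := by simp [h0]
    have n1 := h1.nonpos_of_le (Eventually.of_forall fun t => by simp [h0])
    have n2 := h2.nonpos_of_le (Eventually.of_forall fun t => by simp [h0])
    exact ⟨n1.1, le_antisymm n1.2 (by linarith [n2.2])⟩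
  refine ⟨h0, sub_eq_zero.1 ?_, sub_eq_zero.1 ?_⟩
  · exact SeparatingDual.eq_zero_of_forall_dual_eq_zero (R := ℝ) fun L => (hL L).1
  · exact SeparatingDual.eq_zero_of_forall_dual_eq_zero (R := ℝ) fun L => (hL L).2

end HasJet

/-- The second order Taylor formula with Peano remainder. -/
theorem ContDiffAt.taylor_two_isLittleO {f : G → H} {a : G} (hf : ContDiffAt ℝ 2 f a) :
    (fun h : G => f (a + h) - f a - fderiv ℝ f a h - (2⁻¹ : ℝ) • fderiv ℝ (fderiv ℝ f) a h h)
      =o[𝓝 0] fun h : G => ‖h‖ ^ 2 := by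
  have hd : ∀ᶠ x in 𝓝 a, DifferentiableAt ℝ f x :=
    (hf.eventually (by simp)).mono fun x hx => hx.differentiableAt (by norm_num)
  have hf' : ContDiffAt ℝ 1 (fderiv ℝ f) a := hf.fderiv_right (by norm_num)
  have hD := (hf'.differentiableAt (by norm_num)).hasFDerivAt
  have hsymm : IsSymmSndFDerivAt ℝ f a := hf.isSymmSndFDerivAt (by simp)
  rw [isLittleO_iff]
  intro ε hε
  have hD' := hD.isLittleO.bound hε
  obtain ⟨δ, hδ, hball⟩ := Metric.eventually_nhds_iff.1 (hd.and hD')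
  refine Metric.eventually_nhds_iff.2 ⟨δ, hδ, fun h hh => ?_⟩
  rw [dist_zero_right] at hh
  set R : G → H := fun h => f (a + h) - f a - fderiv ℝ f a h
    - (2⁻¹ : ℝ) • fderiv ℝ (fderiv ℝ f) a h h with hR
  have hder : ∀ y ∈ closedBall (0 : G) ‖h‖, HasFDerivWithinAt R
      (fderiv ℝ f (a + y) - fderiv ℝ f a - fderiv ℝ (fderiv ℝ f) a y) (closedBall 0 ‖h‖) y := by
    intro y hy
    rw [mem_closedBall_zero_iff] at hy
    have hy' : Dist.dist (a + y) a < δ := by simpa using lt_of_le_of_lt hy hh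
    have h1 : HasFDerivAt (fun y => f (a + y)) (fderiv ℝ f (a + y)) y := by
      have := (hball hy').1.hasFDerivAt
      exact (this.comp y ((hasFDerivAt_id y).const_add a)).congr_fderiv (by simp)
    have h2 : HasFDerivAt (fun y => fderiv ℝ (fderiv ℝ f) a y y)
        ((2 : ℝ) • fderiv ℝ (fderiv ℝ f) a y) y := by
      have := ((fderiv ℝ (fderiv ℝ f) a).hasFDerivAt (x := y)).clm_apply (hasFDerivAt_id y)
      refine this.congr_fderiv ?_
      ext z
      simp [two_smul, hsymm.eq z y]
    have h3 := ((h1.sub_const (f a)).sub (fderiv ℝ f a).hasFDerivAt).sub (h2.const_smul (2⁻¹ : ℝ))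
    refine (h3.congr_fderiv ?_).hasFDerivWithinAt
    ext z
    simp [smul_smul]
  have hbound : ∀ y ∈ closedBall (0 : G) ‖h‖,
      ‖fderiv ℝ f (a + y) - fderiv ℝ f a - fderiv ℝ (fderiv ℝ f) a y‖ ≤ ε * ‖h‖ := by
    intro y hy
    rw [mem_closedBall_zero_iff] at hy
    have hy' : Dist.dist (a + y) a < δ := by simpa using lt_of_le_of_lt hy hh
    have := (hball hy').2
    simp only [add_sub_cancel_left] at this
    exact this.trans (by gcongr)
  have := (convex_closedBall (0 : G) ‖h‖).norm_image_sub_le_of_norm_hasFDerivWithin_le hder hbound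
    (x := 0) (y := h) (by simp) (by simp)
  have hR0 : R 0 = 0 := by simp [hR]
  rw [hR0, sub_zero, sub_zero] at this
  rw [norm_pow, norm_norm, pow_two, ← mul_assoc]
  exact this

/-- Second order chain rule. Jets store Taylor coefficients rather than derivatives, hence the
factor 1/2 on the Hessian only. -/
theorem HasJet.comp {f : G → H} {γ : ℝ → G} {a v w : G} (hγ : HasJet γ a v w)
    (hf : ContDiffAt ℝ 2 f a) :
    HasJet (fun t => f (γ t)) (f a) (fderiv ℝ f a v)
      (fderiv ℝ f a w + (2⁻¹ : ℝ) • fderiv ℝ (fderiv ℝ f) a v v) := by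
  set B := fderiv ℝ (fderiv ℝ f) a with hB
  have hO := hγ.sub_isBigO
  have ht : Tendsto (fun t => γ t - a) (𝓝 0) (𝓝 0) := by
    simpa using hγ.tendsto.sub_const a
  have e1 := (hf.taylor_two_isLittleO.comp_tendsto ht).trans_isBigO (hO.norm_left.pow 2)
  have e2 := hγ.clm (fderiv ℝ f a)
  have e2' := e2.sub (HasJet.const (fderiv ℝ f a a))
  -- B(γ − a, γ − a) − t² B(v, v) is the sum of B(γ − a − tv, γ − a) and B(tv, γ − a − tv), each
  -- o(t) times O(t).
  have e3 : (fun t => B (γ t - a - t • v) (γ t - a)) =o[𝓝 0] fun t : ℝ => t ^ 2 := by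
    have h1 : (fun t => γ t - a - t • v) =o[𝓝 0] fun t : ℝ => t := by
      have hlt : (fun t : ℝ => t ^ 2) =o[𝓝 0] fun t : ℝ => t := by
        simpa using isLittleO_pow_pow (𝕜 := ℝ) (m := 1) (n := 2) (by norm_num)
      have hw : (fun t : ℝ => t ^ 2 • w) =o[𝓝 0] fun t : ℝ => t := by
        refine IsBigO.trans_isLittleO (IsBigO.of_bound ‖w‖ (Eventually.of_forall fun t => ?_)) hlt
        rw [norm_smul, mul_comm]
      refine ((hγ.trans hlt).add hw).congr_left fun t => ?_
      abel
    have h2 : (fun t => B (γ t - a - t • v) (γ t - a)) =O[𝓝 0]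
        fun t => ‖γ t - a - t • v‖ * ‖γ t - a‖ := by
      refine IsBigO.of_bound ‖B‖ (Eventually.of_forall fun t => ?_)
      simpa [mul_assoc] using B.le_opNorm₂ (γ t - a - t • v) (γ t - a)
    refine h2.trans_isLittleO ?_
    simpa [pow_two] using h1.norm_left.mul_isBigO hO.norm_left
  have e4 : (fun t => B (t • v) (γ t - a - t • v)) =o[𝓝 0] fun t : ℝ => t ^ 2 := by
    have h1 : (fun t => γ t - a - t • v) =o[𝓝 0] fun t : ℝ => t := by
      have hlt : (fun t : ℝ => t ^ 2) =o[𝓝 0] fun t : ℝ => t := by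
        simpa using isLittleO_pow_pow (𝕜 := ℝ) (m := 1) (n := 2) (by norm_num)
      have hw : (fun t : ℝ => t ^ 2 • w) =o[𝓝 0] fun t : ℝ => t := by
        refine IsBigO.trans_isLittleO (IsBigO.of_bound ‖w‖ (Eventually.of_forall fun t => ?_)) hlt
        rw [norm_smul, mul_comm]
      refine ((hγ.trans hlt).add hw).congr_left fun t => ?_
      abel
    have h2 := ((B v).isBigO_comp (fun t => γ t - a - t • v) (𝓝 0)).trans_isLittleO h1
    have := (isBigO_refl (fun t : ℝ => t) (𝓝 0)).smul_isLittleO h2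
    simpa [pow_two] using this
  refine ((e1.add e2').add ((e3.add e4).const_smul_left (2⁻¹ : ℝ))).congr_left fun t => ?_
  simp only [← hB, Function.comp_apply, add_sub_cancel, map_sub, map_smul, smul_add, smul_sub,
    _root_.sub_apply, _root_.smul_apply, Pi.smul_apply]
  module

theorem HasJet.log {f : ℝ → ℝ} {a b c : ℝ} (h : HasJet f a b c) (ha : a ≠ 0) :
    HasJet (fun t => Real.log (f t)) (Real.log a) (b / a) (c / a - b ^ 2 / (2 * a ^ 2)) := by
  have h1 := h.comp (f := Real.log) (Real.contDiffAt_log.2 ha)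
  have hd : ∀ x : ℝ, fderiv ℝ Real.log x = (ContinuousLinearMap.id ℝ ℝ).smulRight x⁻¹ := by
    intro x; ext; simp
  have h2 : fderiv ℝ (fderiv ℝ Real.log) a b b = - b ^ 2 / a ^ 2 := by
    have hh : HasFDerivAt (fderiv ℝ Real.log)
        ((ContinuousLinearMap.smulRightL ℝ ℝ ℝ (ContinuousLinearMap.id ℝ ℝ)).comp
          ((ContinuousLinearMap.id ℝ ℝ).smulRight (-(a ^ 2)⁻¹))) a := by
      have h3 : HasFDerivAt (fun x : ℝ => x⁻¹)
        ((ContinuousLinearMap.id ℝ ℝ).smulRight (-(a ^ 2)⁻¹)) a := (hasDerivAt_inv ha).hasFDerivAt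
      have := ((ContinuousLinearMap.smulRightL ℝ ℝ ℝ
        (ContinuousLinearMap.id ℝ ℝ)).hasFDerivAt (x := a⁻¹)).comp a h3
      refine this.congr_of_eventuallyEq (Eventually.of_forall fun x => ?_)
      rw [hd]; rfl
    rw [hh.fderiv]
    simp
    field_simp
  refine h1.congr_coeff rfl ?_ ?_
  · rw [hd]; simp [div_eq_mul_inv]
  · rw [h2, hd]; simp; field_simp; ring

/-- The jet (1, 0, c) is that of the squared area element of a graph at its base point, where the
gradient vanishes. -/
theorem HasJet.inv_sqrt {f : ℝ → ℝ} {c : ℝ} (h : HasJet f 1 0 c) :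
    HasJet (fun t => (√(f t))⁻¹) 1 0 (-c / 2) := by
  have hc : ContDiffAt ℝ 2 (fun x : ℝ => (√x)⁻¹) 1 :=
    (Real.contDiffAt_sqrt one_ne_zero).inv (by simp)
  have h1 := h.comp (f := fun x : ℝ => (√x)⁻¹) hc
  have hd : HasDerivAt (fun x : ℝ => (√x)⁻¹) (-(1 / 2)) 1 := by
    refine ((Real.hasDerivAt_sqrt one_ne_zero).fun_inv (by simp)).congr_deriv ?_
    simp
  refine h1.congr_coeff (by simp) (by simp) ?_
  rw [hd.hasFDerivAt.fderiv]
  simp; ring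

end Jets

/-! ### Elementary symmetric functions and concavity of their quotients -/

section ElementarySymmetric

open Filter Topology Finset

variable {ι : Type*} [DecidableEq ι]

/-- The elementary symmetric function of degree `k` in the variables `x i`, `i ∈ s`. -/
def esymmOn (k : ℕ) (s : Finset ι) (x : ι → ℝ) : ℝ :=
  ∑ t ∈ s.powersetCard k, ∏ i ∈ t, x i

/-- The first derivative of `esymmOn k s` at `x` in the direction `ξ`. -/
def esymmOnD (k : ℕ) (s : Finset ι) (x ξ : ι → ℝ) : ℝ :=
  ∑ t ∈ s.powersetCard k, ∑ i ∈ t, ξ i * ∏ l ∈ t.erase i, x l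

/-- The second derivative of `esymmOn k s` at `x` in the direction `ξ`. -/
def esymmOnDD (k : ℕ) (s : Finset ι) (x ξ : ι → ℝ) : ℝ :=
  ∑ t ∈ s.powersetCard k, ∑ i ∈ t, ∑ j ∈ t.erase i, ξ i * ξ j * ∏ l ∈ (t.erase i).erase j, x l

theorem HasJet.prod (s : Finset ι) {f : ι → ℝ → ℝ} {a b c : ι → ℝ}
    (h : ∀ i ∈ s, HasJet (f i) (a i) (b i) (c i)) :
    HasJet (fun t => ∏ i ∈ s, f i t) (∏ i ∈ s, a i) (∑ i ∈ s, b i * ∏ l ∈ s.erase i, a l)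
      (∑ i ∈ s, c i * ∏ l ∈ s.erase i, a l
        + 2⁻¹ * ∑ i ∈ s, ∑ j ∈ s.erase i, b i * b j * ∏ l ∈ (s.erase i).erase j, a l) := by
  induction s using Finset.induction_on with
  | empty => simpa using HasJet.const (1 : ℝ)
  | insert k s hk ih =>
    have h1 := (h k (by simp)).mul (ih fun j hj => h j (by simp [hj]))
    have e1 : ∀ i ∈ s, (insert k s).erase i = insert k (s.erase i) := fun i hi =>
      erase_insert_of_ne (fun h => hk (h ▸ hi))
    have e2 : ∀ i ∈ s, ∀ j ∈ s.erase i, ((insert k s).erase i).erase j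
        = insert k ((s.erase i).erase j) := fun i hi j hj => by
      rw [e1 i hi, erase_insert_of_ne (ne_of_mem_of_not_mem (mem_of_mem_erase hj) hk).symm]
    have n1 : ∀ i, k ∉ s.erase i := fun i h => hk (mem_of_mem_erase h)
    have n2 : ∀ i j, k ∉ (s.erase i).erase j := fun i j h => n1 i (mem_of_mem_erase h)
    have s1 : ∀ g : ι → ℝ, ∑ i ∈ s, g i * ∏ l ∈ (insert k s).erase i, a l
        = a k * ∑ i ∈ s, g i * ∏ l ∈ s.erase i, a l := fun g => by
      rw [mul_sum]
      refine sum_congr rfl fun i hi => ?_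
      rw [e1 i hi, prod_insert (n1 i)]; ring
    have s2 : ∑ i ∈ s, ∑ j ∈ (insert k s).erase i,
        b i * b j * ∏ l ∈ ((insert k s).erase i).erase j, a l
        = b k * ∑ i ∈ s, b i * ∏ l ∈ s.erase i, a l
          + a k * ∑ i ∈ s, ∑ j ∈ s.erase i, b i * b j * ∏ l ∈ (s.erase i).erase j, a l := by
      rw [mul_sum, mul_sum, ← sum_add_distrib]
      refine sum_congr rfl fun i hi => ?_
      rw [e1 i hi, sum_insert (n1 i), erase_insert (n1 i), mul_sum]
      congr 1
      · ring
      · refine sum_congr rfl fun j hj => ?_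
        rw [erase_insert_of_ne (ne_of_mem_of_not_mem (mem_of_mem_erase hj) hk).symm, prod_insert (n2 i j)]; ring
    have s3 : ∑ j ∈ s, b k * b j * ∏ l ∈ s.erase j, a l
        = b k * ∑ i ∈ s, b i * ∏ l ∈ s.erase i, a l := by
      rw [mul_sum]; exact sum_congr rfl fun i _ => by ring
    simp only [prod_insert hk]
    refine h1.congr_coeff rfl ?_ ?_
    · rw [sum_insert hk, erase_insert hk, s1]; ring
    · rw [sum_insert hk, sum_insert hk, erase_insert hk, s1, s2, s3]; ring

omit [DecidableEq ι] in
theorem esymmOn_zero (s : Finset ι) (x : ι → ℝ) : esymmOn 0 s x = 1 := by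
  simp [esymmOn]

theorem esymmOn_insert {i : ι} {s : Finset ι} (hi : i ∉ s) (k : ℕ) (x : ι → ℝ) :
    esymmOn (k + 1) (insert i s) x = esymmOn (k + 1) s x + x i * esymmOn k s x := by
  have hinj : Set.InjOn (insert i) (powersetCard k s : Set (Finset ι)) := by
    intro t ht t' ht' h
    have h1 : i ∉ t := fun h => hi ((mem_powersetCard.1 ht).1 h)
    have h2 : i ∉ t' := fun h => hi ((mem_powersetCard.1 ht').1 h)
    rw [← erase_insert h1, ← erase_insert h2, h]
  have hdisj : Disjoint (powersetCard (k + 1) s) ((powersetCard k s).image (insert i)) := by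
    rw [Finset.disjoint_left]
    intro t ht ht'
    obtain ⟨t', -, rfl⟩ := Finset.mem_image.1 ht'
    exact hi ((mem_powersetCard.1 ht).1 (mem_insert_self i t'))
  rw [esymmOn, powersetCard_succ_insert hi, sum_union hdisj, sum_image hinj, esymmOn, esymmOn,
    mul_sum]
  congr 1
  refine sum_congr rfl fun t ht => ?_
  rw [prod_insert fun h => hi ((mem_powersetCard.1 ht).1 h)]

theorem esymmOn_eq_erase {i : ι} {s : Finset ι} (hi : i ∈ s) (k : ℕ) (x : ι → ℝ) :
    esymmOn (k + 1) s x = esymmOn (k + 1) (s.erase i) x + x i * esymmOn k (s.erase i) x := by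
  conv_lhs => rw [← insert_erase hi]
  exact esymmOn_insert (notMem_erase i s) k x

omit [DecidableEq ι] in
theorem esymmOn_nonneg {x : ι → ℝ} (hx : ∀ i, 0 ≤ x i) (k : ℕ) (s : Finset ι) :
    0 ≤ esymmOn k s x :=
  sum_nonneg fun _ _ => prod_nonneg fun i _ => hx i

omit [DecidableEq ι] in
theorem esymmOn_mono_set {x : ι → ℝ} (hx : ∀ i, 0 ≤ x i) (k : ℕ) {s t : Finset ι} (h : s ⊆ t) :
    esymmOn k s x ≤ esymmOn k t x :=
  sum_le_sum_of_subset_of_nonneg (powersetCard_mono h) fun _ _ _ => prod_nonneg fun i _ => hx i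

/-- Double counting: a (k+1)-set with a marked element is an element together with a k-set avoiding
it. Derivatives of elementary symmetric functions thereby become elementary symmetric functions of
fewer variables. -/
theorem sum_powersetCard_succ_sum_erase (k : ℕ) (s : Finset ι) (G : ι → Finset ι → ℝ) :
    ∑ t ∈ s.powersetCard (k + 1), ∑ i ∈ t, G i (t.erase i)
      = ∑ i ∈ s, ∑ t ∈ (s.erase i).powersetCard k, G i t := by
  rw [sum_sigma', sum_sigma']
  refine sum_bij' (fun p _ => (⟨p.2, p.1.erase p.2⟩ : Σ _ : ι, Finset ι))
    (fun p _ => (⟨insert p.1 p.2, p.1⟩ : Σ _ : Finset ι, ι)) ?_ ?_ ?_ ?_ ?_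
  · rintro ⟨t, i⟩ h
    obtain ⟨h1, h2⟩ := mem_sigma.1 h
    obtain ⟨h3, h4⟩ := mem_powersetCard.1 h1
    refine mem_sigma.2 ⟨h3 h2, mem_powersetCard.2 ⟨erase_subset_erase _ h3, ?_⟩⟩
    simp only
    rw [card_erase_of_mem h2, h4]; rfl
  · rintro ⟨i, t⟩ h
    obtain ⟨h1, h2⟩ := mem_sigma.1 h
    obtain ⟨h3, h4⟩ := mem_powersetCard.1 h2
    have hit : i ∉ t := fun h => notMem_erase i s (h3 h)
    refine mem_sigma.2 ⟨mem_powersetCard.2 ⟨?_, ?_⟩, mem_insert_self _ _⟩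
    · exact insert_subset h1 (h3.trans (erase_subset _ _))
    · simp only; rw [card_insert_of_notMem hit, h4]
  · rintro ⟨t, i⟩ h
    obtain ⟨h1, h2⟩ := mem_sigma.1 h
    simp only at h2
    simp only [insert_erase h2]
  · rintro ⟨i, t⟩ h
    obtain ⟨h1, h2⟩ := mem_sigma.1 h
    obtain ⟨h3, h4⟩ := mem_powersetCard.1 h2
    have hit : i ∉ t := fun h => notMem_erase i s (h3 h)
    simp only [erase_insert hit]
  · rintro ⟨t, i⟩ h; rfl

/-- Euler's identity for a homogeneous polynomial of degree k + 1. -/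
theorem sum_mul_esymmOn_erase (k : ℕ) (s : Finset ι) (x : ι → ℝ) :
    ∑ i ∈ s, x i * esymmOn k (s.erase i) x = (k + 1) * esymmOn (k + 1) s x := by
  have h := sum_powersetCard_succ_sum_erase k s fun i t => x i * ∏ l ∈ t, x l
  simp only [esymmOn, mul_sum]
  rw [← h]
  refine sum_congr rfl fun t ht => ?_
  rw [sum_congr rfl fun i hi => mul_prod_erase t x hi, sum_const, (mem_powersetCard.1 ht).2]
  simp

theorem sum_esymmOn_erase_le {x : ι → ℝ} (hx : ∀ i, 0 ≤ x i) (k : ℕ) (s : Finset ι) :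
    ∑ i ∈ s, esymmOn k (s.erase i) x ≤ s.card * esymmOn k s x := by
  rw [← nsmul_eq_mul]
  exact sum_le_card_nsmul _ _ _ fun i _ => esymmOn_mono_set hx k (erase_subset i s)

theorem esymmOnD_succ (k : ℕ) (s : Finset ι) (x ξ : ι → ℝ) :
    esymmOnD (k + 1) s x ξ = ∑ i ∈ s, ξ i * esymmOn k (s.erase i) x := by
  rw [esymmOnD, sum_powersetCard_succ_sum_erase k s fun i t => ξ i * ∏ l ∈ t, x l]
  simp only [esymmOn, mul_sum]

theorem esymmOnDD_succ_succ (k : ℕ) (s : Finset ι) (x ξ : ι → ℝ) :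
    esymmOnDD (k + 2) s x ξ
      = ∑ i ∈ s, ∑ j ∈ s.erase i, ξ i * ξ j * esymmOn k ((s.erase i).erase j) x := by
  rw [esymmOnDD, sum_powersetCard_succ_sum_erase (k + 1) s
    fun i t => ∑ j ∈ t, ξ i * ξ j * ∏ l ∈ t.erase j, x l]
  refine sum_congr rfl fun i _ => ?_
  rw [sum_powersetCard_succ_sum_erase k _ fun j t => ξ i * ξ j * ∏ l ∈ t, x l]
  simp only [esymmOn, mul_sum]

theorem hasJet_esymmOn (k : ℕ) (s : Finset ι) (x ξ : ι → ℝ) :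
    HasJet (fun t => esymmOn k s (fun i => x i + t * ξ i)) (esymmOn k s x) (esymmOnD k s x ξ)
      (2⁻¹ * esymmOnDD k s x ξ) := by
  have h := HasJet.sum (s.powersetCard k) (f := fun t τ => ∏ i ∈ t, (x i + τ * ξ i)) fun t _ =>
    HasJet.prod t (f := fun i τ => x i + τ * ξ i) (a := x) (b := ξ) (c := fun _ => 0)
      fun i _ => by
        simpa using (HasJet.const (x i)).add (HasJet.ident.mul (HasJet.const (ξ i)))
  refine h.congr_coeff rfl rfl ?_
  simp [esymmOnDD, mul_sum]

omit [DecidableEq ι] in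
theorem esymmOn_smul (k : ℕ) (s : Finset ι) (x : ι → ℝ) (r : ℝ) :
    esymmOn k s (fun i => r * x i) = r ^ k * esymmOn k s x := by
  rw [esymmOn, esymmOn, mul_sum]
  refine sum_congr rfl fun t ht => ?_
  rw [prod_mul_distrib, prod_const, (mem_powersetCard.1 ht).2]

/-- By Euler's identity σ_{k+1} is a combination of values of σ_k on subsets. This keeps the
convention a / 0 = 0 harmless in `esymmQuot`. -/
theorem esymmOn_succ_eq_zero {x : ι → ℝ} (hx : ∀ i, 0 ≤ x i) {k : ℕ} {s : Finset ι}
    (h : esymmOn k s x = 0) : esymmOn (k + 1) s x = 0 := by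
  have h1 := sum_mul_esymmOn_erase k s x
  have h2 : ∑ i ∈ s, x i * esymmOn k (s.erase i) x = 0 := by
    refine sum_eq_zero fun i _ => ?_
    have := esymmOn_mono_set hx k (erase_subset i s)
    have h3 := esymmOn_nonneg hx k (s.erase i)
    rw [le_antisymm (by linarith) h3, mul_zero]
  rw [h2] at h1
  have : (k + 1 : ℝ) ≠ 0 := by positivity
  simpa [this] using h1.symm

/-- The quotient of consecutive elementary symmetric functions. -/
noncomputable def esymmQuot (k : ℕ) (s : Finset ι) (x : ι → ℝ) : ℝ :=
  esymmOn (k + 1) s x / esymmOn k s x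

omit [DecidableEq ι] in
theorem esymmQuot_nonneg {x : ι → ℝ} (hx : ∀ i, 0 ≤ x i) (k : ℕ) (s : Finset ι) :
    0 ≤ esymmQuot k s x :=
  div_nonneg (esymmOn_nonneg hx _ _) (esymmOn_nonneg hx _ _)

/-- Divide Euler's identity by σ_{k+1}(s) = σ_{k+1}(s∖i) + x_i σ_k(s∖i): each term is the parallel
sum x_i q / (x_i + q) of x_i and the quotient q of one degree less. The recursion transfers
concavity from degree to degree. -/
theorem esymmQuot_succ {x : ι → ℝ} (hx : ∀ i, 0 ≤ x i) (k : ℕ) (s : Finset ι) :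
    (k + 2) * esymmQuot (k + 1) s x
      = ∑ i ∈ s, x i * esymmQuot k (s.erase i) x / (x i + esymmQuot k (s.erase i) x) := by
  have h1 := sum_mul_esymmOn_erase (k + 1) s x
  rw [esymmQuot, ← mul_div_assoc]
  have h2 : ((k : ℝ) + 2) * esymmOn (k + 1 + 1) s x
      = ∑ i ∈ s, x i * esymmOn (k + 1) (s.erase i) x := by
    rw [h1]; push_cast; ring
  rw [h2, sum_div]
  refine sum_congr rfl fun i hi => ?_
  rw [esymmQuot]
  have hA := esymmOn_nonneg hx k (s.erase i)
  have hB := esymmOn_nonneg hx (k + 1) (s.erase i)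
  have he := esymmOn_eq_erase hi k x
  rcases hA.eq_or_lt with h0 | h0
  · rw [esymmOn_succ_eq_zero hx h0.symm]; simp
  · rw [he]
    rcases (add_nonneg hB (mul_nonneg (hx i) hA)).eq_or_lt with h3 | h3
    · have : esymmOn (k + 1) (s.erase i) x = 0 := by nlinarith [mul_nonneg (hx i) hA]
      simp [this]
    · clear he h1 h2
      generalize esymmOn (k + 1) (s.erase i) x = B at *
      generalize esymmOn k (s.erase i) x = A at *
      have h4 : x i + B / A ≠ 0 := by
        have : x i + B / A = (B + x i * A) / A := by field_simp; ring
        rw [this]; positivity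
      rw [div_eq_div_iff h3.ne' h4]
      field_simp
      ring

/-- After clearing denominators the difference of the two sides is (ad − bc)². -/
theorem parallelSum_superadditive {a b c d : ℝ} (ha : 0 ≤ a) (hb : 0 ≤ b) (hc : 0 ≤ c)
    (hd : 0 ≤ d) : a * b / (a + b) + c * d / (c + d) ≤ (a + c) * (b + d) / (a + c + (b + d)) := by
  rcases (add_nonneg ha hb).eq_or_lt with h | h
  · have h1 : a = 0 := by linarith
    have h2 : b = 0 := by linarith
    simp [h1, h2]
  rcases (add_nonneg hc hd).eq_or_lt with h' | h'
  · have h1 : c = 0 := by linarith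
    have h2 : d = 0 := by linarith
    simp [h1, h2]
  rw [div_add_div _ _ h.ne' h'.ne', div_le_div_iff₀ (by positivity) (by linarith)]
  nlinarith [sq_nonneg (a * d - b * c)]

theorem parallelSum_mono {a b c : ℝ} (ha : 0 ≤ a) (hb : 0 ≤ b) (hbc : b ≤ c) :
    a * b / (a + b) ≤ a * c / (a + c) := by
  rcases ha.eq_or_lt with h | h
  · simp [← h]
  rw [div_le_div_iff₀ (by linarith) (by linarith)]
  nlinarith [mul_nonneg (mul_self_nonneg a) (sub_nonneg.2 hbc)]

/-- Marcus–Lopes: quotients of consecutive elementary symmetric functions are superadditive. -/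
theorem esymmQuot_superadditive {x y : ι → ℝ} (hx : ∀ i, 0 ≤ x i) (hy : ∀ i, 0 ≤ y i) (k : ℕ)
    (s : Finset ι) :
    esymmQuot k s x + esymmQuot k s y ≤ esymmQuot k s (fun i => x i + y i) := by
  induction k generalizing s with
  | zero =>
    have h : ∀ z : ι → ℝ, esymmQuot 0 s z = ∑ i ∈ s, z i := fun z => by
      have := sum_mul_esymmOn_erase 0 s z
      simp only [esymmOn_zero, mul_one] at this
      rw [esymmQuot, esymmOn_zero, this]; simp
    rw [h, h, h, sum_add_distrib]
  | succ k ih =>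
    have hxy : ∀ i, 0 ≤ x i + y i := fun i => add_nonneg (hx i) (hy i)
    have hk : (0 : ℝ) < k + 2 := by positivity
    refine le_of_mul_le_mul_left ?_ hk
    rw [mul_add, esymmQuot_succ hx, esymmQuot_succ hy, esymmQuot_succ hxy, ← sum_add_distrib]
    refine sum_le_sum fun i _ => ?_
    have h1 := esymmQuot_nonneg hx k (s.erase i)
    have h2 := esymmQuot_nonneg hy k (s.erase i)
    -- Superadditivity of the parallel sum comes first; the induction hypothesis then enters through
    -- monotonicity in the second argument.
    exact (parallelSum_superadditive (hx i) h1 (hy i) h2).trans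
      (parallelSum_mono (hxy i) (add_nonneg h1 h2) (ih _))

omit [DecidableEq ι] in
theorem esymmOn_pos_of_card_le {x : ι → ℝ} (hx : ∀ i, 0 < x i) {k : ℕ} {s : Finset ι}
    (hk : k ≤ s.card) : 0 < esymmOn k s x :=
  sum_pos (fun _ _ => prod_pos fun i _ => hx i) (powersetCard_nonempty.2 hk)

omit [DecidableEq ι] in
theorem esymmOn_eq_zero_of_card_lt (x : ι → ℝ) {k : ℕ} {s : Finset ι}
    (hk : s.card < k) : esymmOn k s x = 0 := by
  rw [esymmOn, powersetCard_eq_empty.2 hk, sum_empty]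

theorem esymmOnD_neg (k : ℕ) (s : Finset ι) (x ξ : ι → ℝ) :
    esymmOnD k s x (fun i => -ξ i) = -esymmOnD k s x ξ := by
  simp [esymmOnD]

theorem esymmOnDD_neg (k : ℕ) (s : Finset ι) (x ξ : ι → ℝ) :
    esymmOnDD k s x (fun i => -ξ i) = esymmOnDD k s x ξ := by
  simp [esymmOnDD]

/-- With A = σ_k and B = σ_{k+1}, the left side is A³ times the second derivative of q = B/A along
ξ. Superadditivity and homogeneity of degree one give q(x + tξ) + q(x − tξ) ≤ 2 q(x), and the terms
of order t² are compared. -/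
theorem esymmQuot_concave_of_pos {x : ι → ℝ} (hx : ∀ i, 0 < x i) (ξ : ι → ℝ) (k : ℕ)
    {s : Finset ι} (hk : k ≤ s.card) :
    esymmOn k s x ^ 2 * esymmOnDD (k + 1) s x ξ
      - 2 * esymmOn k s x * esymmOnD k s x ξ * esymmOnD (k + 1) s x ξ
      - esymmOn k s x * esymmOn (k + 1) s x * esymmOnDD k s x ξ
      + 2 * esymmOn (k + 1) s x * esymmOnD k s x ξ ^ 2 ≤ 0 := by
  have jA := hasJet_esymmOn k s x ξ
  have jB := hasJet_esymmOn (k + 1) s x ξ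
  have jA' := hasJet_esymmOn k s x (fun i => -ξ i)
  have jB' := hasJet_esymmOn (k + 1) s x (fun i => -ξ i)
  rw [esymmOnD_neg, esymmOnDD_neg] at jA' jB'
  -- The midpoint inequality with denominators cleared: A (B₊A₋ + B₋A₊) − 2 B A₊A₋, which vanishes
  -- at t = 0 and has to be nonpositive nearby.
  have jL := ((HasJet.const (esymmOn k s x)).mul ((jB.mul jA').add (jB'.mul jA))).sub
    ((HasJet.const (2 * esymmOn (k + 1) s x)).mul (jA.mul jA'))
  have hpos : ∀ᶠ t : ℝ in 𝓝 0, ∀ i ∈ s, 0 < x i + t * ξ i ∧ 0 < x i + t * -ξ i := by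
    rw [Filter.eventually_all_finset]
    intro i _
    have c1 : ContinuousAt (fun t : ℝ => x i + t * ξ i) 0 := by fun_prop
    have c2 : ContinuousAt (fun t : ℝ => x i + t * -ξ i) 0 := by fun_prop
    exact (c1.eventually (lt_mem_nhds (by simpa using hx i))).and
      (c2.eventually (lt_mem_nhds (by simpa using hx i)))
  have hA : 0 < esymmOn k s x := esymmOn_pos_of_card_le hx hk
  have hcongr : ∀ (m : ℕ) (y z : ι → ℝ), (∀ i ∈ s, y i = z i) → esymmOn m s y = esymmOn m s z := by
    intro m y z h
    refine sum_congr rfl fun t ht => prod_congr rfl fun i hi => h i ((mem_powersetCard.1 ht).1 hi)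
  have := (jL.nonpos_of_le ?_).2
  · simp only [zero_mul, add_zero] at this
    nlinarith
  · filter_upwards [hpos] with t ht
    -- Outside s the value 1 is harmless, and it makes the vector positive at every index, as
    -- superadditivity requires.
    set y : ι → ℝ := fun i => if i ∈ s then x i + t * ξ i else 1 with hy
    set z : ι → ℝ := fun i => if i ∈ s then x i + t * -ξ i else 1 with hz
    have hy0 : ∀ i, 0 < y i := fun i => by
      by_cases h : i ∈ s <;> simp [hy, h]; exact (ht i h).1
    have hz0 : ∀ i, 0 < z i := fun i => by
      by_cases h : i ∈ s <;> simp [hz, h]; simpa using (ht i h).2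
    have key := esymmQuot_superadditive (fun i => (hy0 i).le) (fun i => (hz0 i).le) k s
    have hE : ∀ m, esymmOn m s (fun i => x i + t * ξ i) = esymmOn m s y := fun m =>
      hcongr m _ _ fun i hi => by simp [hy, hi]
    have hE' : ∀ m, esymmOn m s (fun i => x i + t * -ξ i) = esymmOn m s z := fun m =>
      hcongr m _ _ fun i hi => by simp [hz, hi]
    have hE2 : ∀ m, esymmOn m s (fun i => y i + z i) = 2 ^ m * esymmOn m s x := fun m => by
      rw [← esymmOn_smul]
      exact hcongr m _ _ fun i hi => by simp [hy, hz, hi]; ring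
    have p1 := esymmOn_pos_of_card_le hy0 hk
    have p2 := esymmOn_pos_of_card_le hz0 hk
    rw [hE, hE, hE', hE']
    rw [esymmQuot, esymmQuot, esymmQuot, hE2, hE2, pow_succ, mul_right_comm,
      mul_assoc, mul_div_mul_left _ _ (by positivity), div_add_div _ _ p1.ne' p2.ne',
      div_le_div_iff₀ (by positivity) hA] at key
    nlinarith
end ElementarySymmetric

/-! ### The concavity inequality for σ_k with one large entry -/

section ConcavityInequality

open Filter Topology Finset

variable {ι : Type*} [DecidableEq ι]

/-- Induction on the degree: σ_{k+1} is σ_k times a positive concave quotient, and a product of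
log-concave functions is log-concave. -/
theorem esymmOn_log_concave_of_pos {x : ι → ℝ} (hx : ∀ i, 0 < x i) (ξ : ι → ℝ) (k : ℕ)
    {s : Finset ι} (hk : k ≤ s.card) :
    esymmOn k s x * esymmOnDD k s x ξ ≤ esymmOnD k s x ξ ^ 2 := by
  induction k with
  | zero => simp [esymmOnD, esymmOnDD]
  | succ k ih =>
    have h1 := ih (by omega)
    have h2 := esymmQuot_concave_of_pos hx ξ k (s := s) (by omega)
    have hA := esymmOn_pos_of_card_le hx (s := s) (k := k) (by omega)
    have hB := esymmOn_pos_of_card_le hx hk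
    generalize esymmOn k s x = A at *
    generalize esymmOn (k + 1) s x = B at *
    generalize esymmOnD k s x ξ = a at *
    generalize esymmOnD (k + 1) s x ξ = b at *
    generalize esymmOnDD k s x ξ = α at *
    generalize esymmOnDD (k + 1) s x ξ = β at *
    have h3 := mul_le_mul_of_nonneg_left h2 hB.le
    have h4 := mul_le_mul_of_nonneg_left h1 (sq_nonneg B)
    refine le_of_mul_le_mul_left ?_ (pow_pos hA 2)
    nlinarith [sq_nonneg (A * b - B * a)]

omit [DecidableEq ι] in
theorem continuous_esymmOn_shift (k : ℕ) (s : Finset ι) (x : ι → ℝ) :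
    Continuous fun r : ℝ => esymmOn k s (fun i => x i + r) := by
  unfold esymmOn; fun_prop

theorem continuous_esymmOnD_shift (k : ℕ) (s : Finset ι) (x ξ : ι → ℝ) :
    Continuous fun r : ℝ => esymmOnD k s (fun i => x i + r) ξ := by
  unfold esymmOnD; fun_prop

theorem continuous_esymmOnDD_shift (k : ℕ) (s : Finset ι) (x ξ : ι → ℝ) :
    Continuous fun r : ℝ => esymmOnDD k s (fun i => x i + r) ξ := by
  unfold esymmOnDD; fun_prop

/-- Limit of the positive case at the points x + r(1, …, 1) as r decreases to 0. -/
theorem esymmOn_log_concave {x : ι → ℝ} (hx : ∀ i, 0 ≤ x i) (ξ : ι → ℝ) (k : ℕ)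
    {s : Finset ι} (hk : k ≤ s.card) :
    esymmOn k s x * esymmOnDD k s x ξ ≤ esymmOnD k s x ξ ^ 2 := by
  have c1 := continuous_esymmOn_shift k s x
  have c2 := continuous_esymmOnD_shift k s x ξ
  have c3 := continuous_esymmOnDD_shift k s x ξ
  have hc : Continuous fun r : ℝ => esymmOn k s (fun i => x i + r)
      * esymmOnDD k s (fun i => x i + r) ξ - esymmOnD k s (fun i => x i + r) ξ ^ 2 := by
    fun_prop
  have hl := (hc.tendsto 0).mono_left (nhdsWithin_le_nhds (s := Set.Ioi (0 : ℝ)))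
  simp only [add_zero] at hl
  refine sub_nonpos.1 (le_of_tendsto hl ?_)
  filter_upwards [self_mem_nhdsWithin] with r hr
  exact sub_nonpos.2
    (esymmOn_log_concave_of_pos (fun i => add_pos_of_nonneg_of_pos (hx i) hr) ξ k hk)

theorem esymmQuot_concave {x : ι → ℝ} (hx : ∀ i, 0 ≤ x i) (ξ : ι → ℝ) (k : ℕ)
    {s : Finset ι} (hk : k ≤ s.card) :
    esymmOn k s x ^ 2 * esymmOnDD (k + 1) s x ξ
      - 2 * esymmOn k s x * esymmOnD k s x ξ * esymmOnD (k + 1) s x ξ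
      - esymmOn k s x * esymmOn (k + 1) s x * esymmOnDD k s x ξ
      + 2 * esymmOn (k + 1) s x * esymmOnD k s x ξ ^ 2 ≤ 0 := by
  have c1 := continuous_esymmOn_shift k s x
  have c2 := continuous_esymmOnD_shift k s x ξ
  have c3 := continuous_esymmOnDD_shift k s x ξ
  have d1 := continuous_esymmOn_shift (k + 1) s x
  have d2 := continuous_esymmOnD_shift (k + 1) s x ξ
  have d3 := continuous_esymmOnDD_shift (k + 1) s x ξ
  have hc : Continuous fun r : ℝ => esymmOn k s (fun i => x i + r) ^ 2
        * esymmOnDD (k + 1) s (fun i => x i + r) ξ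
      - 2 * esymmOn k s (fun i => x i + r) * esymmOnD k s (fun i => x i + r) ξ
        * esymmOnD (k + 1) s (fun i => x i + r) ξ
      - esymmOn k s (fun i => x i + r) * esymmOn (k + 1) s (fun i => x i + r)
        * esymmOnDD k s (fun i => x i + r) ξ
      + 2 * esymmOn (k + 1) s (fun i => x i + r) * esymmOnD k s (fun i => x i + r) ξ ^ 2 := by
    fun_prop
  have hl := (hc.tendsto 0).mono_left (nhdsWithin_le_nhds (s := Set.Ioi (0 : ℝ)))
  simp only [add_zero] at hl
  refine le_of_tendsto hl ?_
  filter_upwards [self_mem_nhdsWithin] with r hr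
  exact esymmQuot_concave_of_pos (fun i => add_pos_of_nonneg_of_pos (hx i) hr) ξ k hk

/-- Quotients of consecutive elementary symmetric functions are nondecreasing in each variable. -/
theorem esymmOn_mul_erase_le {x : ι → ℝ} (hx : ∀ i, 0 ≤ x i) (k : ℕ) {s : Finset ι} {i : ι}
    (hi : i ∈ s) :
    esymmOn (k + 2) s x * esymmOn k (s.erase i) x
      ≤ esymmOn (k + 1) (s.erase i) x * esymmOn (k + 1) s x := by
  have hA := esymmOn_nonneg hx (k + 1) s
  rcases hA.eq_or_lt with h0 | hA
  · rw [esymmOn_succ_eq_zero hx h0.symm, ← h0]; simp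
  have hy : ∀ j, 0 ≤ (Pi.single i (1 : ℝ) : ι → ℝ) j := fun j => by
    by_cases h : j = i
    · subst h; simp
    · simp [h]
  -- Adding the i-th unit vector, whose own quotient is nonnegative, cannot decrease the quotient;
  -- both symmetric functions are affine in x_i, so this gives the claim.
  have key := esymmQuot_superadditive hx hy (k + 1) s
  have h1 := esymmQuot_nonneg hy (k + 1) s
  set y : ι → ℝ := fun j => x j + (Pi.single i (1 : ℝ) : ι → ℝ) j
  have hc : ∀ m, esymmOn m (s.erase i) y = esymmOn m (s.erase i) x := fun m => by
    refine sum_congr rfl fun t ht => prod_congr rfl fun j hj => ?_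
    have : j ≠ i := ne_of_mem_erase ((mem_powersetCard.1 ht).1 hj)
    simp [y, this]
  have hE : ∀ m, esymmOn (m + 1) s y = esymmOn (m + 1) s x + esymmOn m (s.erase i) x := fun m => by
    rw [esymmOn_eq_erase hi, esymmOn_eq_erase hi m x, hc, hc]; simp [y]; ring
  have key' : esymmQuot (k + 1) s x ≤ esymmQuot (k + 1) s y := by linarith
  have h2 := esymmOn_nonneg hx k (s.erase i)
  rw [esymmQuot, esymmQuot, hE, hE, div_le_div_iff₀ hA (by linarith)] at key'
  linarith

/-- In each monomial of degree k + 1 one factor is at most τ and the cofactor is a monomial of σ_k;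
there are at most 2^|ι| monomials. -/
theorem esymmOn_le_of_exists_le [Fintype ι] {x : ι → ℝ} (hx : ∀ i, 0 ≤ x i) {τ : ℝ} (hτ : 0 ≤ τ)
    (k : ℕ) {s : Finset ι} (h : ∀ t ∈ s.powersetCard (k + 1), ∃ i ∈ t, x i ≤ τ) :
    esymmOn (k + 1) s x ≤ 2 ^ Fintype.card ι * (τ * esymmOn k s x) := by
  have hE := mul_nonneg hτ (esymmOn_nonneg hx k s)
  have h1 : ∀ t ∈ s.powersetCard (k + 1), ∏ i ∈ t, x i ≤ τ * esymmOn k s x := by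
    intro t ht
    obtain ⟨i, hi, hle⟩ := h t ht
    obtain ⟨hts, htc⟩ := mem_powersetCard.1 ht
    rw [← mul_prod_erase t x hi]
    refine mul_le_mul hle ?_ (prod_nonneg fun j _ => hx j) hτ
    refine single_le_sum (f := fun t => ∏ j ∈ t, x j) (fun u _ => prod_nonneg fun j _ => hx j) ?_
    exact mem_powersetCard.2 ⟨(erase_subset i t).trans hts, by rw [card_erase_of_mem hi, htc]; rfl⟩
  calc esymmOn (k + 1) s x ≤ (s.powersetCard (k + 1)).card • (τ * esymmOn k s x) :=
        sum_le_card_nsmul _ _ _ h1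
    _ ≤ 2 ^ Fintype.card ι * (τ * esymmOn k s x) := by
        rw [nsmul_eq_mul]
        refine mul_le_mul_of_nonneg_right ?_ hE
        have : (s.powersetCard (k + 1)).card ≤ 2 ^ Fintype.card ι := by
          rw [← Finset.card_univ, ← card_powerset]
          exact card_le_card fun t ht => mem_powerset.2 (Finset.subset_univ t)
        exact_mod_cast this

omit [DecidableEq ι] in
-- If y is the smallest entry over t, then y^(k+2) ≤ F, because the extra factor x i₁ is at least y
-- as well.
theorem exists_mem_le_of_prod_le {x : ι → ℝ} (hx : ∀ i, 0 ≤ x i) {i₁ : ι} (h₁ : ∀ i, x i ≤ x i₁)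
    {F : ℝ} {k : ℕ} {t : Finset ι} (ht : t.card = k + 1)
    (h : x i₁ * ∏ i ∈ t, x i ≤ F) : ∃ i ∈ t, x i ≤ max 1 F := by
  have hne : t.Nonempty := card_pos.1 (by omega)
  obtain ⟨i, hi, hmin⟩ := t.exists_min_image x hne
  refine ⟨i, hi, ?_⟩
  by_contra! hlt
  have h1 : 1 < x i := (le_max_left _ _).trans_lt hlt
  have h2 : x i ^ (k + 1) ≤ ∏ j ∈ t, x j := by
    rw [← ht, ← prod_const]
    exact prod_le_prod (fun _ _ => hx i) fun j hj => hmin j hj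
  have h3 : x i ^ (k + 2) ≤ F := by
    rw [pow_succ']
    exact (mul_le_mul (h₁ i) h2 (pow_nonneg (hx i) _) (hx i₁)).trans h
  have h4 : x i ≤ x i ^ (k + 2) := le_self_pow₀ h1.le (by omega)
  linarith [le_max_right 1 F]

variable [Fintype ι]

/-- Away from the largest entry `x i₁`, elementary symmetric functions of consecutive degrees are
comparable, with constants that only depend on a bound for `σ_k`. -/
theorem esymmOn_succ_le_of_le {x : ι → ℝ} (hx : ∀ i, 0 ≤ x i) {i₁ : ι} (h₁ : ∀ i, x i ≤ x i₁)
    {F : ℝ} {j : ℕ} (hF : esymmOn (j + 2) univ x ≤ F) {s : Finset ι} (hs : i₁ ∉ s) :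
    esymmOn (j + 1) s x ≤ 2 ^ Fintype.card ι * (max 1 F * esymmOn j s x) := by
  refine esymmOn_le_of_exists_le hx (by positivity) j fun t ht => ?_
  obtain ⟨hts, htc⟩ := mem_powersetCard.1 ht
  have hi : i₁ ∉ t := fun h => hs (hts h)
  refine exists_mem_le_of_prod_le hx h₁ htc (le_trans ?_ hF)
  rw [← prod_insert hi]
  exact single_le_sum (f := fun t => ∏ j ∈ t, x j) (fun u _ => prod_nonneg fun j _ => hx j)
    (mem_powersetCard.2 ⟨Finset.subset_univ _, by rw [card_insert_of_notMem hi, htc]⟩)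

/-- The smallest factor of a monomial bounded by F is at most max 1 F. Here the degrees are one
higher than in `esymmOn_succ_le_of_le`, so the largest entry need not be excluded. -/
theorem esymmOn_succ_succ_le_of_le {x : ι → ℝ} (hx : ∀ i, 0 ≤ x i)
    {F : ℝ} {j : ℕ} (hF : esymmOn (j + 2) univ x ≤ F) (s : Finset ι) :
    esymmOn (j + 2) s x ≤ 2 ^ Fintype.card ι * (max 1 F * esymmOn (j + 1) s x) := by
  refine esymmOn_le_of_exists_le hx (by positivity) (j + 1) fun t ht => ?_
  obtain ⟨hts, htc⟩ := mem_powersetCard.1 ht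
  obtain ⟨i, hi, hmin⟩ := t.exists_min_image x (card_pos.1 (by omega))
  have hF' : ∏ i ∈ t, x i ≤ F :=
    (single_le_sum (f := fun t => ∏ j ∈ t, x j) (fun u _ => prod_nonneg fun j _ => hx j)
      (mem_powersetCard.2 ⟨Finset.subset_univ _, htc⟩)).trans hF
  refine ⟨i, hi, ?_⟩
  by_contra! hlt
  have h1 : 1 < x i := (le_max_left _ _).trans_lt hlt
  have h2 : x i ^ (j + 2) ≤ ∏ l ∈ t, x l := by
    rw [← htc, ← prod_const]
    exact prod_le_prod (fun _ _ => hx i) fun j hj => hmin j hj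
  have h4 : x i ≤ x i ^ (j + 2) := le_self_pow₀ h1.le (by omega)
  linarith [le_max_right 1 F]

theorem esymmOn_univ_split (i₁ : ι) (k : ℕ) (x : ι → ℝ) :
    esymmOn (k + 1) univ x
      = esymmOn (k + 1) (univ.erase i₁) x + x i₁ * esymmOn k (univ.erase i₁) x :=
  esymmOn_eq_erase (mem_univ i₁) k x

/-- Both formulas are read off from the jets of σ_{k+1}(x) = σ_{k+1}(x|i₁) + x_{i₁} σ_k(x|i₁). -/
theorem esymmOn_derivatives_split (i₁ : ι) (k : ℕ) (x ξ : ι → ℝ) :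
    esymmOnD (k + 1) univ x ξ = esymmOnD (k + 1) (univ.erase i₁) x ξ
        + x i₁ * esymmOnD k (univ.erase i₁) x ξ + ξ i₁ * esymmOn k (univ.erase i₁) x ∧
      esymmOnDD (k + 1) univ x ξ = esymmOnDD (k + 1) (univ.erase i₁) x ξ
        + x i₁ * esymmOnDD k (univ.erase i₁) x ξ + 2 * ξ i₁ * esymmOnD k (univ.erase i₁) x ξ := by
  have h1 := hasJet_esymmOn (k + 1) univ x ξ
  have h2 := (hasJet_esymmOn (k + 1) (univ.erase i₁) x ξ).add
    (((HasJet.const (x i₁)).add (HasJet.ident.mul (HasJet.const (ξ i₁)))).mul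
      (hasJet_esymmOn k (univ.erase i₁) x ξ))
  have h3 := h1.unique (h2.congr_fun (Eventually.of_forall fun t => by
    simp only; rw [esymmOn_univ_split i₁]))
  obtain ⟨-, h4, h5⟩ := h3
  simp only [zero_mul, mul_zero, add_zero, zero_add, one_mul] at h4 h5
  constructor
  · linarith
  · linarith

/-- Half of `σ_k` comes from the monomials that contain the largest entry, when that entry is
large. -/
theorem half_esymmOn_le {x : ι → ℝ} (hx : ∀ i, 0 ≤ x i) {i₁ : ι}
    {F : ℝ} {j : ℕ} (hF : esymmOn (j + 2) univ x ≤ F)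
    (hbig : 2 ^ Fintype.card ι * max 1 F ≤ x i₁) :
    esymmOn (j + 2) univ x ≤ 2 * (x i₁ * esymmOn (j + 1) (univ.erase i₁) x) := by
  have h := esymmOn_succ_succ_le_of_le hx hF (univ.erase i₁)
  have hA := esymmOn_nonneg hx (j + 1) (univ.erase i₁)
  have := mul_le_mul_of_nonneg_right hbig hA
  rw [esymmOn_univ_split i₁]
  nlinarith

/-- Young's inequality for y = (y + d) − d: the gap between 1 − ε and 1/(1 + ε/2) pays for the terms
in d. -/
theorem weighted_square_le {A x P ε y d : ℝ} (hA : 0 ≤ A) (hx : 0 < x) (hP : 0 ≤ P) (hε : 0 < ε)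
    (h : 2 * (d ^ 2 * A) ≤ ε * (x * P)) :
    (1 - ε) * (A * y ^ 2) / x ≤ A * (y + d) ^ 2 / ((1 + ε / 2) * x) + 2 * P := by
  have h4 : ε * ((1 - ε) * (1 + ε / 2) * y ^ 2) ≤ ε * (y + d) ^ 2 + 2 * d ^ 2 := by
    have : 0 ≤ (ε * y + 2 * d) ^ 2 / 2 + ε * (ε * y) ^ 2 / 2 + ε * d ^ 2 := by positivity
    linarith
  have h5 : (1 - ε) * (1 + ε / 2) * (A * y ^ 2) ≤ A * (y + d) ^ 2 + x * P := by
    refine le_of_mul_le_mul_left ?_ hε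
    linarith [mul_le_mul_of_nonneg_left h4 hA]
  have h6 : (1 - ε) * (A * y ^ 2) / x
      = (1 - ε) * (1 + ε / 2) * (A * y ^ 2) / ((1 + ε / 2) * x) := by
    field_simp
  have h7 : 2 * P = 2 * P * ((1 + ε / 2) * x) / ((1 + ε / 2) * x) := by field_simp
  rw [h6, h7, ← add_div]
  refine div_le_div_of_nonneg_right (h5.trans ?_) (by positivity)
  have : 0 ≤ x * P := by positivity
  have : 0 ≤ ε * (x * P) := by positivity
  linarith

/-- The quantity squared is the derivative of B/A along ξ. Its coefficients q_i are nonnegative by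
monotonicity of the quotient, so Cauchy–Schwarz with weights q_i applies. Then Σ q_i ≤ n, and q_i A
≤ σ_{j+1}(s∖i) is at most a constant times σ_j(s∖i). -/
theorem esymmQuot_derivative_sq_le {x : ι → ℝ} (hx : ∀ i, 0 ≤ x i) {i₁ : ι}
    (h₁ : ∀ i, x i ≤ x i₁) {F : ℝ} {j : ℕ} (hF : esymmOn (j + 2) univ x ≤ F)
    (hpos : 0 < esymmOn (j + 1) (univ.erase i₁) x) (ξ : ι → ℝ) :
    ((esymmOnD (j + 2) (univ.erase i₁) x ξ * esymmOn (j + 1) (univ.erase i₁) x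
        - esymmOn (j + 2) (univ.erase i₁) x * esymmOnD (j + 1) (univ.erase i₁) x ξ)
        / esymmOn (j + 1) (univ.erase i₁) x ^ 2) ^ 2 * esymmOn (j + 1) (univ.erase i₁) x
      ≤ Fintype.card ι * (2 ^ Fintype.card ι * max 1 F)
        * ∑ i ∈ univ.erase i₁, esymmOn j ((univ.erase i₁).erase i) x * ξ i ^ 2 := by
  set s := univ.erase i₁ with hs
  have hB0 := esymmOn_nonneg hx (j + 2) s
  have hDA : esymmOnD (j + 1) s x ξ = ∑ i ∈ s, ξ i * esymmOn j (s.erase i) x :=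
    esymmOnD_succ _ _ _ _
  have hDB : esymmOnD (j + 2) s x ξ = ∑ i ∈ s, ξ i * esymmOn (j + 1) (s.erase i) x :=
    esymmOnD_succ _ _ _ _
  set A := esymmOn (j + 1) s x with hAdef
  have hA : 0 < A := hpos
  set B := esymmOn (j + 2) s x with hBdef
  set P := ∑ i ∈ s, esymmOn j (s.erase i) x * ξ i ^ 2 with hP
  set d := (esymmOnD (j + 2) s x ξ * A - B * esymmOnD (j + 1) s x ξ) / A ^ 2 with hd
  set q : ι → ℝ := fun i =>
    (esymmOn (j + 1) (s.erase i) x * A - B * esymmOn j (s.erase i) x) / A ^ 2 with hq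
  have hq0 : ∀ i ∈ s, 0 ≤ q i := fun i hi =>
    div_nonneg (sub_nonneg.2 (esymmOn_mul_erase_le hx j hi)) (sq_nonneg A)
  have hq1 : ∀ i ∈ s, q i ≤ esymmOn (j + 1) (s.erase i) x / A := fun i hi => by
    rw [hq, div_le_div_iff₀ (by positivity) hA]
    have := mul_nonneg (mul_nonneg hB0 (esymmOn_nonneg hx j (s.erase i))) hA.le
    nlinarith
  have hdsum : d = ∑ i ∈ s, q i * ξ i := by
    rw [hd, hDA, hDB, sum_mul, mul_sum, ← sum_sub_distrib, sum_div]
    exact sum_congr rfl fun i _ => by rw [hq]; ring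
  have hcs : d ^ 2 ≤ (∑ i ∈ s, q i) * ∑ i ∈ s, q i * ξ i ^ 2 := by
    rw [hdsum]
    have := sum_mul_sq_le_sq_mul_sq s (fun i => √(q i)) fun i => √(q i) * ξ i
    have e1 : ∀ i ∈ s, √(q i) * (√(q i) * ξ i) = q i * ξ i := fun i hi => by
      rw [← mul_assoc, Real.mul_self_sqrt (hq0 i hi)]
    have e2 : ∀ i ∈ s, √(q i) ^ 2 = q i := fun i hi => Real.sq_sqrt (hq0 i hi)
    have e3 : ∀ i ∈ s, (√(q i) * ξ i) ^ 2 = q i * ξ i ^ 2 := fun i hi => by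
      rw [mul_pow, Real.sq_sqrt (hq0 i hi)]
    rwa [sum_congr rfl e1, sum_congr rfl e2, sum_congr rfl e3] at this
  have hsum1 : ∑ i ∈ s, q i ≤ Fintype.card ι := by
    refine (sum_le_sum hq1).trans ?_
    rw [← sum_div, div_le_iff₀ hA]
    refine (sum_esymmOn_erase_le hx (j + 1) s).trans ?_
    refine mul_le_mul_of_nonneg_right ?_ hA.le
    exact_mod_cast Finset.card_le_univ s
  have hsum2 : (∑ i ∈ s, q i * ξ i ^ 2) * A ≤ (2 ^ Fintype.card ι * max 1 F) * P := by
    rw [sum_mul, hP, mul_sum]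
    refine sum_le_sum fun i hi => ?_
    have h2 := esymmOn_succ_le_of_le hx h₁ hF (s := s.erase i) (by simp [hs])
    have h3 : q i * A ≤ esymmOn (j + 1) (s.erase i) x := by
      rw [← le_div_iff₀ hA]; exact hq1 i hi
    calc q i * ξ i ^ 2 * A = (q i * A) * ξ i ^ 2 := by ring
      _ ≤ ((2 ^ Fintype.card ι * max 1 F) * esymmOn j (s.erase i) x) * ξ i ^ 2 := by
          refine mul_le_mul_of_nonneg_right (h3.trans (h2.trans (le_of_eq ?_))) (sq_nonneg _)
          ring
      _ = _ := by ring
  have hsum0 : 0 ≤ ∑ i ∈ s, q i * ξ i ^ 2 :=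
    sum_nonneg fun i hi => mul_nonneg (hq0 i hi) (sq_nonneg _)
  calc d ^ 2 * A ≤ (∑ i ∈ s, q i) * (∑ i ∈ s, q i * ξ i ^ 2) * A :=
        mul_le_mul_of_nonneg_right hcs hA.le
    _ ≤ Fintype.card ι * (∑ i ∈ s, q i * ξ i ^ 2) * A :=
        mul_le_mul_of_nonneg_right (mul_le_mul_of_nonneg_right hsum1 hsum0) hA.le
    _ = Fintype.card ι * ((∑ i ∈ s, q i * ξ i ^ 2) * A) := by ring
    _ ≤ Fintype.card ι * ((2 ^ Fintype.card ι * max 1 F) * P) :=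
        mul_le_mul_of_nonneg_left hsum2 (Nat.cast_nonneg _)
    _ = _ := by ring

/-- The concavity inequality of Guan–Ren–Wang for `σ_k` at points with one large entry. -/
theorem esymmOn_concavity_inequality {x : ι → ℝ} (hx : ∀ i, 0 ≤ x i) {i₁ : ι}
    (h₁ : ∀ i, x i ≤ x i₁) {F ε : ℝ} {j : ℕ} (hF : esymmOn (j + 2) univ x ≤ F)
    (hpos : 0 < esymmOn (j + 2) univ x) (hε : 0 < ε)
    (hbig : 2 * Fintype.card ι * (2 ^ Fintype.card ι * max 1 F) ≤ ε * x i₁)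
    (ξ : ι → ℝ) :
    (1 - ε) * (esymmOn (j + 1) (univ.erase i₁) x * ξ i₁ ^ 2) / x i₁
      ≤ -esymmOnDD (j + 2) univ x ξ + esymmOnD (j + 2) univ x ξ ^ 2 / esymmOn (j + 2) univ x
        + 2 * (∑ i ∈ univ.erase i₁, esymmOn (j + 1) (univ.erase i) x * ξ i ^ 2) / x i₁ := by
  set s := univ.erase i₁ with hs
  set M : ℝ := 2 ^ Fintype.card ι * max 1 F with hM
  have hMpos : 0 < M := by positivity
  have hn : (1 : ℝ) ≤ Fintype.card ι := by
    have : 0 < Fintype.card ι := Fintype.card_pos_iff.2 ⟨i₁⟩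
    exact_mod_cast this
  have hxpos : 0 < x i₁ := by
    have : 0 < ε * x i₁ := lt_of_lt_of_le (by positivity) hbig
    exact pos_of_mul_pos_right this hε.le
  have hsplit := esymmOn_univ_split i₁ (j + 1) x
  obtain ⟨hD, hDD⟩ := esymmOn_derivatives_split i₁ (j + 1) x ξ
  rw [← hs] at hsplit hD hDD
  have hA0 := esymmOn_nonneg hx (j + 1) s
  have hB0 := esymmOn_nonneg hx (j + 2) s
  have hA : 0 < esymmOn (j + 1) s x := by
    refine lt_of_le_of_ne hA0 fun h => ?_
    have := esymmOn_succ_eq_zero hx h.symm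
    rw [hsplit, this, ← h] at hpos
    simp at hpos
  have hcard : j + 1 ≤ s.card := by
    by_contra! h
    rw [esymmOn_eq_zero_of_card_lt x h] at hA
    exact lt_irrefl _ hA
  have hlog := esymmOn_log_concave hx ξ (j + 1) hcard
  have hquot := esymmQuot_concave hx ξ (j + 1) hcard
  have hBle : esymmOn (j + 2) s x ≤ M * esymmOn (j + 1) s x := by
    have := esymmOn_succ_succ_le_of_le hx hF s
    rw [hM]; linarith
  set A := esymmOn (j + 1) s x with hAdef
  set B := esymmOn (j + 2) s x with hBdef
  set P := ∑ i ∈ s, esymmOn j (s.erase i) x * ξ i ^ 2 with hP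
  have hPnn : 0 ≤ P := sum_nonneg fun i _ => mul_nonneg (esymmOn_nonneg hx _ _) (sq_nonneg _)
  set d := (esymmOnD (j + 2) s x ξ * A - B * esymmOnD (j + 1) s x ξ) / A ^ 2 with hd
  have hdle : d ^ 2 * A ≤ Fintype.card ι * M * P :=
    esymmQuot_derivative_sq_le hx h₁ hF hA ξ
  have hlast : P ≤ (∑ i ∈ s, esymmOn (j + 1) (univ.erase i) x * ξ i ^ 2) / x i₁ := by
    rw [le_div_iff₀ hxpos, hP, sum_mul]
    refine sum_le_sum fun i hi => ?_
    have hi' : i₁ ∈ univ.erase i := mem_erase.2 ⟨(ne_of_mem_erase hi).symm, mem_univ _⟩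
    have h1 := esymmOn_eq_erase hi' j x
    have h2 : (univ.erase i).erase i₁ = s.erase i := by rw [hs, erase_right_comm]
    rw [h2] at h1
    have := esymmOn_nonneg hx (j + 1) (s.erase i)
    calc esymmOn j (s.erase i) x * ξ i ^ 2 * x i₁
        = (x i₁ * esymmOn j (s.erase i) x) * ξ i ^ 2 := by ring
      _ ≤ _ := mul_le_mul_of_nonneg_right (by linarith) (sq_nonneg _)
  have hσ : esymmOn (j + 2) univ x = B + x i₁ * A := hsplit
  have hden : 0 < B + x i₁ * A := by rw [← hσ]; exact hpos
  have hmain : A ^ 2 * (ξ i₁ + d) ^ 2 / (B + x i₁ * A)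
      ≤ -esymmOnDD (j + 2) univ x ξ + esymmOnD (j + 2) univ x ξ ^ 2 / esymmOn (j + 2) univ x := by
    rw [hσ, hD, hDD]
    set a := esymmOnD (j + 1) s x ξ
    set b := esymmOnD (j + 2) s x ξ
    set α := esymmOnDD (j + 1) s x ξ
    set β := esymmOnDD (j + 2) s x ξ
    -- Up to positive factors, the defect is minus the second derivative of B/A plus the
    -- log-concavity defect of A.
    have hid : -(β + x i₁ * α + 2 * ξ i₁ * a) + (b + x i₁ * a + ξ i₁ * A) ^ 2 / (B + x i₁ * A)
        - A ^ 2 * (ξ i₁ + d) ^ 2 / (B + x i₁ * A)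
        = -(A ^ 2 * β - 2 * A * a * b - A * B * α + 2 * B * a ^ 2) / A ^ 2
          + (B + x i₁ * A) * (a ^ 2 - A * α) / A ^ 2 := by
      rw [hd]; field_simp; ring
    have p1 : 0 ≤ -(A ^ 2 * β - 2 * A * a * b - A * B * α + 2 * B * a ^ 2) / A ^ 2 :=
      div_nonneg (by linarith) (by positivity)
    have p2 : 0 ≤ (B + x i₁ * A) * (a ^ 2 - A * α) / A ^ 2 :=
      div_nonneg (mul_nonneg hden.le (by linarith)) (by positivity)
    linarith
  -- Since B ≤ M A and M ≤ (ε/2) x i₁, σ_k exceeds x i₁ A by a factor of at most 1 + ε/2.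
  have hq : B + x i₁ * A ≤ (1 + ε / 2) * x i₁ * A := by
    have h2 : M ≤ ε / 2 * x i₁ := by nlinarith
    nlinarith
  have hfin : (1 - ε) * (A * ξ i₁ ^ 2) / x i₁
      ≤ A ^ 2 * (ξ i₁ + d) ^ 2 / (B + x i₁ * A) + 2 * P := by
    have h1 : A * (ξ i₁ + d) ^ 2 / ((1 + ε / 2) * x i₁) ≤ A ^ 2 * (ξ i₁ + d) ^ 2 / (B + x i₁ * A) := by
      rw [div_le_div_iff₀ (by positivity) hden]
      have : 0 ≤ A * (ξ i₁ + d) ^ 2 := by positivity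
      calc A * (ξ i₁ + d) ^ 2 * (B + x i₁ * A)
          ≤ A * (ξ i₁ + d) ^ 2 * ((1 + ε / 2) * x i₁ * A) := mul_le_mul_of_nonneg_left hq this
        _ = _ := by ring
    have h3 : 2 * (d ^ 2 * A) ≤ ε * (x i₁ * P) := by
      calc 2 * (d ^ 2 * A) ≤ 2 * (Fintype.card ι * M * P) :=
            mul_le_mul_of_nonneg_left hdle zero_le_two
        _ = (2 * Fintype.card ι * M) * P := by ring
        _ ≤ ε * x i₁ * P := mul_le_mul_of_nonneg_right hbig hPnn
        _ = _ := by ring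
    linarith [weighted_square_le hA.le hxpos hPnn hε h3 (y := ξ i₁)]
  have e2 : 2 * (∑ i ∈ s, esymmOn (j + 1) (univ.erase i) x * ξ i ^ 2) / x i₁
      = 2 * ((∑ i ∈ s, esymmOn (j + 1) (univ.erase i) x * ξ i ^ 2) / x i₁) := by ring
  rw [e2]
  linarith

end ConcavityInequality

/-! ### Algebra of the estimate at the maximum point -/

section MaximumPointAlgebra

open Finset

variable {ι : Type*} [DecidableEq ι] [Fintype ι]

/-- Choice of the variation of the direction in the second order condition. -/
theorem second_order_condition_of_variation {κ : ι → ℝ} (hκ : ∀ i, 0 ≤ κ i) {i₁ : ι}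
    (hpos : 0 < κ i₁) {τ : ι → ℝ} {R : ℝ}
    (h : ∀ ζ : ι → ℝ, ζ i₁ = 0 →
      (4 * ∑ p, τ p * ζ p + 2 * ∑ p, κ p * ζ p ^ 2) / κ i₁ - 2 * ∑ p, ζ p ^ 2 ≤ R) :
    2 * (∑ p ∈ univ.erase i₁, τ p ^ 2) / κ i₁ ^ 2 ≤ R := by
  -- The quadratic expression would be maximal at τ p / (κ i₁ − κ p), which is singular for multiple
  -- curvatures. Dividing by κ i₁ instead loses only a nonnegative term.
  refine le_trans ?_ (h (fun p => if p = i₁ then 0 else τ p / κ i₁) (by simp))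
  have e : ∀ f : ι → ℝ, f i₁ = 0 → ∑ p, f p = ∑ p ∈ univ.erase i₁, f p := fun f hf => by
    rw [← add_sum_erase _ _ (mem_univ i₁), hf, zero_add]
  rw [e _ (by simp), e (fun p => κ p * _) (by simp), e (fun p => _ ^ 2) (by simp)]
  have c1 : ∑ p ∈ univ.erase i₁, τ p * (if p = i₁ then 0 else τ p / κ i₁)
      = (∑ p ∈ univ.erase i₁, τ p ^ 2) / κ i₁ := by
    rw [sum_div]
    exact sum_congr rfl fun p hp => by rw [if_neg (ne_of_mem_erase hp)]; ring
  have c2 : ∑ p ∈ univ.erase i₁, (if p = i₁ then 0 else τ p / κ i₁) ^ 2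
      = (∑ p ∈ univ.erase i₁, τ p ^ 2) / κ i₁ ^ 2 := by
    rw [sum_div]
    exact sum_congr rfl fun p hp => by rw [if_neg (ne_of_mem_erase hp)]; ring
  have c3 : 0 ≤ ∑ p ∈ univ.erase i₁, κ p * (if p = i₁ then 0 else τ p / κ i₁) ^ 2 :=
    sum_nonneg fun p _ => mul_nonneg (hκ p) (sq_nonneg _)
  rw [c1, c2, add_div]
  have c4 := div_nonneg (mul_nonneg zero_le_two c3) hpos.le
  have c5 : 4 * ((∑ p ∈ univ.erase i₁, τ p ^ 2) / κ i₁) / κ i₁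
      = 4 * ((∑ p ∈ univ.erase i₁, τ p ^ 2) / κ i₁ ^ 2) := by field_simp
  rw [c5]
  have c6 : 2 * (∑ p ∈ univ.erase i₁, τ p ^ 2) / κ i₁ ^ 2
    = 2 * ((∑ p ∈ univ.erase i₁, τ p ^ 2) / κ i₁ ^ 2) := by ring
  linarith

/-- The third order terms: gradient terms with `p ≠ i₁`. -/
theorem sum_gradient_terms_le {κ : ι → ℝ} (hκ : ∀ i, 0 ≤ κ i) {i₁ : ι} (hpos : 0 < κ i₁) (j : ℕ)
    {T : ι → ι → ι → ℝ} (hT2 : ∀ a b c, T a b c = T a c b) :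
    (∑ p ∈ univ.erase i₁, esymmOn (j + 1) (univ.erase p) κ * T i₁ i₁ p ^ 2) / κ i₁ ^ 2
      ≤ (∑ p, ∑ q ∈ univ.erase p, T p q i₁ ^ 2 * esymmOn j ((univ.erase p).erase q) κ) / κ i₁
        + 2 * (esymmOn (j + 1) (univ.erase i₁) κ * ∑ p ∈ univ.erase i₁, T i₁ i₁ p ^ 2)
          / κ i₁ ^ 2 := by
  set S := ∑ p ∈ univ.erase i₁, esymmOn j ((univ.erase i₁).erase p) κ * T i₁ i₁ p ^ 2 with hS
  have hSnn : 0 ≤ S := sum_nonneg fun p _ => mul_nonneg (esymmOn_nonneg hκ _ _) (sq_nonneg _)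
  have h1 : S ≤ ∑ p, ∑ q ∈ univ.erase p, T p q i₁ ^ 2 * esymmOn j ((univ.erase p).erase q) κ := by
    have hnn : ∀ p, 0 ≤ ∑ q ∈ univ.erase p,
        T p q i₁ ^ 2 * esymmOn j ((univ.erase p).erase q) κ := fun p =>
      sum_nonneg fun q _ => mul_nonneg (sq_nonneg _) (esymmOn_nonneg hκ _ _)
    refine le_trans (le_of_eq ?_) (single_le_sum (fun p _ => hnn p) (mem_univ i₁))
    rw [hS]
    refine sum_congr rfl fun p _ => ?_
    rw [hT2 i₁ p i₁]; ring
  -- σ^{pp} = σ_{j+1}(κ|p, i₁) + κ i₁ σ_j(κ|p, i₁): the first part is at most σ^{i₁i₁}, the second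
  -- matches the off-diagonal terms S.
  have h2 : ∑ p ∈ univ.erase i₁, esymmOn (j + 1) (univ.erase p) κ * T i₁ i₁ p ^ 2
      ≤ esymmOn (j + 1) (univ.erase i₁) κ * (∑ p ∈ univ.erase i₁, T i₁ i₁ p ^ 2) + κ i₁ * S := by
    rw [hS, mul_sum, mul_sum, ← sum_add_distrib]
    refine sum_le_sum fun p hp => ?_
    have hp' : i₁ ∈ univ.erase p := mem_erase.2 ⟨(ne_of_mem_erase hp).symm, mem_univ _⟩
    rw [esymmOn_eq_erase hp' j κ, erase_right_comm]
    have := esymmOn_mono_set hκ (j + 1) (erase_subset p (univ.erase i₁))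
    have := mul_le_mul_of_nonneg_right this (sq_nonneg (T i₁ i₁ p))
    linarith
  have h3 : 0 ≤ esymmOn (j + 1) (univ.erase i₁) κ * ∑ p ∈ univ.erase i₁, T i₁ i₁ p ^ 2 :=
    mul_nonneg (esymmOn_nonneg hκ _ _) (sum_nonneg fun p _ => sq_nonneg _)
  have h4 := div_le_div_of_nonneg_right h2 (sq_nonneg (κ i₁))
  have h5 := div_le_div_of_nonneg_right h1 hpos.le
  rw [add_div] at h4
  have h6 : κ i₁ * S / κ i₁ ^ 2 = S / κ i₁ := by field_simp
  have h7 := div_nonneg h3 (sq_nonneg (κ i₁))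
  rw [h6] at h4
  rw [mul_div_assoc]
  linarith

omit [DecidableEq ι] in
theorem weighted_sum_split (c Q S E K D κ L : ι → ℝ) (k u N : ℝ) :
    ∑ i, c i * (Q i / k + 2 * S i / k ^ 2 - (1 - N⁻¹) * (E i / k ^ 2) + (N - 1) * K i - D i
      - N * (κ i - L i) / u)
    = (∑ i, c i * Q i) / k + 2 * (∑ i, c i * S i) / k ^ 2
      - (1 - N⁻¹) * ((∑ i, c i * E i) / k ^ 2) + (N - 1) * ∑ i, c i * K i - ∑ i, c i * D i
      - N * (∑ i, c i * κ i - ∑ i, c i * L i) / u := by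
  rw [← sum_sub_distrib]
  simp only [mul_sum, sum_div, ← sum_add_distrib, ← sum_sub_distrib]
  exact sum_congr rfl fun i _ => by ring

set_option maxHeartbeats 1000000 in
/-- The curvature bound at the maximum point, from the first and second order conditions and the
twice differentiated equation. -/
theorem largest_le_of_maximum_conditions {κ : ι → ℝ} (hκ : ∀ i, 0 ≤ κ i) {i₁ : ι}
    (h₁ : ∀ i, κ i ≤ κ i₁) {j : ℕ} {T : ι → ι → ι → ℝ} (hT1 : ∀ a b c, T a b c = T b a c)
    (hT2 : ∀ a b c, T a b c = T a c b) {Q z g gX φ : ι → ℝ} {N u r m F G F₁₁ : ℝ}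
    (hm : 0 < m) (hr : 0 < r) (hu : r ≤ u) (hF : 0 < F)
    (hN : 2 * F + F ^ 2 / m + 1 ≤ (N - 1) * (m / 2))
    (hσm : m ≤ esymmOn (j + 2) univ κ) (hσF : esymmOn (j + 2) univ κ ≤ F)
    (hbig1 : 2 ^ Fintype.card ι * max 1 F ≤ κ i₁)
    (hbig2 : 2 * Fintype.card ι * (2 ^ Fintype.card ι * max 1 F) ≤ N⁻¹ * κ i₁)
    (hcrit : ∀ i, T i₁ i₁ i / κ i₁ + N * (z i * κ i) / u = 0)
    (hsec : ∀ i, ∀ ζ : ι → ℝ, ζ i₁ = 0 →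
      (Q i + 4 * ∑ p, T i₁ p i * ζ p + 2 * ∑ p, κ p * ζ p ^ 2) / κ i₁
        - T i₁ i₁ i ^ 2 / κ i₁ ^ 2 - κ i ^ 2 - 2 * ∑ p, ζ p ^ 2
        - (if i = i₁ then 2 * κ i₁ ^ 2 else 0)
        - N * ((κ i - ∑ s, z s * T i i s - κ i ^ 2 * u) / u - (z i * κ i) ^ 2 / u ^ 2) ≤ 0)
    (hD : ∀ s, ∑ i, esymmOn (j + 1) (univ.erase i) κ * T i i s = g s)
    (hDD : ∑ i, esymmOn (j + 1) (univ.erase i) κ * (Q i - κ i * κ i₁ ^ 2)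
        - 2 * esymmOn (j + 1) (univ.erase i₁) κ * κ i₁ ^ 3
        + ∑ p, ∑ q ∈ univ.erase p, (T p p i₁ * T q q i₁ - T p q i₁ ^ 2)
          * esymmOn j ((univ.erase p).erase q) κ = F₁₁)
    (hg : ∀ s, g s = gX s + κ s * φ s)
    (hF₁₁ : -(2 * F * κ i₁ ^ 2) + ∑ s, T i₁ i₁ s * φ s ≤ F₁₁)
    (hg₁ : |g i₁| ≤ F * κ i₁) (hG : -G ≤ ∑ s, z s * gX s) (hG0 : 0 ≤ G) :
    κ i₁ ≤ N * ((j + 2) * F + G) / r := by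
  have hκ1 : 0 < κ i₁ := lt_of_lt_of_le (by positivity) hbig1
  have hN1 : 1 < N := by
    have : 0 < (N - 1) * (m / 2) := lt_of_lt_of_le (by positivity) hN
    nlinarith
  have hN0 : 0 < N := by linarith
  have hupos : 0 < u := hr.trans_le hu
  set c : ι → ℝ := fun i => esymmOn (j + 1) (univ.erase i) κ with hc
  have hc0 : ∀ i, 0 ≤ c i := fun i => esymmOn_nonneg hκ _ _
  set σ := esymmOn (j + 2) univ κ with hσ
  have hσpos : 0 < σ := hm.trans_le hσm
  set ξ : ι → ℝ := fun i => T i i i₁ with hξ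
  -- second order conditions after the choice of the variation
  have hsec' : ∀ i, Q i / κ i₁ + 2 * (∑ p ∈ univ.erase i₁, T i₁ p i ^ 2) / κ i₁ ^ 2
      - (1 - N⁻¹) * (T i₁ i₁ i ^ 2 / κ i₁ ^ 2) + (N - 1) * κ i ^ 2
      - (if i = i₁ then 2 * κ i₁ ^ 2 else 0) - N * (κ i - ∑ s, z s * T i i s) / u ≤ 0 := by
    intro i
    have hv := second_order_condition_of_variation hκ hκ1 (τ := fun p => T i₁ p i)
      (R := -(Q i / κ i₁ - T i₁ i₁ i ^ 2 / κ i₁ ^ 2 - κ i ^ 2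
        - (if i = i₁ then 2 * κ i₁ ^ 2 else 0)
        - N * ((κ i - ∑ s, z s * T i i s - κ i ^ 2 * u) / u - (z i * κ i) ^ 2 / u ^ 2)))
      (fun ζ hζ => by
        have := hsec i ζ hζ
        rw [add_assoc, add_div] at this
        linarith)
    -- By criticality the positive square coming from log u is 1/N times the square coming from log
    -- κ i₁, which lowers the coefficient of the latter to 1 − 1/N.
    have e1 : N * ((z i * κ i) ^ 2 / u ^ 2) = N⁻¹ * (T i₁ i₁ i ^ 2 / κ i₁ ^ 2) := by
      have h1 : z i * κ i / u = -(N⁻¹ * (T i₁ i₁ i / κ i₁)) := by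
        have := hcrit i
        rw [mul_div_assoc] at this
        field_simp
        field_simp at this
        linarith
      rw [← div_pow, h1, ← div_pow]
      field_simp
    have e2 : N * ((κ i - ∑ s, z s * T i i s - κ i ^ 2 * u) / u - (z i * κ i) ^ 2 / u ^ 2)
        = N * (κ i - ∑ s, z s * T i i s) / u - N * κ i ^ 2
          - N⁻¹ * (T i₁ i₁ i ^ 2 / κ i₁ ^ 2) := by
      rw [← e1]; field_simp
    rw [e2] at hv
    linarith
  -- weighted sum
  have hsum : ∑ i, c i * (Q i / κ i₁ + 2 * (∑ p ∈ univ.erase i₁, T i₁ p i ^ 2) / κ i₁ ^ 2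
      - (1 - N⁻¹) * (T i₁ i₁ i ^ 2 / κ i₁ ^ 2) + (N - 1) * κ i ^ 2
      - (if i = i₁ then 2 * κ i₁ ^ 2 else 0) - N * (κ i - ∑ s, z s * T i i s) / u) ≤ 0 :=
    sum_nonpos fun i _ => mul_nonpos_of_nonneg_of_nonpos (hc0 i) (hsec' i)
  have hsplit : ∑ i, c i * (Q i / κ i₁ + 2 * (∑ p ∈ univ.erase i₁, T i₁ p i ^ 2) / κ i₁ ^ 2
      - (1 - N⁻¹) * (T i₁ i₁ i ^ 2 / κ i₁ ^ 2) + (N - 1) * κ i ^ 2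
      - (if i = i₁ then 2 * κ i₁ ^ 2 else 0) - N * (κ i - ∑ s, z s * T i i s) / u)
      = (∑ i, c i * Q i) / κ i₁
        + 2 * (∑ i, c i * ∑ p ∈ univ.erase i₁, T i₁ p i ^ 2) / κ i₁ ^ 2
        - (1 - N⁻¹) * ((∑ i, c i * T i₁ i₁ i ^ 2) / κ i₁ ^ 2) + (N - 1) * ∑ i, c i * κ i ^ 2
        - c i₁ * (2 * κ i₁ ^ 2) - N * (∑ i, c i * κ i - ∑ s, z s * g s) / u := by
    have e1 : ∑ i, c i * (if i = i₁ then 2 * κ i₁ ^ 2 else 0) = c i₁ * (2 * κ i₁ ^ 2) := by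
      simp
    have e2 : ∑ s, z s * g s = ∑ i, c i * ∑ s, z s * T i i s := by
      simp_rw [← hD, mul_sum]
      rw [sum_comm]
      exact sum_congr rfl fun i _ => sum_congr rfl fun s _ => by rw [hc]; ring
    rw [← e1, e2]
    exact weighted_sum_split _ _ _ _ _ _ _ _ _ _ _
  rw [hsplit] at hsum
  have hk : ∑ i, c i * κ i = (j + 2) * σ := by
    have := sum_mul_esymmOn_erase (j + 1) univ κ
    rw [hσ]
    push_cast at this
    rw [sum_congr rfl fun i _ => mul_comm (c i) (κ i), this]; ring
  -- the equation
  have hQ : ∑ i, c i * Q i = F₁₁ + (j + 2) * σ * κ i₁ ^ 2 + 2 * c i₁ * κ i₁ ^ 3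
      - esymmOnDD (j + 2) univ κ ξ
      + ∑ p, ∑ q ∈ univ.erase p, T p q i₁ ^ 2 * esymmOn j ((univ.erase p).erase q) κ := by
    have e1 : ∑ i, c i * (Q i - κ i * κ i₁ ^ 2) = ∑ i, c i * Q i - (j + 2) * σ * κ i₁ ^ 2 := by
      rw [← hk, sum_mul, ← sum_sub_distrib]
      exact sum_congr rfl fun i _ => by ring
    have e2 : ∑ p, ∑ q ∈ univ.erase p, (T p p i₁ * T q q i₁ - T p q i₁ ^ 2)
          * esymmOn j ((univ.erase p).erase q) κ = esymmOnDD (j + 2) univ κ ξ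
          - ∑ p, ∑ q ∈ univ.erase p, T p q i₁ ^ 2 * esymmOn j ((univ.erase p).erase q) κ := by
      rw [esymmOnDD_succ_succ, ← sum_sub_distrib]
      refine sum_congr rfl fun p _ => ?_
      rw [← sum_sub_distrib]
      exact sum_congr rfl fun q _ => by ring
    rw [e1, e2] at hDD
    linarith
  -- third order terms
  have hgain : c i₁ * (∑ p ∈ univ.erase i₁, T i₁ i₁ p ^ 2)
      + ∑ i ∈ univ.erase i₁, c i * ξ i ^ 2
      ≤ ∑ i, c i * ∑ p ∈ univ.erase i₁, T i₁ p i ^ 2 := by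
    rw [← add_sum_erase _ _ (mem_univ i₁)]
    refine add_le_add (le_of_eq ?_) (sum_le_sum fun i hi => ?_)
    · congr 1
      exact sum_congr rfl fun p _ => by rw [hT2 i₁ p i₁]
    · refine mul_le_mul_of_nonneg_left ?_ (hc0 i)
      have := single_le_sum (f := fun p => T i₁ p i ^ 2) (fun p _ => sq_nonneg _) hi
      refine le_trans (le_of_eq ?_) this
      simp only [hξ]
      rw [hT2 i i i₁, hT1 i i₁ i]
  have hgrad := sum_gradient_terms_le hκ hκ1 j hT2
  -- The choice ε = 1/N makes the concavity gain match the factor 1 − 1/N in front of the term with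
  -- i = i₁.
  have hconc := esymmOn_concavity_inequality hκ h₁ hσF hσpos (ε := N⁻¹) (by positivity) hbig2 ξ
  have hξD : esymmOnD (j + 2) univ κ ξ = g i₁ := by
    rw [esymmOnD_succ, ← hD]
    exact sum_congr rfl fun i _ => mul_comm _ _
  rw [hξD] at hconc
  have hηsplit : ∑ i, c i * T i₁ i₁ i ^ 2 = c i₁ * ξ i₁ ^ 2
      + ∑ p ∈ univ.erase i₁, c p * T i₁ i₁ p ^ 2 := by
    rw [← add_sum_erase _ _ (mem_univ i₁)]
  have hgnn : 0 ≤ ∑ p ∈ univ.erase i₁, c p * T i₁ i₁ p ^ 2 :=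
    sum_nonneg fun p _ => mul_nonneg (hc0 p) (sq_nonneg _)
  -- The concavity inequality handles i = i₁, its error term being absorbed by the variation gain
  -- with i ≠ i₁. The remaining gain and the off-diagonal second derivative handle the squares T i₁
  -- i₁ p with p ≠ i₁.
  have hthird : -(g i₁ ^ 2 / σ) / κ i₁ ≤ (-esymmOnDD (j + 2) univ κ ξ
      + ∑ p, ∑ q ∈ univ.erase p, T p q i₁ ^ 2 * esymmOn j ((univ.erase p).erase q) κ) / κ i₁
      + 2 * (∑ i, c i * ∑ p ∈ univ.erase i₁, T i₁ p i ^ 2) / κ i₁ ^ 2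
      - (1 - N⁻¹) * ((∑ i, c i * T i₁ i₁ i ^ 2) / κ i₁ ^ 2) := by
    have a1 := div_le_div_of_nonneg_right hconc hκ1.le
    have a2 := div_le_div_of_nonneg_right
      (mul_le_mul_of_nonneg_left hgain zero_le_two) (sq_nonneg (κ i₁))
    have a3 : (1 - N⁻¹) * ((∑ p ∈ univ.erase i₁, c p * T i₁ i₁ p ^ 2) / κ i₁ ^ 2)
        ≤ (∑ p ∈ univ.erase i₁, c p * T i₁ i₁ p ^ 2) / κ i₁ ^ 2 := by
      have b1 : 0 ≤ (∑ p ∈ univ.erase i₁, c p * T i₁ i₁ p ^ 2) / κ i₁ ^ 2 := by positivity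
      have b2 : 0 < N⁻¹ := by positivity
      nlinarith
    rw [hηsplit]
    rw [mul_add, add_div] at a2
    rw [add_div, add_div] at a1
    have b1 : (1 - N⁻¹) * (esymmOn (j + 1) (univ.erase i₁) κ * ξ i₁ ^ 2) / κ i₁ / κ i₁
        = (1 - N⁻¹) * (c i₁ * ξ i₁ ^ 2 / κ i₁ ^ 2) := by rw [hc]; field_simp
    have b2 : 2 * (∑ i ∈ univ.erase i₁, esymmOn (j + 1) (univ.erase i) κ * ξ i ^ 2) / κ i₁ / κ i₁
        = 2 * (∑ i ∈ univ.erase i₁, c i * ξ i ^ 2) / κ i₁ ^ 2 := by rw [hc]; field_simp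
    rw [b1, b2] at a1
    rw [add_div (c i₁ * ξ i₁ ^ 2), mul_add, neg_div, add_div]
    linarith
  -- the zeroth order terms
  have hcκ : κ i₁ * (m / 2) ≤ ∑ i, c i * κ i ^ 2 := by
    have a1 := half_esymmOn_le hκ hσF hbig1
    have a2 : c i₁ * κ i₁ ^ 2 ≤ ∑ i, c i * κ i ^ 2 :=
      single_le_sum (f := fun i => c i * κ i ^ 2)
        (fun i _ => mul_nonneg (hc0 i) (sq_nonneg _)) (mem_univ i₁)
    have a3 : m / 2 ≤ κ i₁ * c i₁ := by rw [hc]; linarith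
    nlinarith [mul_le_mul_of_nonneg_left a3 hκ1.le]
  have hNcκ : κ i₁ * (2 * F + F ^ 2 / m + 1) ≤ (N - 1) * ∑ i, c i * κ i ^ 2 := by
    have a1 := mul_le_mul_of_nonneg_left hcκ (by linarith : 0 ≤ N - 1)
    have a2 := mul_le_mul_of_nonneg_left hN hκ1.le
    linarith
  -- By criticality the third derivatives multiplying φ, the ν-gradient of f, turn into a term that
  -- cancels the φ part of Σ z_s g_s; no bound on it is needed.
  have hF1 : -(2 * F * κ i₁) - N * (∑ s, z s * (κ s * φ s)) / u ≤ F₁₁ / κ i₁ := by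
    have a1 := div_le_div_of_nonneg_right hF₁₁ hκ1.le
    refine le_trans (le_of_eq ?_) a1
    rw [add_div, sum_div, mul_sum, sum_div, sub_eq_add_neg, ← sum_neg_distrib]
    congr 1
    · field_simp
    · refine sum_congr rfl fun s _ => ?_
      have e1 : T i₁ i₁ s / κ i₁ = -(N * (z s * κ s) / u) := by linarith [hcrit s]
      rw [show T i₁ i₁ s * φ s / κ i₁ = T i₁ i₁ s / κ i₁ * φ s by ring, e1]; ring
  have hzg : ∑ s, z s * g s = ∑ s, z s * gX s + ∑ s, z s * (κ s * φ s) := by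
    rw [← sum_add_distrib]
    exact sum_congr rfl fun s _ => by rw [hg]; ring
  have hg2 : g i₁ ^ 2 / σ / κ i₁ ≤ F ^ 2 / m * κ i₁ := by
    have a1 : g i₁ ^ 2 ≤ (F * κ i₁) ^ 2 := sq_le_sq' (by linarith [(abs_le.1 hg₁).1])
      (abs_le.1 hg₁).2
    have a2 : g i₁ ^ 2 / σ ≤ (F * κ i₁) ^ 2 / m := div_le_div₀ (by positivity) a1 hm hσm
    refine (div_le_div_of_nonneg_right a2 hκ1.le).trans (le_of_eq ?_)
    field_simp
  rw [hk, hQ, hzg] at hsum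
  have hfin : κ i₁ ≤ N * ((j + 2) * σ - ∑ s, z s * gX s) / u := by
    have e1 : (F₁₁ + (j + 2) * σ * κ i₁ ^ 2 + 2 * c i₁ * κ i₁ ^ 3 - esymmOnDD (j + 2) univ κ ξ
        + ∑ p, ∑ q ∈ univ.erase p, T p q i₁ ^ 2 * esymmOn j ((univ.erase p).erase q) κ) / κ i₁
        = F₁₁ / κ i₁ + (j + 2) * σ * κ i₁ + c i₁ * (2 * κ i₁ ^ 2)
          + (-esymmOnDD (j + 2) univ κ ξ
            + ∑ p, ∑ q ∈ univ.erase p, T p q i₁ ^ 2 * esymmOn j ((univ.erase p).erase q) κ)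
            / κ i₁ := by
      field_simp; ring
    rw [e1] at hsum
    have e2 : N * ((j + 2) * σ - (∑ s, z s * gX s + ∑ s, z s * (κ s * φ s))) / u
        = N * ((j + 2) * σ - ∑ s, z s * gX s) / u - N * (∑ s, z s * (κ s * φ s)) / u := by
      ring
    rw [e2] at hsum
    have p1 : 0 ≤ (j + 2) * σ * κ i₁ := by positivity
    rw [neg_div] at hthird
    linarith
  refine hfin.trans (div_le_div₀ (by positivity) ?_ hr hu)
  refine mul_le_mul_of_nonneg_left ?_ hN0.le
  have : ((j : ℝ) + 2) * σ ≤ (j + 2) * F := mul_le_mul_of_nonneg_left hσF (by positivity)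
  linarith

end MaximumPointAlgebra

/-! ### Sums of principal minors near a diagonal matrix -/

section PrincipalMinors

open Finset Matrix

variable {ι : Type*} [DecidableEq ι] [Fintype ι]

omit [Fintype ι] in
-- Near a diagonal matrix each off-diagonal entry costs a factor t, so at second order only
-- permutations moving at most two indices contribute to the determinant.
theorem perm_eq_one_or_swap {σ : Equiv.Perm ι} {i j : ι} (h : ∀ l, l ≠ i → l ≠ j → σ l = l) :
    σ = 1 ∨ σ = Equiv.swap i j := by
  by_cases hi : σ i = i
  · left
    ext l
    by_cases h1 : l = i
    · subst h1; simpa using hi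
    by_cases h2 : l = j
    · subst h2
      by_contra hne
      simp only [Equiv.Perm.coe_one, id_eq] at hne
      have h3 : σ l ≠ i := fun h4 => h1 (σ.injective (h4.trans hi.symm))
      exact hne (σ.injective (h _ h3 hne))
    · simpa using h l h1 h2
  · right
    have h1 : σ i = j := by
      by_contra hne
      exact hi (σ.injective (h _ hi hne))
    have hij : i ≠ j := fun e => hi (by rw [h1, e])
    have h2 : σ j = i := by
      by_contra hne
      have h3 : σ j ≠ j := fun h4 => hij (σ.injective (h1.trans h4.symm))
      exact h3 (σ.injective (h _ hne h3))
    ext l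
    by_cases e1 : l = i
    · subst e1; simp [h1]
    by_cases e2 : l = j
    · subst e2; simp [h2]
    · rw [h l e1 e2, Equiv.swap_apply_of_ne_of_ne e1 e2]

/-- Second order expansion of the determinant at a diagonal matrix. -/
theorem hasJet_det {A : ι → ι → ℝ → ℝ} {d : ι → ℝ} {b c : ι → ι → ℝ}
    (h : ∀ i j, HasJet (A i j) (if i = j then d i else 0) (b i j) (c i j)) :
    HasJet (fun t => (Matrix.of fun i j => A i j t).det) (∏ i, d i)
      (∑ i, b i i * ∏ l ∈ univ.erase i, d l)
      (∑ i, c i i * ∏ l ∈ univ.erase i, d l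
        + 2⁻¹ * ∑ i, ∑ j ∈ univ.erase i, (b i i * b j j - b i j * b j i)
          * ∏ l ∈ (univ.erase i).erase j, d l) := by
  have h1 := HasJet.sum (univ : Finset (Equiv.Perm ι)) fun σ _ =>
    (HasJet.const ((Equiv.Perm.sign σ : ℤ) : ℝ)).mul
      (HasJet.prod univ fun i _ => h (σ i) i)
  have z1 : ∀ σ : Equiv.Perm ι, ∀ s : Finset ι, (∃ l ∈ s, σ l ≠ l) →
      ∏ l ∈ s, (if σ l = l then d (σ l) else 0) = 0 := by
    rintro σ s ⟨l, hl, hne⟩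
    exact prod_eq_zero hl (if_neg hne)
  have z2 : ∀ s : Finset ι, ∏ l ∈ s, (if (1 : Equiv.Perm ι) l = l then d ((1 : Equiv.Perm ι) l)
      else 0) = ∏ l ∈ s, d l := by
    intro s; simp
  have o : ∀ (g : ι → ι → ℝ) (i : ι), ∑ σ : Equiv.Perm ι, ((Equiv.Perm.sign σ : ℤ) : ℝ) *
      (g (σ i) i * ∏ l ∈ univ.erase i, (if σ l = l then d (σ l) else 0))
      = g i i * ∏ l ∈ univ.erase i, d l := by
    intro g i
    rw [Finset.sum_eq_single (1 : Equiv.Perm ι)]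
    · rw [z2]; simp
    · intro σ _ hσ
      rw [z1, mul_zero, mul_zero]
      by_contra! hall
      rcases perm_eq_one_or_swap (σ := σ) (i := i) (j := i)
        (fun l hl _ => hall l (mem_erase.2 ⟨hl, mem_univ l⟩)) with h2 | h2
      · exact hσ h2
      · exact hσ (by rw [h2, Equiv.swap_self]; rfl)
    · simp
  refine (h1.congr_fun (Filter.Eventually.of_forall fun t => ?_)).congr_coeff ?_ ?_ ?_
  · rw [Matrix.det_apply']; rfl
  · rw [Finset.sum_eq_single (1 : Equiv.Perm ι)]
    · rw [z2]; simp
    · intro σ _ hσ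
      rw [z1, mul_zero]
      by_contra! hall
      exact hσ (Equiv.ext fun l => hall l (mem_univ l))
    · simp
  · simp only [zero_mul, add_zero, mul_sum]
    rw [sum_comm]
    exact sum_congr rfl fun i _ => o b i
  · simp only [zero_mul, add_zero, mul_add, sum_add_distrib]
    congr 1
    · simp only [mul_sum]
      rw [sum_comm]
      exact sum_congr rfl fun i _ => o c i
    · simp only [mul_sum]
      rw [sum_comm]
      refine sum_congr rfl fun i _ => ?_
      rw [sum_comm]
      refine sum_congr rfl fun j hj => ?_
      have hij : i ≠ j := (ne_of_mem_erase hj).symm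
      have hone : (1 : Equiv.Perm ι) ≠ Equiv.swap i j := fun e => hij <| by
        have := congrArg (fun σ : Equiv.Perm ι => σ j) e
        simpa using this.symm
      rw [Finset.sum_eq_add (1 : Equiv.Perm ι) (Equiv.swap i j) hone]
      · have hs : ∏ l ∈ (univ.erase i).erase j,
            (if (Equiv.swap i j) l = l then d ((Equiv.swap i j) l) else 0)
            = ∏ l ∈ (univ.erase i).erase j, d l := by
          refine prod_congr rfl fun l hl => ?_
          have h1 : l ≠ j := ne_of_mem_erase hl
          have h2 : l ≠ i := ne_of_mem_erase (mem_of_mem_erase hl)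
          rw [Equiv.swap_apply_of_ne_of_ne h2 h1, if_pos rfl]
        rw [z2, hs, Equiv.Perm.sign_swap hij]
        simp only [Equiv.Perm.sign_one, Units.val_one, Int.cast_one, Equiv.Perm.coe_one, id_eq,
          Units.val_neg, Int.cast_neg, Equiv.swap_apply_left, Equiv.swap_apply_right]
        ring
      · rintro σ - ⟨hσ1, hσ2⟩
        rw [z1, mul_zero, mul_zero, mul_zero]
        by_contra! hall
        rcases perm_eq_one_or_swap (σ := σ) (i := i) (j := j)
          (fun l hl hl' => hall l (mem_erase.2 ⟨hl', mem_erase.2 ⟨hl, mem_univ l⟩⟩)) with h2 | h2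
        · exact hσ1 h2
        · exact hσ2 h2
      · simp
      · simp

/-- The sum of the principal minors of order `k`. -/
noncomputable def sumPrincipalMinors (k : ℕ) (A : Matrix ι ι ℝ) : ℝ :=
  ∑ s ∈ univ.powersetCard k, (A.submatrix (Subtype.val : s → ι) Subtype.val).det

/-- Second order expansion of the sum of principal minors at a diagonal matrix. -/
theorem hasJet_sumPrincipalMinors (k : ℕ) {A : ι → ι → ℝ → ℝ} {d : ι → ℝ} {b c : ι → ι → ℝ}
    (h : ∀ i j, HasJet (A i j) (if i = j then d i else 0) (b i j) (c i j)) :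
    HasJet (fun t => sumPrincipalMinors (k + 2) (Matrix.of fun i j => A i j t))
      (esymmOn (k + 2) univ d)
      (∑ i, b i i * esymmOn (k + 1) (univ.erase i) d)
      (∑ i, c i i * esymmOn (k + 1) (univ.erase i) d
        + 2⁻¹ * ∑ i, ∑ j ∈ univ.erase i, (b i i * b j j - b i j * b j i)
          * esymmOn k ((univ.erase i).erase j) d) := by
  have h1 : ∀ s ∈ univ.powersetCard (k + 2), HasJet
      (fun t => ((Matrix.of fun i j => A i j t).submatrix (Subtype.val : s → ι) Subtype.val).det)
      (∏ i ∈ s, d i) (∑ i ∈ s, b i i * ∏ l ∈ s.erase i, d l)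
      (∑ i ∈ s, c i i * ∏ l ∈ s.erase i, d l
        + 2⁻¹ * ∑ i ∈ s, ∑ j ∈ s.erase i, (b i i * b j j - b i j * b j i)
          * ∏ l ∈ (s.erase i).erase j, d l) := by
    intro s _
    have hs := hasJet_det (ι := s) (A := fun i j => A i j) (d := fun i => d i)
      (b := fun i j => b i j) (c := fun i j => c i j) fun i j =>
        (h i j).congr_coeff (by by_cases e : i = j <;> simp [e, Subtype.ext_iff.not.1]) rfl rfl
    have e0 : ∀ f : ι → ℝ, ∑ i : s, f i = ∑ i ∈ s, f i := fun f => Finset.sum_coe_sort s f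
    have e1 : ∀ i : s, ∏ l ∈ univ.erase i, d l = ∏ l ∈ s.erase i, d l := by
      intro i
      refine prod_bij (fun l _ => (l : ι)) ?_ ?_ ?_ ?_
      · intro l hl
        exact mem_erase.2 ⟨fun e => ne_of_mem_erase hl (Subtype.ext e), l.2⟩
      · intro l _ l' _ e; exact Subtype.ext e
      · intro l hl
        exact ⟨⟨l, mem_of_mem_erase hl⟩,
          mem_erase.2 ⟨fun e => ne_of_mem_erase hl (congrArg Subtype.val e), mem_univ _⟩, rfl⟩
      · intro l _; rfl
    have e2 : ∀ i j : s, ∏ l ∈ (univ.erase i).erase j, d l = ∏ l ∈ (s.erase i).erase j, d l := by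
      intro i j
      refine prod_bij (fun l _ => (l : ι)) ?_ ?_ ?_ ?_
      · intro l hl
        exact mem_erase.2 ⟨fun e => ne_of_mem_erase hl (Subtype.ext e),
          mem_erase.2 ⟨fun e => ne_of_mem_erase (mem_of_mem_erase hl) (Subtype.ext e), l.2⟩⟩
      · intro l _ l' _ e; exact Subtype.ext e
      · intro l hl
        refine ⟨⟨l, mem_of_mem_erase (mem_of_mem_erase hl)⟩, ?_, rfl⟩
        exact mem_erase.2 ⟨fun e => ne_of_mem_erase hl (congrArg Subtype.val e),
          mem_erase.2 ⟨fun e => ne_of_mem_erase (mem_of_mem_erase hl) (congrArg Subtype.val e),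
            mem_univ _⟩⟩
      · intro l _; rfl
    have e3 : ∀ (i : s) (f : ι → ℝ), ∑ j ∈ univ.erase i, f j = ∑ j ∈ s.erase i, f j := by
      intro i f
      refine sum_bij (fun l _ => (l : ι)) ?_ ?_ ?_ ?_
      · intro l hl
        exact mem_erase.2 ⟨fun e => ne_of_mem_erase hl (Subtype.ext e), l.2⟩
      · intro l _ l' _ e; exact Subtype.ext e
      · intro l hl
        exact ⟨⟨l, mem_of_mem_erase hl⟩,
          mem_erase.2 ⟨fun e => ne_of_mem_erase hl (congrArg Subtype.val e), mem_univ _⟩, rfl⟩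
      · intro l _; rfl
    refine hs.congr_coeff (prod_coe_sort s d) ?_ ?_
    · simp only [e1]
      exact e0 fun i => b i i * ∏ l ∈ s.erase i, d l
    · simp only [e1, e2]
      congr 1
      · exact e0 fun i => c i i * ∏ l ∈ s.erase i, d l
      · congr 1
        rw [← e0 fun i => ∑ j ∈ s.erase i, (b i i * b j j - b i j * b j i)
          * ∏ l ∈ (s.erase i).erase j, d l]
        exact sum_congr rfl fun i _ => e3 i fun j => (b i i * b j j - b i j * b j i)
          * ∏ l ∈ (s.erase i).erase j, d l
  have h2 := HasJet.sum (univ.powersetCard (k + 2)) h1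
  have r1 : ∀ g : ι → ℝ, ∑ s ∈ univ.powersetCard (k + 2), ∑ i ∈ s, g i * ∏ l ∈ s.erase i, d l
      = ∑ i, g i * esymmOn (k + 1) (univ.erase i) d := fun g => by
    rw [sum_powersetCard_succ_sum_erase (k + 1) univ fun i t => g i * ∏ l ∈ t, d l]
    simp only [esymmOn, mul_sum]
  have r2 : ∀ g : ι → ι → ℝ, ∑ s ∈ univ.powersetCard (k + 2), ∑ i ∈ s, ∑ j ∈ s.erase i,
      g i j * ∏ l ∈ (s.erase i).erase j, d l
      = ∑ i, ∑ j ∈ univ.erase i, g i j * esymmOn k ((univ.erase i).erase j) d := fun g => by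
    rw [sum_powersetCard_succ_sum_erase (k + 1) univ
      fun i t => ∑ j ∈ t, g i j * ∏ l ∈ t.erase j, d l]
    refine sum_congr rfl fun i _ => ?_
    rw [sum_powersetCard_succ_sum_erase k _ fun j t => g i j * ∏ l ∈ t, d l]
    simp only [esymmOn, mul_sum]
  refine h2.congr_coeff rfl (r1 _) ?_
  rw [sum_add_distrib, r1, ← mul_sum, r2 fun i j => b i i * b j j - b i j * b j i]

/-- If the characteristic polynomial splits, elementary symmetric functions of the eigenvalues are
sums of principal minors. -/
theorem esymm_roots_charpoly (A : Matrix ι ι ℝ) (hA : A.charpoly.Splits) {k : ℕ}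
    (hk : k ≤ Fintype.card ι) : A.charpoly.roots.esymm k = sumPrincipalMinors k A := by
  have h1 := charpoly_coeff_eq_sum_minors A k hk
  have h2 := Polynomial.coeff_eq_esymm_roots_of_splits hA
    (k := Fintype.card ι - k) (by rw [charpoly_natDegree_eq_dim]; omega)
  rw [charpoly_natDegree_eq_dim, (charpoly_monic A).leadingCoeff, one_mul,
    Nat.sub_sub_self hk, h1] at h2
  have h3 : ((-1 : ℝ) ^ k) ≠ 0 := by simp
  exact (mul_left_cancel₀ h3 h2).symm

end PrincipalMinors

/-! ### Coordinate partial derivatives -/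

section PartialDerivatives

variable {ι : Type*} [DecidableEq ι] [Fintype ι]

/-- The partial derivative in the direction of the `i`-th coordinate. -/
noncomputable def pderiv (i : ι) (f : (ι → ℝ) → ℝ) (x : ι → ℝ) : ℝ :=
  fderiv ℝ f x (Pi.single i 1)

theorem contDiff_pderiv {m n : WithTop ℕ∞} {f : (ι → ℝ) → ℝ} (hf : ContDiff ℝ n f)
    (hmn : m + 1 ≤ n) (i : ι) : ContDiff ℝ m (pderiv i f) :=
  (hf.fderiv_right hmn).clm_apply contDiff_const

theorem pderiv_pderiv {f : (ι → ℝ) → ℝ} (hf : ContDiff ℝ 2 f) (i j : ι) (x : ι → ℝ) :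
    pderiv i (pderiv j f) x = fderiv ℝ (fderiv ℝ f) x (Pi.single i 1) (Pi.single j 1) := by
  have h1 : DifferentiableAt ℝ (fderiv ℝ f) x :=
    ((hf.fderiv_right (m := 1) (by norm_num)).differentiable (by norm_num)) x
  have h2 := h1.hasFDerivAt.clm_apply (hasFDerivAt_const (Pi.single j (1 : ℝ) : ι → ℝ) x)
  rw [pderiv]
  unfold pderiv
  rw [h2.fderiv]
  simp

theorem pderiv_comm {f : (ι → ℝ) → ℝ} (hf : ContDiff ℝ 2 f) (i j : ι) :
    pderiv i (pderiv j f) = pderiv j (pderiv i f) := by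
  funext x
  rw [pderiv_pderiv hf, pderiv_pderiv hf]
  exact (hf.contDiffAt.isSymmSndFDerivAt (by simp)).eq _ _

theorem fderiv_eq_sum_pderiv {f : (ι → ℝ) → ℝ} (x η : ι → ℝ) :
    fderiv ℝ f x η = ∑ i, η i * pderiv i f x := by
  conv_lhs => rw [pi_eq_sum_univ η, map_sum]
  refine Finset.sum_congr rfl fun i _ => ?_
  rw [map_smul, smul_eq_mul, pderiv]
  congr 2
  funext j
  simp [Pi.single_apply, eq_comm]

theorem hasJet_line {f : (ι → ℝ) → ℝ} (hf : ContDiff ℝ 2 f) (l : ι) :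
    HasJet (fun t : ℝ => f (t • Pi.single l (1 : ℝ))) (f 0) (pderiv l f 0)
      (2⁻¹ * pderiv l (pderiv l f) 0) := by
  have h0 : HasJet (fun t : ℝ => t • (Pi.single l (1 : ℝ) : ι → ℝ)) 0 (Pi.single l 1) 0 := by
    simpa using HasJet.ident.smul (HasJet.const (Pi.single l (1 : ℝ) : ι → ℝ))
  refine (h0.comp (f := f) hf.contDiffAt).congr_coeff rfl rfl ?_
  rw [pderiv_pderiv hf]; simp

end PartialDerivatives

/-! ### Local graphs over the tangent hyperplane -/

section LocalGraph

open Filter Topology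

variable {ι : Type*} [DecidableEq ι] [Fintype ι]
variable {E : Type*} [NormedAddCommGroup E] [InnerProductSpace ℝ E]

/-- `e` together with the unit vector `N` is an orthonormal basis. -/
structure IsAdaptedFrame (N : E) (e : ι → E) : Prop where
  orthonormal : Orthonormal ℝ e
  inner_eq_zero : ∀ i, ⟪e i, N⟫ = 0
  norm_eq_one : ‖N‖ = 1
  expand : ∀ y, y = ∑ i, ⟪e i, y⟫ • e i + ⟪N, y⟫ • N

/-- The point over `x` of the graph of `-w` in the frame `e`, `N` based at `X₀`. -/
noncomputable def graphPoint (X₀ N : E) (e : ι → E) (w : (ι → ℝ) → ℝ) (x : ι → ℝ) : E :=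
  X₀ + ∑ i, x i • e i - w x • N

/-- The square of the area element of the graph of `w`. -/
noncomputable def areaSq (w : (ι → ℝ) → ℝ) (x : ι → ℝ) : ℝ :=
  1 + ∑ j, pderiv j w x ^ 2

/-- The upward unit normal of the graph of `-w`. -/
noncomputable def graphNormal (N : E) (e : ι → E) (w : (ι → ℝ) → ℝ) (x : ι → ℝ) : E :=
  (√(areaSq w x))⁻¹ • (∑ j, pderiv j w x • e j + N)

/-- Near `X₀ ∈ M`, the hypersurface is the graph of `-w` over the tangent hyperplane at `X₀`. -/
structure IsLocalGraph (M : Set E) (ν : E → sphere (0 : E) 1) (X₀ : E) (e : ι → E)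
    (w : (ι → ℝ) → ℝ) : Prop where
  frame : IsAdaptedFrame (ν X₀ : E) e
  contDiff : ContDiff ℝ 4 w
  zero : w 0 = 0
  pderiv_zero : ∀ j, pderiv j w 0 = 0
  mem : ∀ᶠ x in 𝓝 0, graphPoint X₀ (ν X₀) e w x ∈ M
  normal : ∀ᶠ x in 𝓝 0, (ν (graphPoint X₀ (ν X₀) e w x) : E) = graphNormal (ν X₀ : E) e w x
  cover : ∀ᶠ X in 𝓝[M] X₀, X = graphPoint X₀ (ν X₀) e w (fun i => ⟪e i, X - X₀⟫)

theorem areaSq_pos (w : (ι → ℝ) → ℝ) (x : ι → ℝ) : 0 < areaSq w x := by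
  have : 0 ≤ ∑ j, pderiv j w x ^ 2 := Finset.sum_nonneg fun j _ => sq_nonneg _
  rw [areaSq]; linarith

namespace IsAdaptedFrame

variable {N : E} {e : ι → E} (h : IsAdaptedFrame N e)
include h

omit [DecidableEq ι] in
theorem inner_sum (x : ι → ℝ) (i : ι) : ⟪e i, ∑ j, x j • e j⟫ = x i :=
  h.orthonormal.inner_right_fintype x i

omit [DecidableEq ι] in
theorem inner_normal_sum (x : ι → ℝ) : ⟪N, ∑ j, x j • e j⟫ = 0 := by
  rw [_root_.inner_sum]
  refine Finset.sum_eq_zero fun j _ => ?_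
  rw [inner_smul_right, real_inner_comm, h.inner_eq_zero, mul_zero]

omit [DecidableEq ι] in
theorem inner_normal_normal : ⟪N, N⟫ = 1 := by
  rw [real_inner_self_eq_norm_sq, h.norm_eq_one]; norm_num

omit [DecidableEq ι] in
theorem inner_combination (x y : ι → ℝ) (a b : ℝ) :
    ⟪∑ j, x j • e j + a • N, ∑ j, y j • e j + b • N⟫ = ∑ j, x j * y j + a * b := by
  have h1 : ⟪∑ j, x j • e j, N⟫ = 0 := by rw [real_inner_comm]; exact h.inner_normal_sum x
  have h2 : ⟪∑ j, x j • e j, ∑ j, y j • e j⟫ = ∑ j, x j * y j := by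
    rw [_root_.sum_inner]
    simp [inner_smul_left, h.inner_sum]
  rw [inner_add_left, inner_add_right, inner_add_right, inner_smul_left, inner_smul_left,
    inner_smul_right, inner_smul_right, h.inner_normal_normal, h.inner_normal_sum, h1, h2]
  simp

theorem norm_graphNormal (w : (ι → ℝ) → ℝ) (x : ι → ℝ) : ‖graphNormal N e w x‖ = 1 := by
  have hp := areaSq_pos w x
  have h1 := h.inner_combination (fun j => pderiv j w x) (fun j => pderiv j w x) 1 1
  rw [one_smul, real_inner_self_eq_norm_sq] at h1
  have h2 : ‖∑ j, pderiv j w x • e j + N‖ ^ 2 = areaSq w x := by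
    rw [h1, areaSq, add_comm]; simp [pow_two]
  have h3 : ‖∑ j, pderiv j w x • e j + N‖ = √(areaSq w x) := by
    rw [← h2, Real.sqrt_sq (norm_nonneg _)]
  rw [graphNormal, norm_smul, h3, norm_inv, Real.norm_of_nonneg (Real.sqrt_nonneg _),
    inv_mul_cancel₀ (Real.sqrt_pos.2 hp).ne']

end IsAdaptedFrame

omit [DecidableEq ι] in
theorem hasFDerivAt_graphPoint (X₀ N : E) (e : ι → E) {w : (ι → ℝ) → ℝ} {x : ι → ℝ}
    (hw : DifferentiableAt ℝ w x) :
    HasFDerivAt (graphPoint X₀ N e w)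
      ((∑ i, (ContinuousLinearMap.proj i : (ι → ℝ) →L[ℝ] ℝ).smulRight (e i))
        - (fderiv ℝ w x).smulRight N) x := by
  have h1 : HasFDerivAt (fun x : ι → ℝ => ∑ i, x i • e i)
      (∑ i, (ContinuousLinearMap.proj i : (ι → ℝ) →L[ℝ] ℝ).smulRight (e i)) x :=
    HasFDerivAt.fun_sum fun i _ =>
      ((ContinuousLinearMap.proj i : (ι → ℝ) →L[ℝ] ℝ).smulRight (e i)).hasFDerivAt
  exact (h1.const_add X₀).sub (hw.hasFDerivAt.smul_const N)

omit [DecidableEq ι] in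
theorem contDiff_graphPoint (X₀ N : E) (e : ι → E) {w : (ι → ℝ) → ℝ} {n : WithTop ℕ∞}
    (hw : ContDiff ℝ n w) : ContDiff ℝ n (graphPoint X₀ N e w) := by
  unfold graphPoint
  fun_prop

theorem contDiff_areaSq {w : (ι → ℝ) → ℝ} (hw : ContDiff ℝ 4 w) : ContDiff ℝ 3 (areaSq w) := by
  unfold areaSq
  have : ∀ j, ContDiff ℝ 3 (pderiv j w) := fun j => contDiff_pderiv hw (by norm_num) j
  fun_prop

theorem contDiff_inv_sqrt_areaSq {w : (ι → ℝ) → ℝ} (hw : ContDiff ℝ 4 w) :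
    ContDiff ℝ 3 (fun x => (√(areaSq w x))⁻¹) :=
  ((contDiff_areaSq hw).sqrt fun x => (areaSq_pos w x).ne').inv
    fun x => (Real.sqrt_pos.2 (areaSq_pos w x)).ne'

theorem contDiff_graphNormal (N : E) (e : ι → E) {w : (ι → ℝ) → ℝ} (hw : ContDiff ℝ 4 w) :
    ContDiff ℝ 3 (graphNormal N e w) := by
  have h1 : ∀ j, ContDiff ℝ 3 (pderiv j w) := fun j => contDiff_pderiv hw (by norm_num) j
  have h2 := contDiff_inv_sqrt_areaSq hw
  unfold graphNormal
  fun_prop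

/-- The hull lies in the closed supporting half-space at X; a step from z in the direction ν X stays
in the hull, which makes the inequality strict. -/
theorem inner_interior_neg {M : Set E} {ν : E → sphere (0 : E) 1} (hν : IsOuterUnitNormal M ν)
    {z : E} (hz : z ∈ interior (convexHull ℝ M)) {X : E} (hX : X ∈ M) :
    ⟪(ν X : E), z - X⟫ < 0 := by
  have hconv : Convex ℝ {Y : E | ⟪(ν X : E), Y - X⟫ ≤ 0} := by
    intro a ha b hb s t hs ht hst
    simp only [mem_ofPred_eq] at ha hb ⊢
    have : s • a + t • b - X = s • (a - X) + t • (b - X) := by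
      rw [smul_sub, smul_sub, sub_add_sub_comm, ← add_smul, hst, one_smul]
    rw [this, inner_add_right, inner_smul_right, inner_smul_right]
    nlinarith
  have hsub : convexHull ℝ M ⊆ {Y : E | ⟪(ν X : E), Y - X⟫ ≤ 0} :=
    convexHull_min (fun Y hY => hν X hX Y hY) hconv
  obtain ⟨δ, hδ, hball⟩ := Metric.isOpen_iff.1 isOpen_interior z hz
  have h1 : z + (δ / 2) • (ν X : E) ∈ ball z δ := by
    rw [mem_ball, dist_eq_norm, add_sub_cancel_left, norm_smul, norm_eq_of_mem_sphere,
      Real.norm_of_nonneg (by positivity)]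
    linarith
  have h2 : ⟪(ν X : E), z + (δ / 2) • (ν X : E) - X⟫ ≤ 0 := hsub (interior_subset (hball h1))
  rw [add_sub_right_comm, inner_add_right, inner_smul_right, real_inner_self_eq_norm_sq,
    norm_eq_of_mem_sphere] at h2
  linarith

/-- The differential of a defining function does not vanish on transversal vectors. -/
theorem fderiv_ne_zero_of_inner_ne_zero [CompleteSpace E] {M : Set E} {ν : E → sphere (0 : E) 1}
    (hν : IsOuterUnitNormal M ν) {X₀ : E} (hX₀ : X₀ ∈ M) {U : Set E} (hU : IsOpen U)
    (hXU : X₀ ∈ U) {φ : E → ℝ} (hφ : ContDiffAt ℝ 1 φ X₀) (hd : fderiv ℝ φ X₀ ≠ 0)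
    (hMU : M ∩ U = {x ∈ U | φ x = 0}) {y : E} (hy : ⟪(ν X₀ : E), y⟫ ≠ 0) :
    fderiv ℝ φ X₀ y ≠ 0 := by
  have hφ0 : φ X₀ = 0 := (hMU.subset ⟨hX₀, hXU⟩).2
  have hext : IsLocalExtrOn (innerSL ℝ (ν X₀ : E)) {x | φ x = φ X₀} X₀ := by
    right
    have : ∀ᶠ x in 𝓝[{x | φ x = φ X₀}] X₀, x ∈ U ∧ φ x = φ X₀ :=
      Filter.Eventually.and (mem_nhdsWithin_of_mem_nhds (hU.mem_nhds hXU)) self_mem_nhdsWithin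
    filter_upwards [this] with x hx
    have hxM : x ∈ M := (hMU.symm.subset ⟨hx.1, by rw [hx.2, hφ0]⟩).1
    have := hν X₀ hX₀ x hxM
    rw [inner_sub_right] at this
    simpa using this
  -- X₀ maximizes ⟨ν X₀, ·⟩ on the level set of φ, so by Lagrange multipliers the differential of φ
  -- is proportional to ⟨ν X₀, ·⟩.
  obtain ⟨a, b, hab, hcomb⟩ := hext.exists_multipliers_of_hasStrictFDerivAt_1d
    (hφ.hasStrictFDerivAt (by norm_num)) (innerSL ℝ (ν X₀ : E)).hasStrictFDerivAt
  intro h0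
  have h1 := congrArg (fun L : E →L[ℝ] ℝ => L y) hcomb
  simp [h0, hy] at h1
  rw [h1, zero_smul, add_zero] at hcomb
  have ha : a = 0 := by simpa [hd] using hcomb
  exact hab (by rw [ha, h1]; rfl)

/-- The implicit function theorem is applied in the direction ν X₀, transversal to M. The normal
along the graph is then forced by the support property, which fixes its line, and by the interior
point z, which fixes its sign. -/
theorem exists_isLocalGraph [CompleteSpace E] {M : Set E} {ν : E → sphere (0 : E) 1}
    (hM : IsHypersurface 4 M) (hν : IsOuterUnitNormal M ν) {z : E}
    (hz : z ∈ interior (convexHull ℝ M)) {X₀ : E} (hX₀ : X₀ ∈ M) {e : ι → E}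
    (he : IsAdaptedFrame (ν X₀ : E) e) : ∃ w, IsLocalGraph M ν X₀ e w := by
  obtain ⟨U, hU, hXU, φ, hφ, hdφ, hMU⟩ := hM X₀ hX₀
  have hφ0 : φ X₀ = 0 := (hMU.subset ⟨hX₀, hXU⟩).2
  have hφat : ContDiffAt ℝ 4 φ X₀ := hφ.contDiffAt (hU.mem_nhds hXU)
  have hne := fderiv_ne_zero_of_inner_ne_zero hν hX₀ hU hXU (hφat.of_le (by norm_num))
    (hdφ X₀ hXU) hMU (y := ν X₀) (by rw [he.inner_normal_normal]; exact one_ne_zero)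
  set N : E := (ν X₀ : E) with hN
  -- the implicit function
  set Y : (ι → ℝ) × ℝ → E := fun p => X₀ + ∑ i, p.1 i • e i - p.2 • N with hY
  have hY0 : Y (0, 0) = X₀ := by simp [hY]
  have hYc : ContDiff ℝ 4 Y := by rw [hY]; fun_prop
  have hYd : HasFDerivAt Y ((∑ i, ((ContinuousLinearMap.proj i : (ι → ℝ) →L[ℝ] ℝ).comp
      (ContinuousLinearMap.fst ℝ (ι → ℝ) ℝ)).smulRight (e i))
      - (ContinuousLinearMap.snd ℝ (ι → ℝ) ℝ).smulRight N) (0, 0) := by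
    have h1 : HasFDerivAt (fun p : (ι → ℝ) × ℝ => ∑ i, p.1 i • e i)
        (∑ i, ((ContinuousLinearMap.proj i : (ι → ℝ) →L[ℝ] ℝ).comp
          (ContinuousLinearMap.fst ℝ (ι → ℝ) ℝ)).smulRight (e i)) (0, 0) :=
      HasFDerivAt.fun_sum fun i _ => (((ContinuousLinearMap.proj i : (ι → ℝ) →L[ℝ] ℝ).comp
          (ContinuousLinearMap.fst ℝ (ι → ℝ) ℝ)).smulRight (e i)).hasFDerivAt
    exact (h1.const_add X₀).sub ((ContinuousLinearMap.snd ℝ (ι → ℝ) ℝ).smulRight N).hasFDerivAt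
  set Φ : (ι → ℝ) × ℝ → ℝ := fun p => φ (Y p) with hΦ
  have hΦc : ContDiffAt ℝ 4 Φ (0, 0) := by
    refine ContDiffAt.comp (0, 0) ?_ hYc.contDiffAt
    rw [hY0]; exact hφat
  have hΦd : fderiv ℝ Φ (0, 0) (0, 1) = -fderiv ℝ φ X₀ N := by
    have h1 : HasFDerivAt φ (fderiv ℝ φ X₀) (Y (0, 0)) := by
      rw [hY0]; exact (hφat.differentiableAt (by norm_num)).hasFDerivAt
    have h2 : HasFDerivAt Φ _ (0, 0) := h1.comp (0, 0) hYd
    rw [h2.fderiv]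
    simp
  have hinv : (fderiv ℝ Φ (0, 0) ∘L .inr ℝ (ι → ℝ) ℝ).IsInvertible := by
    have hc : fderiv ℝ Φ (0, 0) (0, 1) ≠ 0 := by rw [hΦd]; simpa using hne
    refine ⟨ContinuousLinearEquiv.unitsEquivAut ℝ (Units.mk0 _ hc), ?_⟩
    ext
    simp
  have h4 : (4 : WithTop ℕ∞) ≠ 0 := by norm_num
  set ψ := hΦc.implicitFunction h4 hinv with hψ
  have hψc : ContDiffAt ℝ 4 ψ 0 := hΦc.contDiffAt_implicitFunction h4 hinv
  have hψ0 : ψ 0 = 0 := hΦc.implicitFunction_apply_self h4 hinv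
  have hψe : ∀ᶠ x in 𝓝 (0 : ι → ℝ), Φ (x, ψ x) = Φ (0, 0) :=
    hΦc.eventually_apply_implicitFunction h4 hinv
  have hψi : ∀ᶠ v in 𝓝 ((0 : ι → ℝ), (0 : ℝ)), Φ v = Φ (0, 0) ↔ ψ v.1 = v.2 :=
    hΦc.eventually_apply_eq_iff_implicitFunction h4 hinv
  have hΦ0 : Φ (0, 0) = 0 := by rw [hΦ]; simp only [hY0, hφ0]
  -- a globally defined modification
  obtain ⟨w, hw, hwψ⟩ : ∃ w : (ι → ℝ) → ℝ, ContDiff ℝ 4 w ∧ w =ᶠ[𝓝 0] ψ := by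
    obtain ⟨V, hV, hψV⟩ := hψc.contDiffOn (m := 4) le_rfl (by simp)
    obtain ⟨δ, hδ, hball⟩ := Metric.mem_nhds_iff.1 hV
    let χ : ContDiffBump (0 : ι → ℝ) := ⟨δ / 3, δ / 2, by positivity, by linarith⟩
    refine ⟨fun x => χ x * ψ x, ?_, ?_⟩
    · rw [contDiff_iff_contDiffAt]
      intro x
      by_cases hx : x ∈ ball (0 : ι → ℝ) δ
      · exact χ.contDiff.contDiffAt.mul
          (hψV.contDiffAt (mem_of_superset (isOpen_ball.mem_nhds hx) hball))
      · have hx' : x ∉ tsupport χ := by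
          rw [χ.tsupport_eq]
          intro h
          exact hx (closedBall_subset_ball (by change δ / 2 < δ; linarith) h)
        have h0 : (fun x => χ x * ψ x) =ᶠ[𝓝 x] fun _ => 0 := by
          filter_upwards [(isClosed_tsupport χ).isOpen_compl.mem_nhds hx'] with y hy
          rw [image_eq_zero_of_notMem_tsupport hy, zero_mul]
        exact contDiffAt_const.congr_of_eventuallyEq h0
    · filter_upwards [χ.eventuallyEq_one] with x hx
      rw [hx]; simp
  have hw0 : w 0 = 0 := by rw [hwψ.self_of_nhds, hψ0]
  have hgc : Continuous (graphPoint X₀ N e w) := (contDiff_graphPoint X₀ N e hw).continuous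
  have hg0 : graphPoint X₀ N e w 0 = X₀ := by simp [graphPoint, hw0]
  have hmem : ∀ᶠ x in 𝓝 0, graphPoint X₀ N e w x ∈ M := by
    filter_upwards [hψe, hwψ, hgc.continuousAt.preimage_mem_nhds
      (by rw [hg0]; exact hU.mem_nhds hXU)] with x h1 h2 h3
    refine (hMU.symm.subset ⟨h3, ?_⟩).1
    rw [hΦ0, ← h2] at h1
    exact h1
  have hcov : ∀ᶠ X in 𝓝[M] X₀, X = graphPoint X₀ N e w (fun i => ⟪e i, X - X₀⟫) := by
    have c1 : Tendsto (fun X : E => ((fun i => ⟪e i, X - X₀⟫ : ι → ℝ), -⟪N, X - X₀⟫))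
        (𝓝 X₀) (𝓝 ((0 : ι → ℝ), (0 : ℝ))) := by
      refine Continuous.tendsto' (by fun_prop) _ _ ?_
      simp; rfl
    have c2 : Tendsto (fun X : E => (fun i => ⟪e i, X - X₀⟫ : ι → ℝ)) (𝓝 X₀) (𝓝 0) := by
      refine Continuous.tendsto' (by fun_prop) _ _ ?_
      simp; rfl
    have e1 := (c1.eventually hψi).filter_mono (nhdsWithin_le_nhds (s := M))
    have e2 := (c2.eventually hwψ).filter_mono (nhdsWithin_le_nhds (s := M))
    have e3 : ∀ᶠ X in 𝓝[M] X₀, X ∈ U := mem_nhdsWithin_of_mem_nhds (hU.mem_nhds hXU)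
    filter_upwards [e1, e2, e3, self_mem_nhdsWithin] with X h1 h2 h3 h4
    have hexp := he.expand (X - X₀)
    have hX : X = Y ((fun i => ⟪e i, X - X₀⟫), -⟪N, X - X₀⟫) := by
      simp only [hY, neg_smul, sub_neg_eq_add, add_assoc]
      rw [← hexp]; abel
    have hΦX : Φ ((fun i => ⟪e i, X - X₀⟫), -⟪N, X - X₀⟫) = Φ (0, 0) := by
      rw [hΦ0]
      simp only [hΦ]
      rw [← hX]
      exact (hMU.subset ⟨h4, h3⟩).2
    have h5 := h1.1 hΦX
    rw [graphPoint, h2, h5]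
    exact hX
  -- the normal
  have hortho : ∀ᶠ x in 𝓝 0, ∀ j, ⟪(ν (graphPoint X₀ N e w x) : E), e j⟫
      = pderiv j w x * ⟪(ν (graphPoint X₀ N e w x) : E), N⟫ := by
    filter_upwards [hmem.eventually_nhds, hmem] with x hx hx1 j
    have hd := hasFDerivAt_graphPoint X₀ N e (hw.differentiable (by norm_num) x)
    have hd2 := ((innerSL ℝ (ν (graphPoint X₀ N e w x) : E)).hasFDerivAt).comp x hd
    -- The functional ⟨ν X, ·⟩ is maximal over M at X, so it annihilates the tangent vectors of the
    -- graph there.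
    have hmax : IsLocalMax
        ((innerSL ℝ (ν (graphPoint X₀ N e w x) : E)) ∘ graphPoint X₀ N e w) x := by
      filter_upwards [hx] with y hy
      have := hν _ hx1 _ hy
      rw [inner_sub_right] at this
      simpa using this
    have h0 := congrArg (fun L => L (Pi.single j 1)) (hmax.hasFDerivAt_eq_zero hd2)
    have h0' : ⟪(ν (graphPoint X₀ N e w x) : E), e j⟫
        - pderiv j w x * ⟪(ν (graphPoint X₀ N e w x) : E), N⟫ = 0 := by
      simpa [pderiv] using h0
    linarith
  have hNN : ⟪N, N⟫ = 1 := he.inner_normal_normal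
  have hp0 : ∀ j, pderiv j w 0 = 0 := fun j => by
    have := hortho.self_of_nhds j
    rw [hg0, ← hN, hNN, real_inner_comm, he.inner_eq_zero] at this
    linarith
  have hneg : ∀ᶠ x in 𝓝 0, ⟪∑ j, pderiv j w x • e j + N, z - graphPoint X₀ N e w x⟫ < 0 := by
    have hc : Continuous fun x => ⟪∑ j, pderiv j w x • e j + N, z - graphPoint X₀ N e w x⟫ := by
      have : ∀ j, Continuous (pderiv j w) := fun j =>
        (contDiff_pderiv (m := 3) hw (by norm_num) j).continuous
      fun_prop
    refine hc.continuousAt.eventually (gt_mem_nhds ?_)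
    simp only [hp0, hg0, zero_smul, Finset.sum_const_zero, zero_add]
    exact inner_interior_neg hν hz hX₀
  refine ⟨w, he, hw, hw0, hp0, hmem, ?_, hcov⟩
  filter_upwards [hortho, hmem, hneg] with x h1 h2 h3
  set n : E := (ν (graphPoint X₀ N e w x) : E) with hn
  have hn1 : ‖n‖ = 1 := norm_eq_of_mem_sphere _
  have hexp : n = ⟪N, n⟫ • (∑ j, pderiv j w x • e j + N) := by
    conv_lhs => rw [he.expand n]
    rw [smul_add, Finset.smul_sum]
    congr 1
    refine Finset.sum_congr rfl fun j _ => ?_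
    rw [smul_smul, real_inner_comm, h1 j, real_inner_comm, mul_comm]
  -- Both n and Σ ∂_j w e_j + N pair negatively with z − X, so their ratio is positive.
  have hcpos : 0 < ⟪N, n⟫ := by
    have h4 := inner_interior_neg hν hz h2
    rw [← hn, hexp, inner_smul_left] at h4
    simp only [conj_trivial] at h4
    nlinarith
  have hA : ‖∑ j, pderiv j w x • e j + N‖ = √(areaSq w x) := by
    have h5 := he.inner_combination (fun j => pderiv j w x) (fun j => pderiv j w x) 1 1
    rw [one_smul, real_inner_self_eq_norm_sq] at h5
    have h6 : ‖∑ j, pderiv j w x • e j + N‖ ^ 2 = areaSq w x := by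
      rw [h5, areaSq, add_comm]; simp [pow_two]
    rw [← h6, Real.sqrt_sq (norm_nonneg _)]
  have h7 : ⟪N, n⟫ = (√(areaSq w x))⁻¹ := by
    have h8 := congrArg norm hexp
    rw [hn1, norm_smul, hA, Real.norm_of_nonneg hcpos.le] at h8
    exact eq_inv_of_mul_eq_one_left h8.symm
  rw [hexp, h7, graphNormal]

end LocalGraph

/-! ### The Weingarten map in graph coordinates -/

section Weingarten

open Filter Topology

variable {E : Type*} [NormedAddCommGroup E] [InnerProductSpace ℝ E]

/-- The frame of tangent vectors given by an orthonormal basis of the tangent hyperplane. -/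
theorem isAdaptedFrame_of_basis {ι : Type*} [Fintype ι] {ν : E → sphere (0 : E) 1} {X : E}
    (b : OrthonormalBasis ι ℝ (tangentHyperplane ν X)) :
    IsAdaptedFrame (ν X : E) (fun i => (b i : E)) := by
  have hN : ⟪(ν X : E), (ν X : E)⟫ = 1 := by
    rw [real_inner_self_eq_norm_sq, norm_eq_of_mem_sphere]; norm_num
  have hperp : ∀ τ : tangentHyperplane ν X, ⟪(τ : E), (ν X : E)⟫ = 0 := fun τ => by
    rw [real_inner_comm]
    exact Submodule.mem_orthogonal_singleton_iff_inner_right.1 τ.2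
  refine ⟨?_, fun i => hperp (b i), norm_eq_of_mem_sphere _, fun y => ?_⟩
  · exact b.orthonormal.comp_linearIsometry (tangentHyperplane ν X).subtypeₗᵢ
  · have hy : y - ⟪(ν X : E), y⟫ • (ν X : E) ∈ tangentHyperplane ν X := by
      rw [Submodule.mem_orthogonal_singleton_iff_inner_right, inner_sub_right, inner_smul_right,
        hN]
      ring
    have h1 := congrArg (Submodule.subtype _) (b.sum_repr' ⟨_, hy⟩)
    simp only [map_sum, map_smul, Submodule.subtype_apply] at h1
    rw [← sub_eq_iff_eq_add, ← h1]
    refine Finset.sum_congr rfl fun i _ => ?_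
    congr 1
    rw [Submodule.coe_inner]
    simp only
    rw [inner_sub_right, inner_smul_right, hperp, mul_zero, sub_zero]

variable {ι : Type*} [DecidableEq ι] [Fintype ι]

theorem clm_eq_sum {G : Type*} [NormedAddCommGroup G] [NormedSpace ℝ G] (L : (ι → ℝ) →L[ℝ] G)
    (η : ι → ℝ) : L η = ∑ i, η i • L (Pi.single i 1) := by
  conv_lhs => rw [← Finset.univ_sum_single η, map_sum]
  refine Finset.sum_congr rfl fun i _ => ?_
  rw [← map_smul, ← Pi.single_smul, smul_eq_mul, mul_one]

/-- The differential of the graph parametrization. -/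
noncomputable def graphTangent (N : E) (e : ι → E) (w : (ι → ℝ) → ℝ) (x η : ι → ℝ) : E :=
  ∑ i, η i • e i - (fderiv ℝ w x η) • N

/-- The Jacobian matrix of the horizontal part of the normal of a graph. -/
noncomputable def graphJacobian (w : (ι → ℝ) → ℝ) (x : ι → ℝ) : Matrix ι ι ℝ :=
  Matrix.of fun j i => pderiv i (fun y => pderiv j w y * (√(areaSq w y))⁻¹) x

namespace IsAdaptedFrame

variable {N : E} {e : ι → E} (h : IsAdaptedFrame N e) {w : (ι → ℝ) → ℝ}
include h

omit [DecidableEq ι] in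
theorem inner_graphTangent_left (x η : ι → ℝ) (i : ι) : ⟪e i, graphTangent N e w x η⟫ = η i := by
  rw [graphTangent, inner_sub_right, h.inner_sum, inner_smul_right, h.inner_eq_zero]; simp

omit [DecidableEq ι] in
theorem inner_graphTangent (x η η' : ι → ℝ) :
    ⟪graphTangent N e w x η, graphTangent N e w x η'⟫
      = ∑ i, η i * η' i + fderiv ℝ w x η * fderiv ℝ w x η' := by
  have := h.inner_combination η η' (-fderiv ℝ w x η) (-fderiv ℝ w x η')
  simpa [graphTangent, sub_eq_add_neg] using this

theorem inner_graphNormal_graphTangent (x η : ι → ℝ) :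
    ⟪graphNormal N e w x, graphTangent N e w x η⟫ = 0 := by
  have := h.inner_combination (fun j => pderiv j w x) η 1 (-fderiv ℝ w x η)
  rw [one_smul, neg_smul, ← sub_eq_add_neg, fderiv_eq_sum_pderiv (η := η)] at this
  rw [graphNormal, inner_smul_left, graphTangent, fderiv_eq_sum_pderiv, this]
  simp [mul_comm]

theorem inner_graphNormal (x : ι → ℝ) (j : ι) :
    ⟪e j, graphNormal N e w x⟫ = pderiv j w x * (√(areaSq w x))⁻¹ := by
  rw [graphNormal, inner_smul_right, inner_add_right, h.inner_sum, h.inner_eq_zero, add_zero,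
    mul_comm]

theorem inner_fderiv_graphNormal (hw : ContDiff ℝ 4 w) (x η : ι → ℝ) (j : ι) :
    ⟪e j, fderiv ℝ (graphNormal N e w) x η⟫ = (graphJacobian w x).mulVec η j := by
  have hd : HasFDerivAt (graphNormal N e w) (fderiv ℝ (graphNormal N e w) x) x :=
    ((contDiff_graphNormal N e hw).differentiable (by norm_num) x).hasFDerivAt
  have h1 : HasFDerivAt (fun y => pderiv j w y * (√(areaSq w y))⁻¹) _ x :=
    (((innerSL ℝ (e j)).hasFDerivAt).comp x hd).congr_of_eventuallyEq
      (Eventually.of_forall fun y => (by simp [h.inner_graphNormal]))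
  have h2 : ⟪e j, fderiv ℝ (graphNormal N e w) x η⟫
      = fderiv ℝ (fun y => pderiv j w y * (√(areaSq w y))⁻¹) x η := by
    rw [h1.fderiv]; simp
  rw [h2, fderiv_eq_sum_pderiv, Matrix.mulVec, dotProduct]
  exact Finset.sum_congr rfl fun i _ => mul_comm _ _

theorem inner_graphNormal_fderiv (hw : ContDiff ℝ 4 w) (x η : ι → ℝ) :
    ⟪graphNormal N e w x, fderiv ℝ (graphNormal N e w) x η⟫ = 0 := by
  have hd : HasFDerivAt (graphNormal N e w) (fderiv ℝ (graphNormal N e w) x) x :=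
    ((contDiff_graphNormal N e hw).differentiable (by norm_num) x).hasFDerivAt
  have h1 := hd.norm_sq
  have h2 : HasFDerivAt (fun y => ‖graphNormal N e w y‖ ^ 2) (0 : (ι → ℝ) →L[ℝ] ℝ) x := by
    simp only [h.norm_graphNormal]
    exact hasFDerivAt_const _ _
  have h3 := congrArg (fun L => L η) (h1.unique h2)
  simpa using h3

/-- Differentiate the orthogonality of normal and tangent vector along the graph: the second
fundamental form is the Hessian of w times the vertical component of the normal. -/
theorem inner_fderiv_graphNormal_graphTangent (hw : ContDiff ℝ 4 w) (x η : ι → ℝ) :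
    ⟪fderiv ℝ (graphNormal N e w) x η, graphTangent N e w x η⟫
      = (√(areaSq w x))⁻¹ * ∑ i, ∑ j, η i * η j * pderiv i (pderiv j w) x := by
  have hwd : ContDiff ℝ 3 (fderiv ℝ w) := hw.fderiv_right (by norm_num)
  have hd : HasFDerivAt (graphNormal N e w) (fderiv ℝ (graphNormal N e w) x) x :=
    ((contDiff_graphNormal N e hw).differentiable (by norm_num) x).hasFDerivAt
  have ht : HasFDerivAt (fun y => graphTangent N e w y η)
      (-(((fderiv ℝ (fderiv ℝ w) x).flip η).smulRight N)) x := by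
    have h1 := (hwd.differentiable (by norm_num) x).hasFDerivAt.clm_apply (hasFDerivAt_const η x)
    have h2 := (h1.smul_const N).const_sub (∑ i, η i • e i)
    refine h2.congr_fderiv ?_
    ext v
    simp
  have h1 := hd.inner ℝ ht
  have h2 : HasFDerivAt (fun y => ⟪graphNormal N e w y, graphTangent N e w y η⟫)
      (0 : (ι → ℝ) →L[ℝ] ℝ) x := by
    simp only [h.inner_graphNormal_graphTangent]
    exact hasFDerivAt_const _ _
  have h3 := congrArg (fun L => L η) (h1.unique h2)
  have h4 : ⟪graphNormal N e w x, N⟫ = (√(areaSq w x))⁻¹ := by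
    rw [graphNormal, inner_smul_left, inner_add_left, h.inner_normal_normal, real_inner_comm,
      h.inner_normal_sum]
    simp
  have h5 : fderiv ℝ (fderiv ℝ w) x η η = ∑ i, ∑ j, η i * η j * pderiv i (pderiv j w) x := by
    simp_rw [pderiv_pderiv (hw.of_le (by norm_num))]
    rw [clm_eq_sum (fderiv ℝ (fderiv ℝ w) x) η, _root_.sum_apply]
    refine Finset.sum_congr rfl fun i _ => ?_
    rw [_root_.smul_apply, clm_eq_sum (fderiv ℝ (fderiv ℝ w) x (Pi.single i 1)) η, Finset.smul_sum]
    exact Finset.sum_congr rfl fun j _ => by simp only [smul_eq_mul]; ring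
  simp [inner_smul_right, h4] at h3
  rw [← h5]
  linarith

/-- A tangent vector is determined by its horizontal components, since orthogonality to the normal
gives the vertical one. -/
theorem graphTangent_inner {x : ι → ℝ} {τ : E} (hτ : ⟪graphNormal N e w x, τ⟫ = 0) :
    graphTangent N e w x (fun i => ⟪e i, τ⟫) = τ := by
  have hpos : (√(areaSq w x))⁻¹ ≠ 0 := (inv_pos.2 (Real.sqrt_pos.2 (areaSq_pos w x))).ne'
  rw [graphNormal, inner_smul_left] at hτ
  have h3 : ⟪∑ j, pderiv j w x • e j + N, τ⟫ = 0 := by simpa [hpos] using hτ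
  rw [inner_add_left, _root_.sum_inner] at h3
  have h4 : ⟪N, τ⟫ = -fderiv ℝ w x (fun i => ⟪e i, τ⟫) := by
    rw [fderiv_eq_sum_pderiv]
    simp only [inner_smul_left, conj_trivial] at h3
    rw [Finset.sum_congr rfl fun i _ => mul_comm _ _]
    linarith
  conv_rhs => rw [h.expand τ, h4]
  rw [graphTangent, neg_smul, sub_eq_add_neg]

end IsAdaptedFrame

omit [DecidableEq ι] in
theorem tendsto_graphPoint {X₀ N : E} {e : ι → E} {w : (ι → ℝ) → ℝ} (hw : ContDiff ℝ 4 w)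
    (hw0 : w 0 = 0) : Tendsto (graphPoint X₀ N e w) (𝓝 0) (𝓝 X₀) := by
  have h := (contDiff_graphPoint X₀ N e hw).continuous.tendsto 0
  simpa [graphPoint, hw0] using h

namespace IsLocalGraph

variable {M : Set E} {ν : E → sphere (0 : E) 1} {X₀ : E} {e : ι → E} {w : (ι → ℝ) → ℝ}
  (h : IsLocalGraph M ν X₀ e w)
include h

theorem tendsto : Tendsto (graphPoint X₀ (ν X₀) e w) (𝓝 0) (𝓝[M] X₀) :=
  tendsto_nhdsWithin_iff.2 ⟨tendsto_graphPoint h.contDiff h.zero, h.mem⟩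

/-- A local extension of the normal to the ambient space. -/
theorem normal_eq_extension : ∀ᶠ X in 𝓝[M] X₀,
    (ν X : E) = graphNormal (ν X₀ : E) e w (fun i => ⟪e i, X - X₀⟫) := by
  have c2 : Tendsto (fun X : E => (fun i => ⟪e i, X - X₀⟫ : ι → ℝ)) (𝓝 X₀) (𝓝 0) := by
    refine Continuous.tendsto' (by fun_prop) _ _ ?_
    simp; rfl
  filter_upwards [h.cover, (c2.eventually h.normal).filter_mono (nhdsWithin_le_nhds (s := M))]
    with X h1 h2
  rw [← h1] at h2
  exact h2

theorem eventually_differentiableWithinAt :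
    ∀ᶠ X in 𝓝[M] X₀, DifferentiableWithinAt ℝ (fun Y => (ν Y : E)) M X := by
  filter_upwards [eventually_eventually_nhdsWithin.2 h.normal_eq_extension,
    h.normal_eq_extension] with X h1 h2
  have hc : Differentiable ℝ (fun X => graphNormal (ν X₀ : E) e w (fun i => ⟪e i, X - X₀⟫)) :=
    ((contDiff_graphNormal (ν X₀ : E) e h.contDiff).differentiable (by norm_num)).comp
      (differentiable_pi.2 fun i =>
        (innerSL ℝ (e i)).differentiable.comp (differentiable_id.sub_const X₀))
  exact (hc X).differentiableWithinAt.congr_of_eventuallyEq h1 h2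

/-- The derivative of the normal along the graph. -/
theorem eventually_fderivWithin : ∀ᶠ x in 𝓝 0, ∀ η,
    fderivWithin ℝ (fun Y => (ν Y : E)) M (graphPoint X₀ (ν X₀) e w x)
      (graphTangent (ν X₀ : E) e w x η) = fderiv ℝ (graphNormal (ν X₀ : E) e w) x η := by
  filter_upwards [h.tendsto.eventually h.eventually_differentiableWithinAt,
    h.mem.eventually_nhds, h.normal.eventually_nhds] with x h1 h2 h3 η
  have hY := (hasFDerivAt_graphPoint X₀ (ν X₀ : E) e
    (h.contDiff.differentiable (by norm_num) x))
  have h4 := h1.hasFDerivWithinAt.comp_hasFDerivAt x hY h2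
  have h5 : HasFDerivAt (graphNormal (ν X₀ : E) e w) _ x :=
    h4.congr_of_eventuallyEq (h3.mono fun y hy => hy.symm)
  rw [h5.fderiv]
  simp [graphTangent]

/-- The normal curvature in a local graph. -/
theorem eventually_inner_fderivWithin : ∀ᶠ X in 𝓝[M] X₀, ∀ ξ, ⟪(ν X : E), ξ⟫ = 0 →
    ⟪fderivWithin ℝ (fun Y => (ν Y : E)) M X ξ, ξ⟫
      = (√(areaSq w fun i => ⟪e i, X - X₀⟫))⁻¹ * ∑ i, ∑ j, ⟪e i, ξ⟫ * ⟪e j, ξ⟫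
        * pderiv i (pderiv j w) (fun i => ⟪e i, X - X₀⟫) := by
  have c2 : Tendsto (fun X : E => (fun i => ⟪e i, X - X₀⟫ : ι → ℝ)) (𝓝[M] X₀) (𝓝 0) := by
    refine (Continuous.tendsto' (by fun_prop) _ _ ?_).mono_left nhdsWithin_le_nhds
    simp; rfl
  filter_upwards [h.cover, h.normal_eq_extension, c2.eventually h.eventually_fderivWithin]
    with X h1 h2 h3 ξ hξ
  rw [h2] at hξ
  have h4 := h3 fun i => ⟪e i, ξ⟫
  rw [h.frame.graphTangent_inner hξ, ← h1] at h4
  have h5 := h.frame.inner_fderiv_graphNormal_graphTangent h.contDiff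
    (fun i => ⟪e i, X - X₀⟫) fun i => ⟪e i, ξ⟫
  rw [h.frame.graphTangent_inner hξ] at h5
  rw [h4, h5]

/-- The Weingarten map is conjugate to the Jacobian of the horizontal part of the normal. -/
theorem eventually_charpoly [FiniteDimensional ℝ E] : ∀ᶠ x in 𝓝 0,
    (weingartenMap M ν (graphPoint X₀ (ν X₀) e w x)).charpoly = (graphJacobian w x).charpoly := by
  filter_upwards [h.eventually_fderivWithin, h.normal] with x h1 h2
  set X := graphPoint X₀ (ν X₀) e w x with hX
  have hfr := h.frame
  have hmem : ∀ η, graphTangent (ν X₀ : E) e w x η ∈ tangentHyperplane ν X := fun η => by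
    rw [Submodule.mem_orthogonal_singleton_iff_inner_right, h2]
    exact hfr.inner_graphNormal_graphTangent x η
  have hsurj : ∀ τ ∈ tangentHyperplane ν X,
      graphTangent (ν X₀ : E) e w x (fun i => ⟪e i, τ⟫) = τ := fun τ hτ => by
    rw [Submodule.mem_orthogonal_singleton_iff_inner_right, h2] at hτ
    exact hfr.graphTangent_inner hτ
  let D : (ι → ℝ) ≃ₗ[ℝ] tangentHyperplane ν X :=
    { toFun := fun η => ⟨graphTangent (ν X₀ : E) e w x η, hmem η⟩
      invFun := fun τ i => ⟪e i, (τ : E)⟫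
      map_add' := fun a b => by
        ext
        simp only [graphTangent, Pi.add_apply, add_smul, Finset.sum_add_distrib, map_add,
          Submodule.coe_add]
        abel
      map_smul' := fun a b => by
        ext
        simp only [graphTangent, Pi.smul_apply, smul_eq_mul, map_smul, RingHom.id_apply,
          Submodule.coe_smul, smul_sub, Finset.smul_sum, smul_smul]
      left_inv := fun η => funext fun i => hfr.inner_graphTangent_left x η i
      right_inv := fun τ => Subtype.ext (hsurj τ τ.2) }
  -- Horizontal coordinates identify the tangent hyperplane with ℝⁿ without being an isometry. The
  -- resulting matrix need not be symmetric, but only its characteristic polynomial matters.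
  have hconj : weingartenMap M ν X = D.conj (Matrix.toLin' (graphJacobian w x)) := by
    refine LinearMap.ext fun τ => ?_
    obtain ⟨η, rfl⟩ := D.surjective τ
    rw [LinearEquiv.conj_apply_apply, D.symm_apply_apply]
    have h3 : fderiv ℝ (graphNormal (ν X₀ : E) e w) x η ∈ tangentHyperplane ν X := by
      rw [Submodule.mem_orthogonal_singleton_iff_inner_right, h2]
      exact hfr.inner_graphNormal_fderiv h.contDiff x η
    have h4 : weingartenMap M ν X (D η) = ⟨fderiv ℝ (graphNormal (ν X₀ : E) e w) x η, h3⟩ := by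
      have h5 : weingartenMap M ν X (D η) = (tangentHyperplane ν X).orthogonalProjectionOnto
        (fderivWithin ℝ (fun Y => (ν Y : E)) M X (graphTangent (ν X₀ : E) e w x η)) := rfl
      rw [h5, h1 η]
      exact Submodule.orthogonalProjectionOnto_mem_subspace_eq_self (⟨_, h3⟩ : tangentHyperplane ν X)
    rw [h4]
    refine Subtype.ext ?_
    change _ = graphTangent (ν X₀ : E) e w x _
    refine (hsurj _ h3).symm.trans ?_
    congr 1
    funext j
    rw [hfr.inner_fderiv_graphNormal h.contDiff, Matrix.toLin'_apply]
  rw [hconj, LinearEquiv.charpoly_conj, Matrix.charpoly_toLin']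

end IsLocalGraph

end Weingarten

/-! ### Graphs in principal frames -/

section PrincipalGraph

open Filter Topology

variable {E : Type*} [NormedAddCommGroup E] [InnerProductSpace ℝ E]

section

variable {ι : Type*} [DecidableEq ι] [Fintype ι]

/-- The gradient of w vanishes at the base point, so the area factor equals 1 and its derivative is
multiplied by 0. -/
theorem graphJacobian_zero {w : (ι → ℝ) → ℝ} (hw : ContDiff ℝ 4 w)
    (h0 : ∀ j, pderiv j w 0 = 0) (i j : ι) :
    graphJacobian w 0 j i = pderiv i (pderiv j w) 0 := by
  have h1 : DifferentiableAt ℝ (pderiv j w) 0 :=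
    (contDiff_pderiv (m := 3) hw (by norm_num) j).differentiable (by norm_num) 0
  have h2 := (contDiff_inv_sqrt_areaSq hw).differentiable (by norm_num) 0
  have h3 := h1.hasFDerivAt.mul h2.hasFDerivAt
  have h4 : areaSq w 0 = 1 := by simp [areaSq, h0]
  have h5 : graphJacobian w 0 j i
      = fderiv ℝ (pderiv j w * fun x => (√(areaSq w x))⁻¹) 0 (Pi.single i 1) := rfl
  rw [h5, h3.fderiv, _root_.add_apply, _root_.smul_apply, h0 j, h4]
  simp [pderiv]

theorem IsLocalGraph.inner_weingartenMap [FiniteDimensional ℝ E] {M : Set E}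
    {ν : E → sphere (0 : E) 1} {X₀ : E} {e : ι → E} {w : (ι → ℝ) → ℝ}
    (h : IsLocalGraph M ν X₀ e w) (τ τ' : tangentHyperplane ν X₀) :
    ⟪weingartenMap M ν X₀ τ, τ'⟫
      = ∑ j, ∑ i, ⟪e j, (τ' : E)⟫ * ⟪e i, (τ : E)⟫ * pderiv i (pderiv j w) 0 := by
  have hfr := h.frame
  have hX : graphPoint X₀ (ν X₀ : E) e w 0 = X₀ := by simp [graphPoint, h.zero]
  have hcoord : ∀ τ : tangentHyperplane ν X₀, (τ : E) = ∑ i, ⟪e i, (τ : E)⟫ • e i := fun τ => by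
    have h1 := hfr.expand (τ : E)
    rwa [Submodule.mem_orthogonal_singleton_iff_inner_right.1 τ.2, zero_smul, add_zero] at h1
  have hτ : graphTangent (ν X₀ : E) e w 0 (fun i => ⟪e i, (τ : E)⟫) = τ := by
    rw [graphTangent, fderiv_eq_sum_pderiv]
    simp only [h.pderiv_zero, mul_zero, Finset.sum_const_zero, zero_smul, sub_zero]
    exact (hcoord τ).symm
  have h1 := h.eventually_fderivWithin.self_of_nhds (fun i => ⟪e i, (τ : E)⟫)
  rw [hX, hτ] at h1
  have h2 : weingartenMap M ν X₀ τ = (tangentHyperplane ν X₀).orthogonalProjectionOnto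
      (fderivWithin ℝ (fun Y => (ν Y : E)) M X₀ τ) := rfl
  rw [h2, Submodule.inner_orthogonalProjectionOnto_eq_of_mem_right, h1]
  conv_lhs => rw [hcoord τ', _root_.inner_sum]
  refine Finset.sum_congr rfl fun j _ => ?_
  rw [inner_smul_right, real_inner_comm (e j), hfr.inner_fderiv_graphNormal h.contDiff,
    Matrix.mulVec, dotProduct, Finset.mul_sum]
  refine Finset.sum_congr rfl fun i _ => ?_
  rw [graphJacobian_zero h.contDiff h.pderiv_zero]
  ring

/-- A local graph in a frame of principal directions. -/
structure IsPrincipalGraph (M : Set E) (ν : E → sphere (0 : E) 1) (X₀ : E) (e : ι → E)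
    (w : (ι → ℝ) → ℝ) (κ : ι → ℝ) : Prop extends IsLocalGraph M ν X₀ e w where
  hessian : ∀ i j, pderiv i (pderiv j w) 0 = if i = j then κ i else 0

end

variable [FiniteDimensional ℝ E] {M : Set E} {ν : E → sphere (0 : E) 1} {z X₀ : E}

/-- In a local graph based at X₀ the associated bilinear form is the Hessian of w. -/
theorem weingartenMap_isSymmetric (hM : IsHypersurface 4 M) (hν : IsOuterUnitNormal M ν)
    (hz : z ∈ interior (convexHull ℝ M)) (hX₀ : X₀ ∈ M) :
    (weingartenMap M ν X₀).IsSymmetric := by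
  obtain ⟨w, hw⟩ := exists_isLocalGraph hM hν hz hX₀
    (isAdaptedFrame_of_basis (stdOrthonormalBasis ℝ (tangentHyperplane ν X₀)))
  intro τ τ'
  rw [hw.inner_weingartenMap, real_inner_comm, hw.inner_weingartenMap, Finset.sum_comm]
  refine Finset.sum_congr rfl fun i _ => Finset.sum_congr rfl fun j _ => ?_
  rw [pderiv_comm (hw.contDiff.of_le (by norm_num)) i j]
  ring

omit [FiniteDimensional ℝ E] in
theorem finrank_tangentHyperplane {n : ℕ} (hn : Module.finrank ℝ E = n + 1) (X : E) :
    Module.finrank ℝ (tangentHyperplane ν X) = n := by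
  have : Fact (Module.finrank ℝ E = n + 1) := ⟨hn⟩
  exact Submodule.finrank_orthogonal_span_singleton (ne_zero_of_mem_unit_sphere (ν X))

/-- An orthonormal eigenbasis of the Weingarten map serves as frame, which makes the Hessian of w
diagonal at the base point. -/
theorem exists_isPrincipalGraph {n : ℕ} (hn : Module.finrank ℝ E = n + 1)
    (hM : IsHypersurface 4 M) (hν : IsOuterUnitNormal M ν)
    (hz : z ∈ interior (convexHull ℝ M)) (hX₀ : X₀ ∈ M) :
    ∃ (e : Fin n → E) (w : (Fin n → ℝ) → ℝ) (κ : Fin n → ℝ), IsPrincipalGraph M ν X₀ e w κ ∧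
      principalCurvatures M ν X₀ = Finset.univ.val.map κ := by
  have hsymm := weingartenMap_isSymmetric hM hν hz hX₀
  have hfin := finrank_tangentHyperplane (ν := ν) hn X₀
  set b := hsymm.eigenvectorBasis hfin with hb
  obtain ⟨w, hw⟩ := exists_isLocalGraph hM hν hz hX₀ (isAdaptedFrame_of_basis b)
  refine ⟨_, w, hsymm.eigenvalues hfin, ⟨hw, fun i j => ?_⟩,
    hsymm.roots_charpoly_eq_eigenvalues hfin⟩
  have h1 := hw.inner_weingartenMap (b i) (b j)
  have h2 : weingartenMap M ν X₀ (b i) = hsymm.eigenvalues hfin i • b i :=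
    hsymm.apply_eigenvectorBasis hfin i
  have h3 : ∀ i j, ⟪(b i : E), (b j : E)⟫ = if i = j then 1 else 0 := fun i j => by
    rw [← Submodule.coe_inner]; exact orthonormal_iff_ite.1 b.orthonormal i j
  rw [h2, inner_smul_left, Submodule.coe_inner] at h1
  simp only [h3] at h1
  simp at h1
  rw [← h1]

/-- Symmetry makes all eigenvalues real, so that the real roots are complete and their σ_k is a sum
of principal minors. -/
theorem splits_charpoly_weingartenMap (hM : IsHypersurface 4 M) (hν : IsOuterUnitNormal M ν)
    (hz : z ∈ interior (convexHull ℝ M)) (hX₀ : X₀ ∈ M) :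
    (weingartenMap M ν X₀).charpoly.Splits := by
  rw [(weingartenMap_isSymmetric hM hν hz hX₀).charpoly_eq rfl]
  exact Polynomial.Splits.prod fun i _ => Polynomial.Splits.X_sub_C _

theorem IsLocalGraph.eventually_esymm {ι : Type*} [DecidableEq ι] [Fintype ι]
    {e : ι → E} {w : (ι → ℝ) → ℝ} (h : IsLocalGraph M ν X₀ e w)
    (hM : IsHypersurface 4 M) (hν : IsOuterUnitNormal M ν)
    (hz : z ∈ interior (convexHull ℝ M)) {k : ℕ} (hk : k ≤ Fintype.card ι) :
    ∀ᶠ x in 𝓝 0, (principalCurvatures M ν (graphPoint X₀ (ν X₀) e w x)).esymm k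
      = sumPrincipalMinors k (graphJacobian w x) := by
  filter_upwards [h.eventually_charpoly, h.mem] with x h1 h2
  rw [principalCurvatures, h1]
  exact esymm_roots_charpoly _ (h1 ▸ splits_charpoly_weingartenMap hM hν hz h2) hk

omit [FiniteDimensional ℝ E] in
-- M lies below its tangent hyperplane, so w ≥ 0 = w(0), and the Hessian at a minimum is
-- nonnegative.
theorem IsPrincipalGraph.nonneg {ι : Type*} [DecidableEq ι] [Fintype ι]
    {e : ι → E} {w : (ι → ℝ) → ℝ} {κ : ι → ℝ} (h : IsPrincipalGraph M ν X₀ e w κ)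
    (hν : IsOuterUnitNormal M ν) (hX₀ : X₀ ∈ M) (i : ι) : 0 ≤ κ i := by
  have hw0 : ∀ᶠ x in 𝓝 0, 0 ≤ w x := by
    filter_upwards [h.mem] with x hx
    have h1 := hν X₀ hX₀ _ hx
    have hfr := h.frame
    rw [graphPoint, add_sub_assoc, add_sub_cancel_left, inner_sub_right, hfr.inner_normal_sum,
      inner_smul_right, hfr.inner_normal_normal] at h1
    linarith
  have h1 := (hasJet_line (h.contDiff.of_le (by norm_num)) i).neg
  have hc : Tendsto (fun t : ℝ => t • (Pi.single i (1 : ℝ) : ι → ℝ)) (𝓝 0) (𝓝 0) :=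
    Continuous.tendsto' (by fun_prop) _ _ (by simp)
  have h2 := (h1.nonpos_of_le (by
    filter_upwards [hc.eventually hw0] with t ht
    rw [h.zero]; linarith)).2
  rw [h.hessian, if_pos rfl] at h2
  linarith

theorem esymm_map_univ {n : ℕ} (κ : Fin n → ℝ) (k : ℕ) :
    (Finset.univ.val.map κ).esymm k = esymmOn k Finset.univ κ :=
  Finset.esymm_map_val κ Finset.univ k

end PrincipalGraph

/-! ### Expansions of the graph quantities along coordinate lines -/

section GraphJets

open Filter Topology

variable {ι : Type*} [DecidableEq ι] [Fintype ι]

theorem pderiv_comp_of_hasDerivAt {f : (ι → ℝ) → ℝ} {φ : ℝ → ℝ} {φ' : ℝ} {x : ι → ℝ} (i : ι)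
    (hφ : HasDerivAt φ φ' (f x)) (hf : DifferentiableAt ℝ f x) :
    pderiv i (fun y => φ (f y)) x = φ' * pderiv i f x := by
  have h := hφ.comp_hasFDerivAt x hf.hasFDerivAt
  have h2 : pderiv i (fun y => φ (f y)) x = fderiv ℝ (φ ∘ f) x (Pi.single i 1) := rfl
  rw [h2, h.fderiv]
  simp [pderiv]

theorem pderiv_mul {f g : (ι → ℝ) → ℝ} {x : ι → ℝ} (i : ι) (hf : DifferentiableAt ℝ f x)
    (hg : DifferentiableAt ℝ g x) :
    pderiv i (fun y => f y * g y) x = f x * pderiv i g x + pderiv i f x * g x := by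
  have h := hf.hasFDerivAt.mul hg.hasFDerivAt
  have h2 : pderiv i (fun y => f y * g y) x = fderiv ℝ (f * g) x (Pi.single i 1) := rfl
  rw [h2, h.fderiv]
  simp [pderiv, mul_comm]

theorem pderiv_areaSq {w : (ι → ℝ) → ℝ} (hw : ContDiff ℝ 4 w) (i : ι) (x : ι → ℝ) :
    pderiv i (areaSq w) x = ∑ j, 2 * pderiv j w x * pderiv i (pderiv j w) x := by
  have h1 : ∀ j, DifferentiableAt ℝ (pderiv j w) x := fun j =>
    (contDiff_pderiv (m := 3) hw (by norm_num) j).differentiable (by norm_num) x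
  have h2 := (HasFDerivAt.fun_sum (u := Finset.univ) fun j _ =>
    (h1 j).hasFDerivAt.pow 2).const_add 1
  have h3 : pderiv i (areaSq w) x
    = fderiv ℝ (fun x => 1 + ∑ j, pderiv j w x ^ 2) x (Pi.single i 1) := rfl
  rw [h3, HasFDerivAt.fderiv h2, _root_.sum_apply]
  refine Finset.sum_congr rfl fun j _ => ?_
  simp [pderiv]

theorem graphJacobian_eq {w : (ι → ℝ) → ℝ} (hw : ContDiff ℝ 4 w) (x : ι → ℝ) (i j : ι) :
    graphJacobian w x j i = pderiv i (pderiv j w) x * (√(areaSq w x))⁻¹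
      - pderiv j w x * ((∑ s, pderiv s w x * pderiv i (pderiv s w) x)
        * ((√(areaSq w x))⁻¹ * ((√(areaSq w x))⁻¹ * (√(areaSq w x))⁻¹))) := by
  have h1 : DifferentiableAt ℝ (pderiv j w) x :=
    (contDiff_pderiv (m := 3) hw (by norm_num) j).differentiable (by norm_num) x
  have h2 := (contDiff_inv_sqrt_areaSq hw).differentiable (by norm_num) x
  have hpos := areaSq_pos w x
  have hsq := Real.sqrt_pos.2 hpos
  have hd := (Real.hasDerivAt_sqrt hpos.ne').inv hsq.ne'
  have h4 := pderiv_comp_of_hasDerivAt i hd ((contDiff_areaSq hw).differentiable (by norm_num) x)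
  have h5 : graphJacobian w x j i = pderiv i (fun y => pderiv j w y * (√(areaSq w y))⁻¹) x := rfl
  simp only [Pi.inv_apply] at h4
  rw [h5, pderiv_mul i h1 h2, h4, pderiv_areaSq hw]
  have h6 : ∑ s, 2 * pderiv s w x * pderiv i (pderiv s w) x
      = 2 * ∑ s, pderiv s w x * pderiv i (pderiv s w) x := by
    rw [Finset.mul_sum]; exact Finset.sum_congr rfl fun s _ => by ring
  rw [h6]
  field_simp
  ring

theorem HasJet.prodMk {G H : Type*} [NormedAddCommGroup G] [NormedSpace ℝ G]
    [NormedAddCommGroup H] [NormedSpace ℝ H] {f : ℝ → G} {g : ℝ → H} {a b c : G} {a' b' c' : H}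
    (hf : HasJet f a b c) (hg : HasJet g a' b' c') :
    HasJet (fun t => (f t, g t)) (a, a') (b, b') (c, c') := by
  simpa using (hf.clm (ContinuousLinearMap.inl ℝ G H)).add (hg.clm (ContinuousLinearMap.inr ℝ G H))

namespace IsPrincipalGraph

variable {E : Type*} [NormedAddCommGroup E] [InnerProductSpace ℝ E]
  {M : Set E} {ν : E → sphere (0 : E) 1} {X₀ : E} {e : ι → E} {w : (ι → ℝ) → ℝ} {κ : ι → ℝ}
  (h : IsPrincipalGraph M ν X₀ e w κ)
include h

theorem hasJet_height (l : ι) :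
    HasJet (fun t : ℝ => w (t • Pi.single l (1 : ℝ))) 0 0 (2⁻¹ * κ l) :=
  (hasJet_line (h.contDiff.of_le (by norm_num)) l).congr_coeff h.zero (h.pderiv_zero l)
    (by rw [h.hessian, if_pos rfl])

theorem hasJet_pderiv (l j : ι) :
    HasJet (fun t : ℝ => pderiv j w (t • Pi.single l (1 : ℝ))) 0 (if l = j then κ l else 0)
      (2⁻¹ * pderiv l (pderiv l (pderiv j w)) 0) :=
  (hasJet_line (contDiff_pderiv h.contDiff (by norm_num) j) l).congr_coeff (h.pderiv_zero j)
    (h.hessian l j) rfl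

theorem hasJet_pderiv_pderiv (l i j : ι) :
    HasJet (fun t : ℝ => pderiv i (pderiv j w) (t • Pi.single l (1 : ℝ)))
      (if i = j then κ i else 0) (pderiv l (pderiv i (pderiv j w)) 0)
      (2⁻¹ * pderiv l (pderiv l (pderiv i (pderiv j w))) 0) :=
  (hasJet_line (contDiff_pderiv (contDiff_pderiv (m := 3) h.contDiff (by norm_num) j)
    (by norm_num) i) l).congr_coeff (h.hessian i j) rfl rfl

theorem hasJet_areaSq (l : ι) :
    HasJet (fun t : ℝ => areaSq w (t • Pi.single l (1 : ℝ))) 1 0 (κ l ^ 2) := by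
  have h1 := (HasJet.const (1 : ℝ)).add (HasJet.sum Finset.univ fun j _ =>
    (h.hasJet_pderiv l j).mul (h.hasJet_pderiv l j))
  refine (h1.congr_coeff (by simp) (by simp) (by simp [pow_two])).congr_fun
    (Eventually.of_forall fun t => ?_)
  simp [areaSq, pow_two]

theorem hasJet_inv_sqrt_areaSq (l : ι) :
    HasJet (fun t : ℝ => (√(areaSq w (t • Pi.single l (1 : ℝ))))⁻¹) 1 0 (-κ l ^ 2 / 2) :=
  (h.hasJet_areaSq l).inv_sqrt

/-- The cubic terms in κ come from the area factor and from the part of the Jacobian quadratic in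
the gradient. They take the place of the commutator terms given by the Gauss equation. -/
theorem hasJet_graphJacobian (l i j : ι) :
    HasJet (fun t : ℝ => graphJacobian w (t • Pi.single l (1 : ℝ)) i j)
      (if i = j then κ i else 0) (pderiv l (pderiv j (pderiv i w)) 0)
      (2⁻¹ * pderiv l (pderiv l (pderiv j (pderiv i w))) 0
        - (if i = j then 2⁻¹ * (κ l ^ 2 * κ i) else 0)
        - (if l = i then (if l = j then κ l ^ 3 else 0) else 0)) := by
  have hv := h.hasJet_inv_sqrt_areaSq l
  have h1 := ((h.hasJet_pderiv_pderiv l j i).mul hv).sub ((h.hasJet_pderiv l i).mul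
    ((HasJet.sum Finset.univ fun s _ => (h.hasJet_pderiv l s).mul
      (h.hasJet_pderiv_pderiv l j s)).mul (hv.mul (hv.mul hv))))
  refine (h1.congr_coeff ?_ ?_ ?_).congr_fun
    (Eventually.of_forall fun t => (graphJacobian_eq h.contDiff _ j i).symm)
  · by_cases hij : i = j
    · simp [hij]
    · simp [hij, Ne.symm hij]
  · simp
  · by_cases hij : i = j
    · subst hij
      by_cases hl : l = i
      · subst hl; simp; ring
      · simp [hl]; ring
    · by_cases hl : l = i
      · subst hl; simp [hij, Ne.symm hij]
      · simp [hij, Ne.symm hij, hl]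

theorem hasJet_graphPoint (l : ι) :
    HasJet (fun t : ℝ => graphPoint X₀ (ν X₀ : E) e w (t • Pi.single l (1 : ℝ))) X₀ (e l)
      (-(2⁻¹ * κ l) • (ν X₀ : E)) := by
  have h1 := ((HasJet.const X₀).add (HasJet.ident.smul (HasJet.const (e l)))).sub
    ((h.hasJet_height l).smul (HasJet.const (ν X₀ : E)))
  refine (h1.congr_coeff (by simp) (by simp) (by simp)).congr_fun
    (Eventually.of_forall fun t => ?_)
  simp [graphPoint, Pi.single_apply, mul_ite, ite_smul]

theorem hasJet_graphNormal (l : ι) :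
    HasJet (fun t : ℝ => graphNormal (ν X₀ : E) e w (t • Pi.single l (1 : ℝ))) (ν X₀ : E)
      (κ l • e l) (∑ j, (2⁻¹ * pderiv l (pderiv l (pderiv j w)) 0) • e j
        - (2⁻¹ * κ l ^ 2) • (ν X₀ : E)) := by
  have h1 := (h.hasJet_inv_sqrt_areaSq l).smul ((HasJet.sum Finset.univ fun j _ =>
    (h.hasJet_pderiv l j).smul (HasJet.const (e j))).add (HasJet.const (ν X₀ : E)))
  refine h1.congr_coeff (by simp) (by simp [ite_smul]) ?_
  simp
  rw [neg_div, neg_smul, sub_eq_add_neg, div_eq_inv_mul]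

end IsPrincipalGraph

end GraphJets

/-! ### Differentiating the curvature equation twice -/

section CurvatureEquation

open Filter Topology

theorem norm_apply_le_of_iteratedFDeriv_one {G : Type*} [NormedAddCommGroup G] [NormedSpace ℝ G]
    {Ψ : G → ℝ} {p : G} {F : ℝ} (h : ‖iteratedFDeriv ℝ 1 Ψ p‖ ≤ F) (v : G) :
    |fderiv ℝ Ψ p v| ≤ F * ‖v‖ := by
  rw [norm_iteratedFDeriv_one] at h
  exact ((fderiv ℝ Ψ p).le_opNorm v).trans (by gcongr)

theorem norm_apply_le_of_iteratedFDeriv_two {G : Type*} [NormedAddCommGroup G] [NormedSpace ℝ G]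
    {Ψ : G → ℝ} {p : G} {F : ℝ} (h : ‖iteratedFDeriv ℝ 2 Ψ p‖ ≤ F) (v : G) :
    |fderiv ℝ (fderiv ℝ Ψ) p v v| ≤ F * ‖v‖ ^ 2 := by
  have h1 := (iteratedFDeriv ℝ 2 Ψ p).le_opNorm fun _ => v
  rw [iteratedFDeriv_two_apply] at h1
  refine h1.trans ?_
  simp only [Finset.prod_const, Finset.card_univ, Fintype.card_fin]
  gcongr

variable {E : Type*} [NormedAddCommGroup E] [InnerProductSpace ℝ E] {ι : Type*} [DecidableEq ι]
  [Fintype ι] {M : Set E} {ν : E → sphere (0 : E) 1} {X₀ : E} {e : ι → E}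
  {w : (ι → ℝ) → ℝ} {κ : ι → ℝ}

namespace IsPrincipalGraph

variable (h : IsPrincipalGraph M ν X₀ e w κ)
include h

theorem hasJet_comp_graph {Ψ : E × E → ℝ} (hΨ : ContDiffAt ℝ 2 Ψ (X₀, (ν X₀ : E))) (l : ι) :
    HasJet (fun t : ℝ => Ψ (graphPoint X₀ (ν X₀ : E) e w (t • Pi.single l (1 : ℝ)),
        graphNormal (ν X₀ : E) e w (t • Pi.single l (1 : ℝ))))
      (Ψ (X₀, (ν X₀ : E)))
      (fderiv ℝ Ψ (X₀, (ν X₀ : E)) (e l, 0) + κ l * fderiv ℝ Ψ (X₀, (ν X₀ : E)) (0, e l))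
      (2⁻¹ * (∑ j, pderiv l (pderiv l (pderiv j w)) 0 * fderiv ℝ Ψ (X₀, (ν X₀ : E)) (0, e j)
        - κ l * fderiv ℝ Ψ (X₀, (ν X₀ : E)) ((ν X₀ : E), κ l • (ν X₀ : E))
        + fderiv ℝ (fderiv ℝ Ψ) (X₀, (ν X₀ : E)) (e l, κ l • e l) (e l, κ l • e l))) := by
  have h1 := ((h.hasJet_graphPoint l).prodMk (h.hasJet_graphNormal l)).comp hΨ
  refine h1.congr_coeff rfl ?_ ?_
  · have h2 : (e l, κ l • e l) = (e l, (0 : E)) + κ l • ((0 : E), e l) := by simp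
    rw [h2, map_add, map_smul, smul_eq_mul]
  · have h2 : (-(2⁻¹ * κ l) • (ν X₀ : E), ∑ j, (2⁻¹ * pderiv l (pderiv l (pderiv j w)) 0) • e j
        - (2⁻¹ * κ l ^ 2) • (ν X₀ : E))
        = ∑ j, (2⁻¹ * pderiv l (pderiv l (pderiv j w)) 0) • ((0 : E), e j)
          - (2⁻¹ * κ l) • ((ν X₀ : E), κ l • (ν X₀ : E)) := by
      ext
      · simp [Prod.fst_sum]
      · simp [Prod.snd_sum, smul_smul, pow_two, mul_assoc]
    rw [h2, map_sub, map_sum, map_smul]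
    simp only [map_smul, smul_eq_mul, mul_assoc, ← Finset.mul_sum]
    ring

variable [FiniteDimensional ℝ E]

/-- The first and second derivatives of the curvature equation. -/
theorem differentiated_equation {z : E} (hM : IsHypersurface 4 M) (hν : IsOuterUnitNormal M ν)
    (hz : z ∈ interior (convexHull ℝ M)) {k : ℕ} (hk : k + 2 ≤ Fintype.card ι) {Ψ : E × E → ℝ}
    (hΨ : ContDiffAt ℝ 2 Ψ (X₀, (ν X₀ : E)))
    (heq : ∀ X ∈ M, (principalCurvatures M ν X).esymm (k + 2) = Ψ (X, (ν X : E))) (l : ι) :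
    esymmOn (k + 2) Finset.univ κ = Ψ (X₀, (ν X₀ : E)) ∧
    ∑ i, esymmOn (k + 1) (Finset.univ.erase i) κ * pderiv l (pderiv i (pderiv i w)) 0
      = fderiv ℝ Ψ (X₀, (ν X₀ : E)) (e l, 0) + κ l * fderiv ℝ Ψ (X₀, (ν X₀ : E)) (0, e l) ∧
    ∑ i, esymmOn (k + 1) (Finset.univ.erase i) κ
        * (pderiv l (pderiv l (pderiv i (pderiv i w))) 0 - κ i * κ l ^ 2)
      - 2 * esymmOn (k + 1) (Finset.univ.erase l) κ * κ l ^ 3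
      + ∑ p, ∑ q ∈ Finset.univ.erase p,
        (pderiv l (pderiv p (pderiv p w)) 0 * pderiv l (pderiv q (pderiv q w)) 0
          - pderiv l (pderiv q (pderiv p w)) 0 * pderiv l (pderiv p (pderiv q w)) 0)
          * esymmOn k ((Finset.univ.erase p).erase q) κ
      = ∑ j, pderiv l (pderiv l (pderiv j w)) 0 * fderiv ℝ Ψ (X₀, (ν X₀ : E)) (0, e j)
        - κ l * fderiv ℝ Ψ (X₀, (ν X₀ : E)) ((ν X₀ : E), κ l • (ν X₀ : E))
        + fderiv ℝ (fderiv ℝ Ψ) (X₀, (ν X₀ : E)) (e l, κ l • e l) (e l, κ l • e l) := by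
  have hc : Tendsto (fun t : ℝ => t • (Pi.single l (1 : ℝ) : ι → ℝ)) (𝓝 0) (𝓝 0) :=
    Continuous.tendsto' (by fun_prop) _ _ (by simp)
  have h1 := hasJet_sumPrincipalMinors k fun i j => h.hasJet_graphJacobian l i j
  have h2 := h1.congr_fun (g := fun t : ℝ => Ψ (graphPoint X₀ (ν X₀ : E) e w
      (t • Pi.single l (1 : ℝ)), graphNormal (ν X₀ : E) e w (t • Pi.single l (1 : ℝ)))) (by
    filter_upwards [hc.eventually (h.eventually_esymm hM hν hz hk), hc.eventually h.mem,
      hc.eventually h.normal] with t h3 h4 h5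
    rw [← h5, ← heq _ h4, h3]
    rfl)
  -- Both sides of the equation are expanded along the l-th coordinate line; the three coefficients
  -- give the equation and its first and second derivatives.
  obtain ⟨ha, hb, hcc⟩ := h2.unique (h.hasJet_comp_graph hΨ l)
  refine ⟨ha, ?_, ?_⟩
  · rw [← hb]
    exact Finset.sum_congr rfl fun i _ => mul_comm _ _
  · have h6 := congrArg (fun y => 2 * y) hcc
    simp only [mul_inv_cancel_left₀ (two_ne_zero : (2 : ℝ) ≠ 0), mul_add] at h6
    rw [← h6]
    congr 1
    simp only [if_true, sub_mul, Finset.sum_sub_distrib, ite_mul, zero_mul]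
    simp only [mul_sub, Finset.sum_sub_distrib, Finset.sum_ite_eq, Finset.mem_univ, if_true]
    congr 1
    · congr 1
      · rw [Finset.mul_sum]
        exact Finset.sum_congr rfl fun i _ => by ring
      · rw [Finset.mul_sum]
        exact Finset.sum_congr rfl fun i _ => by ring
    · ring

end IsPrincipalGraph

end CurvatureEquation

/-! ### First and second order conditions at the maximum -/

section MaximumConditions

open Filter Topology

variable {E : Type*} [NormedAddCommGroup E] [InnerProductSpace ℝ E] {ι : Type*} [DecidableEq ι]
  [Fintype ι] {M : Set E} {ν : E → sphere (0 : E) 1} {X₀ : E} {e : ι → E}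
  {w : (ι → ℝ) → ℝ} {κ : ι → ℝ}

/-- Splits off the inverse area factor, which also appears in the normal curvature, so that the two
combine in the logarithm. -/
theorem IsAdaptedFrame.inner_sub_graphNormal {N : E} (h : IsAdaptedFrame N e)
    (w : (ι → ℝ) → ℝ) (x : ι → ℝ) (z : E) :
    ⟪graphPoint X₀ N e w x - z, graphNormal N e w x⟫
      = (√(areaSq w x))⁻¹ * (∑ s, (x s - ⟪e s, z - X₀⟫) * pderiv s w x
        + (⟪X₀ - z, N⟫ - w x)) := by
  have h1 := h.expand (z - X₀)
  have h2 : graphPoint X₀ N e w x - z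
      = ∑ s, (x s - ⟪e s, z - X₀⟫) • e s + (⟪X₀ - z, N⟫ - w x) • N := by
    have h3 : graphPoint X₀ N e w x - z = ∑ i, x i • e i - w x • N
        - (∑ i, ⟪e i, z - X₀⟫ • e i + ⟪N, z - X₀⟫ • N) := by
      rw [← h1, graphPoint]; abel
    have h4 : ⟪X₀ - z, N⟫ = -⟪N, z - X₀⟫ := by
      rw [real_inner_comm, ← neg_sub z, inner_neg_right]
    rw [h3, h4]
    simp only [sub_smul, Finset.sum_sub_distrib, neg_smul]
    abel
  have h3 := h.inner_combination (fun s => x s - ⟪e s, z - X₀⟫) (fun s => pderiv s w x)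
    (⟪X₀ - z, N⟫ - w x) 1
  rw [one_smul, mul_one] at h3
  rw [h2, graphNormal, inner_smul_right, h3]

namespace IsPrincipalGraph

variable (h : IsPrincipalGraph M ν X₀ e w κ)
include h

/-- The first and second order conditions at a maximum, over unit tangent vectors, of
the normal curvature divided by a power of the support function. -/
theorem maximum_conditions {i₁ : ι} (hκ : 0 < κ i₁) {z : E} {u : ℝ} (hu : u = ⟪X₀ - z, (ν X₀ : E)⟫)
    (hu0 : 0 < u) {N : ℕ}
    (hmax : ∀ X ∈ M, ∀ ξ, ⟪(ν X : E), ξ⟫ = 0 →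
      ⟪fderivWithin ℝ (fun Y => (ν Y : E)) M X ξ, ξ⟫ * u ^ N
        ≤ κ i₁ * ⟪X - z, (ν X : E)⟫ ^ N * ‖ξ‖ ^ 2)
    (i : ι) {ζ : ι → ℝ} (hζ : ζ i₁ = 0) :
    pderiv i (pderiv i₁ (pderiv i₁ w)) 0 / κ i₁ + N * (⟪e i, z - X₀⟫ * κ i) / u = 0 ∧
    (pderiv i (pderiv i (pderiv i₁ (pderiv i₁ w))) 0
        + 4 * ∑ p, pderiv i (pderiv i₁ (pderiv p w)) 0 * ζ p + 2 * ∑ p, κ p * ζ p ^ 2) / κ i₁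
      - pderiv i (pderiv i₁ (pderiv i₁ w)) 0 ^ 2 / κ i₁ ^ 2 - κ i ^ 2 - 2 * ∑ p, ζ p ^ 2
      - (if i = i₁ then 2 * κ i₁ ^ 2 else 0)
      - N * ((κ i - ∑ s, ⟪e s, z - X₀⟫ * pderiv i (pderiv i (pderiv s w)) 0 - κ i ^ 2 * u) / u
        - (⟪e i, z - X₀⟫ * κ i) ^ 2 / u ^ 2) ≤ 0 := by
  have hfr := h.frame
  have hw2 : ContDiff ℝ 2 w := h.contDiff.of_le (by norm_num)
  have hc : Tendsto (fun t : ℝ => t • (Pi.single i (1 : ℝ) : ι → ℝ)) (𝓝 0) (𝓝 0) :=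
    Continuous.tendsto' (by fun_prop) _ _ (by simp)
  set x : ℝ → ι → ℝ := fun t => t • Pi.single i (1 : ℝ) with hx
  -- Along the i-th coordinate line the tangent vector has horizontal part e_{i₁} + tζ. It is not
  -- normalized; its squared length is expanded in `hB`.
  set η : ℝ → ι → ℝ := fun t p => (if p = i₁ then 1 else 0) + t * ζ p with hη
  have hηj : ∀ p, HasJet (fun t => η t p) (if p = i₁ then 1 else 0) (ζ p) 0 := fun p => by
    have := (HasJet.const (if p = i₁ then (1 : ℝ) else 0)).add
      (HasJet.ident.mul (HasJet.const (ζ p)))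
    exact this.congr_coeff (by simp) (by simp) (by simp)
  have hA := h.hasJet_areaSq i
  -- the second fundamental form
  have ha : HasJet (fun t => ∑ p, ∑ q, η t p * η t q * pderiv p (pderiv q w) (x t)) (κ i₁)
      (pderiv i (pderiv i₁ (pderiv i₁ w)) 0)
      (2⁻¹ * pderiv i (pderiv i (pderiv i₁ (pderiv i₁ w))) 0
        + 2 * ∑ p, pderiv i (pderiv i₁ (pderiv p w)) 0 * ζ p + ∑ p, κ p * ζ p ^ 2) := by
    have h1 := HasJet.sum Finset.univ fun p _ => HasJet.sum Finset.univ fun q _ =>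
      ((hηj p).mul (hηj q)).mul (h.hasJet_pderiv_pderiv i p q)
    refine h1.congr_coeff ?_ ?_ ?_
    · simp [ite_mul]
    · simp [Finset.sum_add_distrib, add_mul, hζ, mul_ite, ite_mul]
    · have hs : ∀ p, pderiv i (pderiv p (pderiv i₁ w)) 0 = pderiv i (pderiv i₁ (pderiv p w)) 0 :=
        fun p => by rw [pderiv_comm hw2 p i₁]
      simp [Finset.sum_add_distrib, add_mul, mul_ite, ite_mul, hs]
      rw [two_mul]
      simp only [pow_two, mul_comm (κ _), mul_comm (pderiv i (pderiv i₁ (pderiv _ w)) 0)]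
  have hapos := ha.tendsto.eventually (lt_mem_nhds hκ)
  -- the norm of the tangent vector
  have hB : HasJet (fun t => ∑ p, η t p * η t p + fderiv ℝ w (x t) (η t) * fderiv ℝ w (x t) (η t))
      1 0 (∑ p, ζ p ^ 2 + if i = i₁ then κ i₁ ^ 2 else 0) := by
    have h1 := HasJet.sum Finset.univ fun p _ => (hηj p).mul (hηj p)
    have h2 := HasJet.sum Finset.univ fun p _ => (hηj p).mul (h.hasJet_pderiv i p)
    simp only [fderiv_eq_sum_pderiv]
    refine (h1.add (h2.mul h2)).congr_coeff ?_ ?_ ?_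
    · simp
    · simp [Finset.sum_add_distrib, hζ]
    · simp [pow_two]
      split_ifs with hi
      · rw [hi]
      · ring
  have hBpos := hB.tendsto.eventually (lt_mem_nhds one_pos)
  -- the support function
  have hP : HasJet (fun t => ∑ s, (x t s - ⟪e s, z - X₀⟫) * pderiv s w (x t) + (u - w (x t))) u
      (-(⟪e i, z - X₀⟫ * κ i))
      (2⁻¹ * (κ i - ∑ s, ⟪e s, z - X₀⟫ * pderiv i (pderiv i (pderiv s w)) 0)) := by
    have hxj : ∀ s, HasJet (fun t => x t s) 0 (if i = s then 1 else 0) 0 := fun s => by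
      refine ((HasJet.ident.mul (HasJet.const (if i = s then (1 : ℝ) else 0))).congr_coeff
        (by simp) (by simp) (by simp)).congr_fun
        (Eventually.of_forall fun t => (by simp [hx, Pi.single_apply, eq_comm]))
    have h1 := (HasJet.sum Finset.univ fun s _ =>
      ((hxj s).sub (HasJet.const ⟪e s, z - X₀⟫)).mul (h.hasJet_pderiv i s)).add
      ((HasJet.const u).sub (h.hasJet_height i))
    refine h1.congr_coeff ?_ ?_ ?_
    · simp
    · simp
    · simp [Finset.sum_add_distrib, Finset.mul_sum, mul_sub, mul_left_comm]
      ring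
  have hPpos := hP.tendsto.eventually (lt_mem_nhds hu0)
  -- the logarithm of the test function
  have hΦ := (((ha.log hκ.ne').add ((HasJet.const (((N : ℝ) - 1) / 2)).mul
    (hA.log one_ne_zero))).sub ((HasJet.const (N : ℝ)).mul (hP.log hu0.ne'))).sub
      (hB.log one_ne_zero)
  -- The normal curvature is A^(−1/2) a / B and the support function is A^(−1/2) P, with A the
  -- squared area element; hence the coefficient (N − 1)/2 of log A.
  have hle := hΦ.nonpos_of_le (by
    filter_upwards [hc.eventually h.mem, hc.eventually h.normal,
      hc.eventually h.eventually_fderivWithin, hapos, hBpos, hPpos] with t h1 h2 h3 h4 h5 h6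
    have hAp := areaSq_pos w (x t)
    have hvp : 0 < (√(areaSq w (x t)))⁻¹ := inv_pos.2 (Real.sqrt_pos.2 hAp)
    have h7 := hmax _ h1 (graphTangent (ν X₀ : E) e w (x t) (η t))
      (by rw [h2]; exact hfr.inner_graphNormal_graphTangent _ _)
    rw [h3, hfr.inner_fderiv_graphNormal_graphTangent h.contDiff, h2, hfr.inner_sub_graphNormal,
      ← real_inner_self_eq_norm_sq, hfr.inner_graphTangent, ← hu] at h7
    have h8 := Real.log_le_log (by positivity) h7
    rw [Real.log_mul (by positivity) (by positivity), Real.log_mul hvp.ne' h4.ne',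
      Real.log_mul (by positivity) h5.ne', Real.log_mul hκ.ne' (by positivity), Real.log_pow,
      Real.log_pow, Real.log_mul hvp.ne' h6.ne', Real.log_inv, Real.log_sqrt hAp.le] at h8
    simp only [Real.log_one]
    linarith)
  obtain ⟨hb, hcc⟩ := hle
  constructor
  · rw [← hb]; ring
  · have h2 : (2 : ℝ) * _ ≤ 2 * 0 := mul_le_mul_of_nonneg_left hcc zero_le_two
    rw [mul_zero] at h2
    refine le_of_eq_of_le ?_ h2
    split_ifs <;> field_simp <;> ring

end IsPrincipalGraph

end MaximumConditions

/-! ### The estimate at a maximum point -/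

section PointwiseEstimate

open Filter Topology

variable {E : Type*} [NormedAddCommGroup E] [InnerProductSpace ℝ E] {ι : Type*} [DecidableEq ι]
  [Fintype ι] {M : Set E} {ν : E → sphere (0 : E) 1} {X₀ : E} {e : ι → E}
  {w : (ι → ℝ) → ℝ} {κ : ι → ℝ}

omit [DecidableEq ι] in
theorem IsAdaptedFrame.norm_sum_inner_le {N : E} (h : IsAdaptedFrame N e) (y : E) :
    ‖∑ i, ⟪e i, y⟫ • e i‖ ≤ ‖y‖ := by
  have h1 := h.inner_combination (fun i => ⟪e i, y⟫) (fun i => ⟪e i, y⟫) ⟪N, y⟫ ⟪N, y⟫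
  have h2 := h.inner_combination (fun i => ⟪e i, y⟫) (fun i => ⟪e i, y⟫) 0 0
  rw [← h.expand, real_inner_self_eq_norm_sq] at h1
  simp only [zero_smul, add_zero, real_inner_self_eq_norm_sq] at h2
  refine le_of_sq_le_sq ?_ (norm_nonneg _)
  nlinarith [mul_self_nonneg ⟪N, y⟫]

/-- Symmetry in flat coordinates, in place of the commutation formula for second covariant
derivatives of the second fundamental form. -/
theorem pderiv_fourth_comm {w : (ι → ℝ) → ℝ} (hw : ContDiff ℝ 4 w) (i l : ι) :
    pderiv i (pderiv i (pderiv l (pderiv l w))) = pderiv l (pderiv l (pderiv i (pderiv i w))) := by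
  have h3 : ∀ j, ContDiff ℝ 3 (pderiv j w) := fun j => contDiff_pderiv hw (by norm_num) j
  have h2 : ∀ j k, ContDiff ℝ 2 (pderiv j (pderiv k w)) := fun j k =>
    contDiff_pderiv (h3 k) (by norm_num) j
  rw [pderiv_comm ((h3 l).of_le (by norm_num)) i l, pderiv_comm (hw.of_le (by norm_num)) i l,
    pderiv_comm (h2 l i) i l, pderiv_comm ((h3 i).of_le (by norm_num)) i l]

/-- Supplies the data of `largest_le_of_maximum_conditions`: T consists of the third derivatives of
w at the base point, whose full symmetry is the Codazzi equation, and Q of mixed fourth derivatives.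
-/
theorem IsPrincipalGraph.largest_le_of_isMax [FiniteDimensional ℝ E]
    (h : IsPrincipalGraph M ν X₀ e w κ) {z z₀ : E} (hX₀ : X₀ ∈ M)
    (hM : IsHypersurface 4 M) (hν : IsOuterUnitNormal M ν)
    (hz : z ∈ interior (convexHull ℝ M)) {k : ℕ} (hk : k + 2 ≤ Fintype.card ι) {Ψ : E × E → ℝ}
    (hΨ : ContDiffAt ℝ 2 Ψ (X₀, (ν X₀ : E)))
    (heq : ∀ X ∈ M, (principalCurvatures M ν X).esymm (k + 2) = Ψ (X, (ν X : E)))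
    {m F r D : ℝ} (hm : 0 < m) (hr : 0 < r) (hmΨ : m ≤ Ψ (X₀, (ν X₀ : E)))
    (hF : ∀ j ≤ 2, ‖iteratedFDeriv ℝ j Ψ (X₀, (ν X₀ : E))‖ ≤ F)
    (hrX : r ≤ ⟪X₀ - z₀, (ν X₀ : E)⟫) (hD : ‖z₀ - X₀‖ ≤ D) {N : ℕ}
    (hN : 2 * F + F ^ 2 / m + 1 ≤ (N - 1) * (m / 2)) {i₁ : ι} (h₁ : ∀ i, κ i ≤ κ i₁)
    (hbig1 : 2 ^ Fintype.card ι * max 1 F ≤ κ i₁)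
    (hbig2 : 2 * Fintype.card ι * (2 ^ Fintype.card ι * max 1 F) ≤ (N : ℝ)⁻¹ * κ i₁)
    (hmax : ∀ X ∈ M, ∀ ξ, ⟪(ν X : E), ξ⟫ = 0 →
      ⟪fderivWithin ℝ (fun Y => (ν Y : E)) M X ξ, ξ⟫ * ⟪X₀ - z₀, (ν X₀ : E)⟫ ^ N
        ≤ κ i₁ * ⟪X - z₀, (ν X : E)⟫ ^ N * ‖ξ‖ ^ 2) :
    κ i₁ ≤ N * ((k + 2) * F + F * D) / r := by
  have hκ := h.nonneg hν hX₀
  have hw2 : ContDiff ℝ 2 w := h.contDiff.of_le (by norm_num)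
  have hw3 : ∀ j, ContDiff ℝ 2 (pderiv j w) := fun j => contDiff_pderiv h.contDiff (by norm_num) j
  have hΨF : Ψ (X₀, (ν X₀ : E)) ≤ F := by
    have := hF 0 (by norm_num)
    rw [norm_iteratedFDeriv_zero] at this
    exact (Real.le_norm_self _).trans this
  have hF0 : 0 < F := hm.trans_le (hmΨ.trans hΨF)
  have hκ1 : 1 ≤ κ i₁ := by
    refine le_trans ?_ hbig1
    have h1 : (1 : ℝ) ≤ 2 ^ Fintype.card ι := one_le_pow₀ one_le_two
    nlinarith [le_max_left 1 F]
  have hfr := h.frame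
  set L := fderiv ℝ Ψ (X₀, (ν X₀ : E)) with hL
  have hL1 : ∀ v, |L v| ≤ F * ‖v‖ := norm_apply_le_of_iteratedFDeriv_one (hF 1 (by norm_num))
  have hL2 := norm_apply_le_of_iteratedFDeriv_two (hF 2 le_rfl)
  have heq' := fun l => h.differentiated_equation hM hν hz hk hΨ heq l
  have he1 : ∀ i, ‖e i‖ = 1 := hfr.orthonormal.1
  have hcomm : ∀ a b c, pderiv a (pderiv b (pderiv c w)) 0 = pderiv b (pderiv a (pderiv c w)) 0 :=
    fun a b c => by rw [pderiv_comm (hw3 c)]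
  have hcomm' : ∀ a b c,
      pderiv a (pderiv b (pderiv c w)) 0 = pderiv a (pderiv c (pderiv b w)) 0 :=
    fun a b c => by rw [pderiv_comm hw2 b c]
  have hcyc : ∀ a b c, pderiv a (pderiv b (pderiv c w)) 0 = pderiv b (pderiv c (pderiv a w)) 0 :=
    fun a b c => by rw [hcomm, hcomm']
  have hsec := (heq' i₁).2.2
  conv_lhs at hsec => simp only [hcyc i₁]
  conv_lhs at hsec => simp only [fun p q => hcomm q p i₁, ← pow_two]
  refine largest_le_of_maximum_conditions (T := fun a b c => pderiv a (pderiv b (pderiv c w)) 0)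
    (Q := fun i => pderiv i₁ (pderiv i₁ (pderiv i (pderiv i w))) 0)
    (z := fun s => ⟪e s, z₀ - X₀⟫) (g := fun s => L (e s, 0) + κ s * L (0, e s))
    (gX := fun s => L (e s, 0)) (φ := fun s => L (0, e s)) hκ h₁ hcomm hcomm' hm hr hrX hF0 hN
    (by rw [(heq' i₁).1]; exact hmΨ) (by rw [(heq' i₁).1]; exact hΨF) hbig1 hbig2 ?_ ?_ ?_
    hsec (fun s => rfl) ?_ ?_ ?_ (mul_nonneg hF0.le ((norm_nonneg _).trans hD))
  · intro i
    have h2 := (h.maximum_conditions (one_pos.trans_le hκ1) rfl (hr.trans_le hrX) hmax i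
      (ζ := 0) rfl).1
    simp only [hcomm' i₁ i₁ i, hcomm i₁ i i₁]
    rw [← h2]
  · intro i ζ hζ
    have h2 := (h.maximum_conditions (one_pos.trans_le hκ1) rfl (hr.trans_le hrX) hmax i hζ).2
    rw [congrFun (pderiv_fourth_comm h.contDiff i i₁) 0] at h2
    simp only [hcyc i i₁] at h2
    exact h2
  · intro s
    rw [← (heq' s).2.1]
    exact Finset.sum_congr rfl fun i _ => by rw [hcomm' i i s, hcomm i s i]
  · have hN1 : ‖((ν X₀ : E), κ i₁ • (ν X₀ : E))‖ = κ i₁ := by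
      rw [Prod.norm_def, norm_smul, hfr.norm_eq_one, Real.norm_of_nonneg (hκ i₁), mul_one,
        max_eq_right hκ1]
    have hv1 : ‖(e i₁, κ i₁ • e i₁)‖ = κ i₁ := by
      rw [Prod.norm_def, norm_smul, he1, Real.norm_of_nonneg (hκ i₁), mul_one, max_eq_right hκ1]
    have h2 := hL1 ((ν X₀ : E), κ i₁ • (ν X₀ : E))
    have h3 := hL2 (e i₁, κ i₁ • e i₁)
    rw [hN1] at h2
    rw [hv1] at h3
    have h4 := mul_le_mul_of_nonneg_left (abs_le.1 h2).2 (hκ i₁)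
    linarith [(abs_le.1 h3).1]
  · have h2 := hL1 (e i₁, κ i₁ • e i₁)
    have h3 : L (e i₁, κ i₁ • e i₁) = L (e i₁, 0) + κ i₁ * L (0, e i₁) := by
      rw [← smul_eq_mul, ← map_smul, ← map_add]; simp
    rw [h3, Prod.norm_def, norm_smul, he1, Real.norm_of_nonneg (hκ i₁), mul_one, max_eq_right hκ1] at h2
    exact h2
  · have h2 := hL1 (∑ s, ⟪e s, z₀ - X₀⟫ • e s, 0)
    have h3 : L (∑ s, ⟪e s, z₀ - X₀⟫ • e s, 0) = ∑ s, ⟪e s, z₀ - X₀⟫ * L (e s, 0) := by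
      have : ((∑ s, ⟪e s, z₀ - X₀⟫ • e s, 0) : E × E) = ∑ s, ⟪e s, z₀ - X₀⟫ • (e s, (0 : E)) := by
        ext <;> simp [Prod.fst_sum, Prod.snd_sum]
      rw [this, map_sum]
      simp only [map_smul, smul_eq_mul]
    rw [h3, Prod.norm_def, norm_zero, max_eq_left (norm_nonneg _)] at h2
    have h4 : F * ‖∑ s, ⟪e s, z₀ - X₀⟫ • e s‖ ≤ F * D := by
      gcongr
      exact (hfr.norm_sum_inner_le _).trans hD
    linarith [neg_abs_le (∑ s, ⟪e s, z₀ - X₀⟫ * L (e s, 0))]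

end PointwiseEstimate

/-! ### Regularity of the degree-zero extension -/

section HomogeneousExtension

open Filter Topology

variable {E : Type*} [NormedAddCommGroup E] [InnerProductSpace ℝ E]

theorem homogeneousExtension_coe (f : E × sphere (0 : E) 1 → ℝ) (X : E) (v : sphere (0 : E) 1) :
    homogeneousExtension f (X, (v : E)) = f (X, v) := by
  have hv : (v : E) ≠ 0 := ne_zero_of_mem_unit_sphere v
  rw [homogeneousExtension, dif_neg hv]
  congr 2
  ext
  simp

/-- A smooth map to the unit sphere that agrees with `v ↦ v / ‖v‖` near a given point. -/
theorem exists_contMDiff_normalize {n : ℕ} [Fact (Module.finrank ℝ E = n + 1)]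
    (v₀ : sphere (0 : E) 1) :
    ∃ g : E → sphere (0 : E) 1, ContMDiff 𝓘(ℝ, E) (𝓡 n) 2 g ∧
      ∀ᶠ v in 𝓝 (v₀ : E), (g v : E) = ‖v‖⁻¹ • v := by
  have : FiniteDimensional ℝ E := .of_fact_finrank_eq_succ n
  let χ : ContDiffBump (v₀ : E) := ⟨1 / 4, 1 / 2, by norm_num, by norm_num⟩
  -- The cut-off displacement has length below 1/2 < ‖v₀‖, so q never vanishes and can be normalized
  -- globally.
  set q : E → E := fun v => v₀ + χ v • (v - v₀) with hq
  have hq0 : ∀ v, q v ≠ 0 := fun v h0 => by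
    have h1 : ‖χ v • (v - (v₀ : E))‖ = 1 := by
      rw [eq_neg_of_add_eq_zero_right h0, norm_neg, norm_eq_of_mem_sphere]
    by_cases hv : v ∈ ball (v₀ : E) (1 / 2)
    · rw [norm_smul, Real.norm_of_nonneg χ.nonneg] at h1
      have h2 : ‖v - (v₀ : E)‖ < 1 / 2 := by rwa [← dist_eq_norm]
      nlinarith [χ.le_one (x := v), χ.nonneg (x := v), norm_nonneg (v - (v₀ : E))]
    · rw [χ.zero_of_le_dist (not_lt.1 fun hlt => hv hlt)] at h1
      simp at h1
  have hqc : ContDiff ℝ 2 q := contDiff_const.add (χ.contDiff.smul (contDiff_id.sub contDiff_const))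
  have hgc : ContDiff ℝ 2 fun v => ‖q v‖⁻¹ • q v :=
    ((hqc.norm ℝ hq0).inv fun v => norm_ne_zero_iff.2 (hq0 v)).smul hqc
  have hg1 : ∀ v, ‖q v‖⁻¹ • q v ∈ sphere (0 : E) 1 := fun v => by
    rw [mem_sphere_zero_iff_norm, norm_smul, norm_inv, norm_norm,
      inv_mul_cancel₀ (norm_ne_zero_iff.2 (hq0 v))]
  refine ⟨fun v => ⟨_, hg1 v⟩, hgc.contMDiff.codRestrict_sphere hg1, ?_⟩
  filter_upwards [χ.eventuallyEq_one] with v hv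
  have : q v = v := by rw [hq]; simp [hv]
  simp only [this]

/-- Near (X₀, v₀) the extension is f composed with a globally defined C² map into E × S, which turns
regularity on the manifold into regularity on the vector space. -/
theorem contDiffAt_homogeneousExtension {n : ℕ} [Fact (Module.finrank ℝ E = n + 1)]
    {f : E × sphere (0 : E) 1 → ℝ} {Γ : Set (E × sphere (0 : E) 1)} (hΓ : IsOpen Γ)
    (hf : ContMDiffOn (𝓘(ℝ, E).prod (𝓡 n)) 𝓘(ℝ, ℝ) 2 f Γ) {X₀ : E} {v₀ : sphere (0 : E) 1}
    (h₀ : (X₀, v₀) ∈ Γ) : ContDiffAt ℝ 2 (homogeneousExtension f) (X₀, (v₀ : E)) := by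
  obtain ⟨g, hg, hgv⟩ := exists_contMDiff_normalize (n := n) v₀
  have hG : ContMDiff 𝓘(ℝ, E × E) (𝓘(ℝ, E).prod (𝓡 n)) 2 fun p : E × E => (p.1, g p.2) :=
    (contDiff_fst.contMDiff).prodMk (hg.comp contDiff_snd.contMDiff)
  have hg0 : g v₀ = v₀ := by
    ext1
    rw [hgv.self_of_nhds]
    simp
  have hfat : ContMDiffAt (𝓘(ℝ, E).prod (𝓡 n)) 𝓘(ℝ, ℝ) 2 f (X₀, g v₀) := by
    rw [hg0]; exact hf.contMDiffAt (hΓ.mem_nhds h₀)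
  have h1 : ContMDiffAt 𝓘(ℝ, E × E) 𝓘(ℝ, ℝ) 2 (fun p : E × E => f (p.1, g p.2)) (X₀, (v₀ : E)) :=
    ContMDiffAt.comp (X₀, (v₀ : E)) (g := f) (f := fun p : E × E => (p.1, g p.2)) hfat
      hG.contMDiffAt
  have h2 := contMDiffAt_iff_contDiffAt.1 h1
  refine h2.congr_of_eventuallyEq ?_
  have hv0 : ∀ᶠ v in 𝓝 (v₀ : E), v ≠ 0 := isOpen_ne.mem_nhds (ne_zero_of_mem_unit_sphere v₀)
  filter_upwards [(continuous_snd.tendsto (X₀, (v₀ : E))).eventually hgv,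
    (continuous_snd.tendsto (X₀, (v₀ : E))).eventually hv0] with p hp hp0
  rw [homogeneousExtension, dif_neg hp0]
  congr 2
  ext1
  exact hp.symm

end HomogeneousExtension

/-! ### Existence of a maximum over the unit tangent bundle -/

section MaximumPoint

open Filter Topology

variable {E : Type*} [NormedAddCommGroup E] [InnerProductSpace ℝ E]
  {M : Set E} {ν : E → sphere (0 : E) 1}

/-- The unit tangent bundle of `M`. -/
def unitTangentBundle (M : Set E) (ν : E → sphere (0 : E) 1) : Set (E × E) :=
  {p | p.1 ∈ M ∧ ‖p.2‖ = 1 ∧ ⟪(ν p.1 : E), p.2⟫ = 0}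

theorem IsPrincipalGraph.inner_fderivWithin {ι : Type*} [DecidableEq ι] [Fintype ι] {X₀ : E}
    {e : ι → E} {w : (ι → ℝ) → ℝ} {κ : ι → ℝ} (h : IsPrincipalGraph M ν X₀ e w κ)
    (hX₀ : X₀ ∈ M) {ξ : E} (hξ : ⟪(ν X₀ : E), ξ⟫ = 0) :
    ⟪fderivWithin ℝ (fun Y => (ν Y : E)) M X₀ ξ, ξ⟫ = ∑ i, κ i * ⟪e i, ξ⟫ ^ 2 := by
  have h1 := h.eventually_inner_fderivWithin.self_of_nhdsWithin hX₀ ξ hξ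
  have h0 : (fun i => ⟪e i, X₀ - X₀⟫ : ι → ℝ) = 0 := by simp; rfl
  have hA : areaSq w 0 = 1 := by simp [areaSq, h.pderiv_zero]
  rw [h0, hA] at h1
  simp only [h.hessian] at h1
  rw [h1]
  simp [pow_two, mul_comm]

variable [FiniteDimensional ℝ E] {z : E} {n : ℕ}

theorem continuousOn_normal (hn : Module.finrank ℝ E = n + 1)
    (hM : IsHypersurface 4 M) (hν : IsOuterUnitNormal M ν)
    (hz : z ∈ interior (convexHull ℝ M)) : ContinuousOn (fun X => (ν X : E)) M := fun X hX => by
  obtain ⟨e, w, κ, h, -⟩ := exists_isPrincipalGraph hn hM hν hz hX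
  exact (h.eventually_differentiableWithinAt.self_of_nhdsWithin hX).continuousWithinAt

/-- The local graph formula expresses the normal curvature through the continuous Hessian of w. -/
theorem continuousOn_normalCurvature (hn : Module.finrank ℝ E = n + 1)
    (hM : IsHypersurface 4 M) (hν : IsOuterUnitNormal M ν)
    (hz : z ∈ interior (convexHull ℝ M)) :
    ContinuousOn (fun p : E × E => ⟪fderivWithin ℝ (fun Y => (ν Y : E)) M p.1 p.2, p.2⟫)
      (unitTangentBundle M ν) := by
  rintro ⟨X₀, ξ₀⟩ h₀
  obtain ⟨e, w, κ, h, -⟩ := exists_isPrincipalGraph hn hM hν hz h₀.1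
  have hfst : Tendsto Prod.fst (𝓝[unitTangentBundle M ν] (X₀, ξ₀)) (𝓝[M] X₀) :=
    continuous_fst.continuousWithinAt.tendsto_nhdsWithin fun p hp => hp.1
  have hev : (fun p : E × E => ⟪fderivWithin ℝ (fun Y => (ν Y : E)) M p.1 p.2, p.2⟫)
      =ᶠ[𝓝[unitTangentBundle M ν] (X₀, ξ₀)] fun p =>
        (√(areaSq w fun i => ⟪e i, p.1 - X₀⟫))⁻¹ * ∑ i, ∑ j, ⟪e i, p.2⟫ * ⟪e j, p.2⟫
          * pderiv i (pderiv j w) (fun i => ⟪e i, p.1 - X₀⟫) := by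
    filter_upwards [hfst.eventually h.eventually_inner_fderivWithin, self_mem_nhdsWithin]
      with p hp hp'
    exact hp p.2 hp'.2.2
  refine ContinuousWithinAt.congr_of_eventuallyEq ?_ hev (hev.self_of_nhdsWithin h₀)
  have h1 := (contDiff_inv_sqrt_areaSq h.contDiff).continuous
  have h2 : ∀ i j, Continuous (pderiv i (pderiv j w)) := fun i j =>
    (contDiff_pderiv (m := 2) (contDiff_pderiv (m := 3) h.contDiff (by norm_num) j)
      (by norm_num) i).continuous
  have h3 : Continuous fun p : E × E => (fun i => ⟪e i, p.1 - X₀⟫ : Fin n → ℝ) := by fun_prop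
  refine Continuous.continuousWithinAt ((h1.comp h3).mul ?_)
  refine continuous_finsetSum _ fun i _ => continuous_finsetSum _ fun j _ => ?_
  exact Continuous.mul (by fun_prop) ((h2 i j).comp h3)

theorem isCompact_unitTangentBundle (hMc : IsCompact M)
    (hc : ContinuousOn (fun X => (ν X : E)) M) : IsCompact (unitTangentBundle M ν) := by
  have h1 : IsCompact (M ×ˢ sphere (0 : E) 1) := hMc.prod (isCompact_sphere 0 1)
  have h2 : ContinuousOn (fun p : E × E => ⟪(ν p.1 : E), p.2⟫) (M ×ˢ sphere (0 : E) 1) :=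
    (hc.comp continuousOn_fst fun p hp => hp.1).inner continuousOn_snd
  have h3 := h2.preimage_isClosed_of_isClosed h1.isClosed (isClosed_singleton (x := (0 : ℝ)))
  have h4 : unitTangentBundle M ν = (M ×ˢ sphere (0 : E) 1) ∩
      (fun p : E × E => ⟪(ν p.1 : E), p.2⟫) ⁻¹' {0} := by
    ext p
    simp [unitTangentBundle, and_assoc]
  exact h1.of_isClosed_subset (h4 ▸ h3) (h4 ▸ inter_subset_left)

/-- The normal curvature divided by a power of the support function attains its maximum over the
unit tangent bundle, in the direction of a principal graph. -/
theorem exists_isPrincipalGraph_isMax (hn : Module.finrank ℝ E = n + 1) (hn0 : 0 < n)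
    (hM : IsHypersurface 4 M) (hMc : IsCompact M) (hMn : M.Nonempty)
    (hν : IsOuterUnitNormal M ν) (hz : z ∈ interior (convexHull ℝ M)) {z₀ : E}
    (hz₀ : ∀ X ∈ M, 0 < ⟪X - z₀, (ν X : E)⟫) (N : ℕ) :
    ∃ X₀ ∈ M, ∃ (e : Fin n → E) (w : (Fin n → ℝ) → ℝ) (κ : Fin n → ℝ) (i₁ : Fin n),
      IsPrincipalGraph M ν X₀ e w κ ∧ (∀ i, κ i ≤ κ i₁) ∧
      ∀ X ∈ M, ∀ ξ, ⟪(ν X : E), ξ⟫ = 0 →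
        ⟪fderivWithin ℝ (fun Y => (ν Y : E)) M X ξ, ξ⟫ * ⟪X₀ - z₀, (ν X₀ : E)⟫ ^ N
          ≤ κ i₁ * ⟪X - z₀, (ν X : E)⟫ ^ N * ‖ξ‖ ^ 2 := by
  have hc := continuousOn_normal hn hM hν hz
  have : Nonempty (Fin n) := ⟨⟨0, hn0⟩⟩
  have hSn : (unitTangentBundle M ν).Nonempty := by
    obtain ⟨X, hX⟩ := hMn
    obtain ⟨e, w, κ, h, -⟩ := exists_isPrincipalGraph hn hM hν hz hX
    exact ⟨(X, e ⟨0, hn0⟩), hX, h.frame.orthonormal.1 _, by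
      rw [real_inner_comm]; exact h.frame.inner_eq_zero _⟩
  have hpos : ∀ p ∈ unitTangentBundle M ν, 0 < ⟪p.1 - z₀, (ν p.1 : E)⟫ := fun p hp => hz₀ _ hp.1
  have hcont : ContinuousOn (fun p : E × E =>
      ⟪fderivWithin ℝ (fun Y => (ν Y : E)) M p.1 p.2, p.2⟫ / ⟪p.1 - z₀, (ν p.1 : E)⟫ ^ N)
      (unitTangentBundle M ν) := by
    refine (continuousOn_normalCurvature hn hM hν hz).div (ContinuousOn.pow ?_ N)
      fun p hp => (pow_pos (hpos p hp) N).ne'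
    exact (continuousOn_fst.sub continuousOn_const).inner
      (hc.comp continuousOn_fst fun p (hp : p ∈ unitTangentBundle M ν) => hp.1)
  obtain ⟨⟨X₀, ξ₀⟩, h₀, hmax⟩ := (isCompact_unitTangentBundle hMc hc).exists_isMaxOn hSn hcont
  obtain ⟨e, w, κ, h, -⟩ := exists_isPrincipalGraph hn hM hν hz h₀.1
  obtain ⟨i₁, hi₁⟩ := Finite.exists_max κ
  refine ⟨X₀, h₀.1, e, w, κ, i₁, h, hi₁, fun X hX ξ hξ => ?_⟩
  have hu₀ := hz₀ X₀ h₀.1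
  have hu := hz₀ X hX
  by_cases hξ0 : ξ = 0
  · simp [hξ0]
  have hnorm : 0 < ‖ξ‖ := norm_pos_iff.2 hξ0
  -- The maximizing direction need not belong to the chosen frame; its normal curvature is an
  -- average of the κ i, so the largest one may replace it.
  have hle : ⟪fderivWithin ℝ (fun Y => (ν Y : E)) M X₀ ξ₀, ξ₀⟫ ≤ κ i₁ := by
    have h1 := h.frame.inner_combination (fun i => ⟪e i, ξ₀⟫) (fun i => ⟪e i, ξ₀⟫)
      ⟪(ν X₀ : E), ξ₀⟫ ⟪(ν X₀ : E), ξ₀⟫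
    rw [← h.frame.expand, real_inner_self_eq_norm_sq, h₀.2.1, h₀.2.2] at h1
    rw [h.inner_fderivWithin h₀.1 h₀.2.2]
    calc ∑ i, κ i * ⟪e i, ξ₀⟫ ^ 2 ≤ ∑ i, κ i₁ * ⟪e i, ξ₀⟫ ^ 2 :=
          Finset.sum_le_sum fun i _ => mul_le_mul_of_nonneg_right (hi₁ i) (sq_nonneg _)
      _ = κ i₁ := by
        rw [← Finset.mul_sum]
        simp only [pow_two]
        linear_combination (-κ i₁) * h1
  have h1 := hmax (show (X, ‖ξ‖⁻¹ • ξ) ∈ unitTangentBundle M ν from ⟨hX, by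
    rw [norm_smul, norm_inv, norm_norm, inv_mul_cancel₀ hnorm.ne'], by
    rw [inner_smul_right, hξ, mul_zero]⟩)
  have h2 : ⟪fderivWithin ℝ (fun Y => (ν Y : E)) M X (‖ξ‖⁻¹ • ξ), ‖ξ‖⁻¹ • ξ⟫
      = ⟪fderivWithin ℝ (fun Y => (ν Y : E)) M X ξ, ξ⟫ / ‖ξ‖ ^ 2 := by
    rw [map_smul, inner_smul_left, inner_smul_right]
    simp only [conj_trivial]
    field_simp
  have h3 : ⟪fderivWithin ℝ (fun Y => (ν Y : E)) M X ξ, ξ⟫ / ‖ξ‖ ^ 2 / ⟪X - z₀, (ν X : E)⟫ ^ N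
      ≤ κ i₁ / ⟪X₀ - z₀, (ν X₀ : E)⟫ ^ N := by
    rw [← h2]
    exact le_trans h1 (div_le_div_of_nonneg_right hle (pow_nonneg hu₀.le N))
  rw [div_div, div_le_div_iff₀ (by positivity) (by positivity)] at h3
  linarith

end MaximumPoint

/-! ### Rays and differentiability of the radial function -/

section RadialFunction

open Filter Topology

variable {E : Type*} [NormedAddCommGroup E] [InnerProductSpace ℝ E]
  {M : Set E} {ν : E → sphere (0 : E) 1} {z : E}

theorem exists_ray_mem_frontier {K : Set E} (hK : Bornology.IsBounded K) (hz : z ∈ interior K)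
    {v : E} (hv : v ≠ 0) : ∃ t : ℝ, 0 ≤ t ∧ z + t • v ∈ frontier K := by
  have hconn : IsPreconnected ((fun t : ℝ => z + t • v) '' Ici 0) :=
    isPreconnected_Ici.image _ (by fun_prop)
  obtain ⟨R, hR⟩ := hK.subset_closedBall z
  have hout : z + ((|R| + 1) / ‖v‖) • v ∉ K := fun hmem => by
    have h1 := hR hmem
    rw [mem_closedBall, dist_eq_norm, add_sub_cancel_left, norm_smul, Real.norm_of_nonneg
      (by positivity), div_mul_cancel₀ _ (norm_ne_zero_iff.2 hv)] at h1
    linarith [le_abs_self R]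
  by_contra! hno
  have hcov : ∀ t : ℝ, 0 ≤ t → z + t • v ∈ interior K ∨ z + t • v ∈ (closure K)ᶜ := fun t ht => by
    by_contra! h
    exact hno t ht ⟨notMem_compl_iff.1 h.2, h.1⟩
  have hR0 : 0 ≤ (|R| + 1) / ‖v‖ := by positivity
  obtain ⟨y, -, hy1, hy2⟩ := hconn _ _ isOpen_interior isClosed_closure.isOpen_compl
    (by rintro _ ⟨t, ht, rfl⟩; exact hcov t ht)
    ⟨z, ⟨0, self_mem_Ici, by simp⟩, hz⟩
    ⟨_, ⟨_, mem_Ici.2 hR0, rfl⟩, (hcov _ hR0).resolve_left fun h => hout (interior_subset h)⟩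
  exact hy2 (interior_subset_closure hy1)

theorem inner_ray_pos (hν : IsOuterUnitNormal M ν) (hz : z ∈ interior (convexHull ℝ M)) {v : E}
    {t : ℝ} (ht : 0 ≤ t) (hmem : z + t • v ∈ M) : 0 < t ∧ 0 < ⟪(ν (z + t • v) : E), v⟫ := by
  have h1 := inner_interior_neg hν hz hmem
  rw [sub_add_cancel_left, inner_neg_right, inner_smul_right, neg_neg_iff_pos] at h1
  have h2 : 0 < ⟪(ν (z + t • v) : E), v⟫ := pos_of_mul_pos_right h1 ht
  exact ⟨pos_of_mul_pos_left h1 h2.le, h2⟩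

/-- Where a ray from z meets M it crosses the supporting hyperplane outwards, so it has no later
point on M. -/
theorem ray_parameter_unique (hν : IsOuterUnitNormal M ν) (hz : z ∈ interior (convexHull ℝ M))
    {v : E} {s t : ℝ} (hs : 0 ≤ s) (ht : 0 ≤ t) (hsM : z + s • v ∈ M) (htM : z + t • v ∈ M) :
    s = t := by
  wlog hst : s ≤ t generalizing s t
  · exact (this ht hs htM hsM (le_of_not_ge hst)).symm
  have h1 := hν _ hsM _ htM
  rw [add_sub_add_left_eq_sub, ← sub_smul, inner_smul_right] at h1
  nlinarith [(inner_ray_pos hν hz hs hsM).2]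

theorem radialFunction_eq (hν : IsOuterUnitNormal M ν) (hz : z ∈ interior (convexHull ℝ M))
    {v : E} {t : ℝ} (ht : 0 ≤ t) (hmem : z + t • (‖v‖⁻¹ • v) ∈ M) :
    radialFunction M z v = t := by
  have : {s : ℝ | 0 ≤ s ∧ z + s • (‖v‖⁻¹ • v) ∈ M} = {t} :=
    Set.eq_singleton_iff_unique_mem.2
      ⟨⟨ht, hmem⟩, fun s hs => ray_parameter_unique hν hz hs.1 ht hs.2 hmem⟩
  rw [radialFunction, this, csSup_singleton]

theorem radialFunction_smul {c : ℝ} (hc : 0 < c) (v : E) :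
    radialFunction M z (c • v) = radialFunction M z v := by
  have : ‖c • v‖⁻¹ • c • v = ‖v‖⁻¹ • v := by
    rw [norm_smul, Real.norm_of_nonneg hc.le, smul_smul, mul_inv_rev, inv_mul_cancel_right₀ hc.ne']
  rw [radialFunction, this, radialFunction]

/-- Implicit function theorem along the ray, which is transversal to M. It is needed because
`fderiv` is 0 by default at points of non-differentiability, where `C1NormLE` would carry no
information. -/
theorem differentiableAt_radialFunction [CompleteSpace E] (hM : IsHypersurface 4 M)
    (hν : IsOuterUnitNormal M ν) (hz : z ∈ interior (convexHull ℝ M)) {v₀ : E} (hv₀ : v₀ ≠ 0)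
    {t₀ : ℝ} (ht₀ : 0 ≤ t₀) (hmem : z + t₀ • (‖v₀‖⁻¹ • v₀) ∈ M) :
    DifferentiableAt ℝ (radialFunction M z) v₀ := by
  set X₀ := z + t₀ • (‖v₀‖⁻¹ • v₀) with hX₀
  obtain ⟨U, hU, hXU, φ, hφ, hdφ, hMU⟩ := hM X₀ hmem
  have hφ0 : φ X₀ = 0 := (hMU.subset ⟨hmem, hXU⟩).2
  have hφat : ContDiffAt ℝ 4 φ X₀ := hφ.contDiffAt (hU.mem_nhds hXU)
  obtain ⟨htpos, hin⟩ := inner_ray_pos hν hz ht₀ hmem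
  have hne := fderiv_ne_zero_of_inner_ne_zero hν hmem hU hXU (hφat.of_le (by norm_num))
    (hdφ X₀ hXU) hMU hin.ne'
  set Y : E × ℝ → E := fun p => z + p.2 • (‖p.1‖⁻¹ • p.1) with hY
  have hYc : ContDiffAt ℝ 4 Y (v₀, t₀) := by
    have h1 : ContDiffAt ℝ 4 (fun p : E × ℝ => ‖p.1‖⁻¹) (v₀, t₀) :=
      (contDiffAt_fst.norm ℝ hv₀).inv (norm_ne_zero_iff.2 hv₀)
    exact contDiffAt_const.add (contDiffAt_snd.smul (h1.smul contDiffAt_fst))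
  set Φ : E × ℝ → ℝ := fun p => φ (Y p) with hΦ
  have hΦc : ContDiffAt ℝ 4 Φ (v₀, t₀) := ContDiffAt.comp (v₀, t₀) hφat hYc
  have hΦd : fderiv ℝ Φ (v₀, t₀) (0, 1) = fderiv ℝ φ X₀ (‖v₀‖⁻¹ • v₀) := by
    have h1 : HasDerivAt (fun t : ℝ => (v₀, t)) ((0 : E), (1 : ℝ)) t₀ :=
      (hasDerivAt_const t₀ v₀).prodMk (hasDerivAt_id t₀)
    have h2 := (hΦc.differentiableAt (by norm_num)).hasFDerivAt.comp_hasDerivAt t₀ h1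
    have h3 : HasDerivAt (fun t : ℝ => z + t • (‖v₀‖⁻¹ • v₀)) (‖v₀‖⁻¹ • v₀) t₀ := by
      simpa using ((hasDerivAt_id t₀).smul_const (‖v₀‖⁻¹ • v₀)).const_add z
    have h4 := (hφat.differentiableAt (by norm_num)).hasFDerivAt.comp_hasDerivAt t₀ h3
    exact h2.unique h4
  have hinv : (fderiv ℝ Φ (v₀, t₀) ∘L .inr ℝ E ℝ).IsInvertible := by
    have hc : fderiv ℝ Φ (v₀, t₀) (0, 1) ≠ 0 := by rw [hΦd]; exact hne
    refine ⟨ContinuousLinearEquiv.unitsEquivAut ℝ (Units.mk0 _ hc), ?_⟩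
    ext
    simp
  have h4 : (4 : WithTop ℕ∞) ≠ 0 := by norm_num
  have hψc := hΦc.contDiffAt_implicitFunction h4 hinv
  have hψ0 := hΦc.implicitFunction_apply_self h4 hinv
  have hψe := hΦc.eventually_apply_implicitFunction h4 hinv
  set ψ := hΦc.implicitFunction h4 hinv
  refine (hψc.differentiableAt h4).congr_of_eventuallyEq ?_
  have hcont : ContinuousAt (fun v => Y (v, ψ v)) v₀ := by
    refine ContinuousAt.comp (f := fun v => (v, ψ v)) (g := Y) ?_
      (continuousAt_id.prodMk hψc.continuousAt)
    simp only [hψ0]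
    exact hYc.continuousAt
  have hYU : ∀ᶠ v in 𝓝 v₀, Y (v, ψ v) ∈ U :=
    hcont.preimage_mem_nhds (by rw [hψ0]; exact hU.mem_nhds hXU)
  have hψpos : ∀ᶠ v in 𝓝 v₀, 0 < ψ v :=
    hψc.continuousAt.eventually (lt_mem_nhds (by rw [hψ0]; exact htpos))
  filter_upwards [hψe, hYU, hψpos] with v h1 h2 h3
  refine radialFunction_eq hν hz h3.le (hMU.symm.subset ⟨h2, ?_⟩).1
  exact h1.trans hφ0

end RadialFunction

/-! ### A ball of controlled radius inside the hypersurface -/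

section Inradius

open Filter Topology

theorem pow_le_esymmOn {ι : Type*} {k : ℕ} {s : Finset ι} {x : ι → ℝ} {a : ℝ}
    (hk : k ≤ s.card) (ha : 0 ≤ a) (h : ∀ i ∈ s, a ≤ x i) : a ^ k ≤ esymmOn k s x := by
  obtain ⟨t, hts, htk⟩ := Finset.exists_subset_card_eq hk
  have h0 : ∀ u ∈ s.powersetCard k, 0 ≤ ∏ i ∈ u, x i := fun u hu =>
    Finset.prod_nonneg fun i hi => ha.trans (h i ((Finset.mem_powersetCard.1 hu).1 hi))
  calc a ^ k = ∏ _i ∈ t, a := by rw [Finset.prod_const, htk]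
    _ ≤ ∏ i ∈ t, x i := Finset.prod_le_prod (fun _ _ => ha) fun i hi => h i (hts hi)
    _ ≤ esymmOn k s x := Finset.single_le_sum h0 (Finset.mem_powersetCard.2 ⟨hts, htk⟩)

variable {E : Type*} [NormedAddCommGroup E] [InnerProductSpace ℝ E]
  {M : Set E} {ν : E → sphere (0 : E) 1} {z : E}

/-- The derivative tests for |X − z|²: M touches from inside the sphere about z through its farthest
point, so it is at least as curved as the sphere there. -/
theorem IsPrincipalGraph.farthest_conditions {ι : Type*} [DecidableEq ι] [Fintype ι] {X₀ : E}
    {e : ι → E} {w : (ι → ℝ) → ℝ} {κ : ι → ℝ} (h : IsPrincipalGraph M ν X₀ e w κ)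
    (hmax : ∀ X ∈ M, ‖X - z‖ ≤ ‖X₀ - z‖) (l : ι) :
    ⟪e l, X₀ - z⟫ = 0 ∧ 1 ≤ ⟪(ν X₀ : E), X₀ - z⟫ * κ l := by
  have hfr := h.frame
  set c : ι → ℝ := fun s => ⟪e s, X₀ - z⟫ with hc
  set b : ℝ := ⟪(ν X₀ : E), X₀ - z⟫ with hb
  have hnorm : ∀ x : ι → ℝ, ‖graphPoint X₀ (ν X₀ : E) e w x - z‖ ^ 2
      = ∑ s, (c s + x s) * (c s + x s) + (b - w x) * (b - w x) := fun x => by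
    rw [← hfr.inner_combination, ← real_inner_self_eq_norm_sq]
    have : graphPoint X₀ (ν X₀ : E) e w x - z
        = ∑ s, (c s + x s) • e s + (b - w x) • (ν X₀ : E) := by
      have h1 := hfr.expand (X₀ - z)
      have h2 : graphPoint X₀ (ν X₀ : E) e w x - z
          = (X₀ - z) + ∑ s, x s • e s - w x • (ν X₀ : E) := by rw [graphPoint]; abel
      rw [h2, h1]
      simp only [add_smul, sub_smul, Finset.sum_add_distrib]
      abel
    rw [this]
  have hj : HasJet (fun t : ℝ => ‖graphPoint X₀ (ν X₀ : E) e w (t • Pi.single l (1 : ℝ)) - z‖ ^ 2)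
      (‖X₀ - z‖ ^ 2) (2 * c l) (1 - b * κ l) := by
    have hxj : ∀ s, HasJet (fun t : ℝ => c s + (t • Pi.single l (1 : ℝ) : ι → ℝ) s) (c s)
        (if l = s then 1 else 0) 0 := fun s =>
      (((HasJet.const (c s)).add (HasJet.ident.mul
        (HasJet.const (if l = s then (1 : ℝ) else 0)))).congr_coeff
        (by simp) (by simp) (by simp)).congr_fun
        (Eventually.of_forall fun t => (by simp [Pi.single_apply, eq_comm]))
    have hwj := (HasJet.const b).sub (h.hasJet_height l)
    have h1 := (HasJet.sum Finset.univ fun s _ => (hxj s).mul (hxj s)).add (hwj.mul hwj)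
    refine (h1.congr_coeff ?_ ?_ ?_).congr_fun (Eventually.of_forall fun t => (hnorm _).symm)
    · have := hnorm 0
      simp only [graphPoint, h.zero] at this
      simp at this
      simp [this]
    · simp [Finset.sum_add_distrib]; ring
    · simp; ring
  have hcont : Tendsto (fun t : ℝ => t • (Pi.single l (1 : ℝ) : ι → ℝ)) (𝓝 0) (𝓝 0) :=
    Continuous.tendsto' (by fun_prop) _ _ (by simp)
  have h2 := hj.nonpos_of_le (by
    filter_upwards [hcont.eventually h.mem] with t ht
    have := hmax _ ht
    gcongr)
  constructor <;> linarith [h2.1, h2.2]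

/-- The differential of a function homogeneous of degree 0 is homogeneous of degree −1. -/
theorem norm_fderiv_radialFunction_le {Λ : ℝ} (hΛ : C1NormLE M z Λ) {v : E} (hv : v ≠ 0) :
    ‖fderiv ℝ (radialFunction M z) v‖ ≤ ‖v‖⁻¹ * Λ := by
  have hpos : 0 < ‖v‖⁻¹ := inv_pos.2 (norm_pos_iff.2 hv)
  have h1 : radialFunction M z = fun y => radialFunction M z (‖v‖⁻¹ • y) :=
    funext fun y => (radialFunction_smul hpos y).symm
  have hmem : ‖v‖⁻¹ • v ∈ sphere (0 : E) 1 := by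
    rw [mem_sphere_zero_iff_norm, norm_smul, norm_inv, norm_norm,
      inv_mul_cancel₀ (norm_ne_zero_iff.2 hv)]
  have h2 := (hΛ _ hmem).2
  rw [h1, fderiv_comp_smul, norm_smul, Real.norm_of_nonneg hpos.le]
  gcongr

theorem abs_radialFunction_sub_le [CompleteSpace E] (hM : IsHypersurface 4 M)
    (hν : IsOuterUnitNormal M ν) (hz : z ∈ interior (convexHull ℝ M)) {Λ : ℝ}
    (hΛ : C1NormLE M z Λ) (hray : ∀ v : E, v ≠ 0 → ∃ t : ℝ, 0 ≤ t ∧ z + t • v ∈ M)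
    {θ v : E} (hθ : ‖θ‖ = 1) (hv : ‖v - θ‖ ≤ 1 / 2) :
    |radialFunction M z v - radialFunction M z θ| ≤ 2 * Λ * ‖v - θ‖ := by
  have hΛ0 : 0 ≤ Λ := (norm_nonneg _).trans (hΛ θ (mem_sphere_zero_iff_norm.2 hθ)).1
  have hlow : ∀ y ∈ closedBall θ (1 / 2), 1 / 2 ≤ ‖y‖ := fun y hy => by
    rw [mem_closedBall, dist_comm, dist_eq_norm] at hy
    linarith [norm_sub_norm_le θ y]
  have hne : ∀ y ∈ closedBall θ (1 / 2), y ≠ 0 := fun y hy => by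
    rw [← norm_pos_iff]; linarith [hlow y hy]
  refine (convex_closedBall θ (1 / 2)).norm_image_sub_le_of_norm_fderiv_le (𝕜 := ℝ)
    (f := radialFunction M z) (C := 2 * Λ) (fun y hy => ?_) (fun y hy => ?_)
    (mem_closedBall_self (by norm_num)) (by rwa [mem_closedBall, dist_eq_norm])
  · have hy0 := hne y hy
    obtain ⟨t, ht, hmem⟩ := hray (‖y‖⁻¹ • y)
      (smul_ne_zero (inv_ne_zero (norm_ne_zero_iff.2 hy0)) hy0)
    exact differentiableAt_radialFunction hM hν hz hy0 ht hmem
  · refine (norm_fderiv_radialFunction_le hΛ (hne y hy)).trans ?_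
    have : ‖y‖⁻¹ ≤ 2 := by
      rw [inv_le_comm₀ (norm_pos_iff.2 (hne y hy)) two_pos]
      linarith [hlow y hy]
    gcongr

/-- A point with respect to which the support function is bounded from below. -/
theorem exists_le_inner_normal [FiniteDimensional ℝ E] {n k : ℕ}
    (hn : Module.finrank ℝ E = n + 1) (hk : 1 ≤ k) (hkn : k ≤ n) (hM : IsHypersurface 4 M)
    (hMc : IsCompact M) (hMn : M.Nonempty) (hν : IsOuterUnitNormal M ν)
    (hz : z ∈ interior (convexHull ℝ M)) {Λ F : ℝ} (hΛ : C1NormLE M z Λ)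
    (hray : ∀ v : E, v ≠ 0 → ∃ t : ℝ, 0 ≤ t ∧ z + t • v ∈ M)
    (hF : ∀ X ∈ M, (principalCurvatures M ν X).esymm k ≤ F) :
    0 < Λ ∧ ∃ z₀ : E, ∀ X ∈ M, (16 * Λ * max 1 F ^ 2)⁻¹ ≤ ⟪X - z₀, (ν X : E)⟫ ∧ ‖z₀ - X‖ ≤ 2 * Λ := by
  obtain ⟨X₁, hX₁, hmax⟩ := hMc.exists_isMaxOn hMn
    (f := fun X => ‖X - z‖) (by fun_prop)
  have hmax' : ∀ X ∈ M, ‖X - z‖ ≤ ‖X₁ - z‖ := fun X hX => hmax hX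
  obtain ⟨e, w, κ, h, hpc⟩ := exists_isPrincipalGraph hn hM hν hz hX₁
  have hfar := fun l => h.farthest_conditions hmax' l
  set R := ‖X₁ - z‖ with hR
  have hb : 0 < ⟪(ν X₁ : E), X₁ - z⟫ := by
    have := inner_interior_neg hν hz hX₁
    rw [← neg_sub, inner_neg_right] at this
    linarith
  have hbR : ⟪(ν X₁ : E), X₁ - z⟫ ≤ R := by
    have := real_inner_le_norm (ν X₁ : E) (X₁ - z)
    rwa [norm_eq_of_mem_sphere, one_mul] at this
  have hRpos : 0 < R := hb.trans_le hbR
  have hκR : ∀ l, R⁻¹ ≤ κ l := fun l => by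
    have h1 := (hfar l).2
    have h2 := h.nonneg hν hX₁ l
    rw [inv_le_iff_one_le_mul₀' hRpos]
    nlinarith
  -- At the farthest point all curvatures are at least 1/R, so R^(−k) ≤ σ_k ≤ F; this is where the
  -- equation bounds R from below.
  have hRF : R⁻¹ ≤ max 1 F := by
    by_cases h1 : R⁻¹ ≤ 1
    · exact h1.trans (le_max_left _ _)
    · have h2 := hF X₁ hX₁
      rw [hpc, esymm_map_univ] at h2
      have h3 := pow_le_esymmOn (k := k) (s := Finset.univ) (x := κ) (by simpa using hkn)
        (inv_pos.2 hRpos).le fun i _ => hκR i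
      have h4 : R⁻¹ ≤ R⁻¹ ^ k := le_self_pow₀ (not_le.1 h1).le (by omega)
      exact (h4.trans (h3.trans h2)).trans (le_max_right _ _)
  have hdist : ∀ X ∈ M, ‖X - z‖ ≤ Λ := fun X hX => by
    have hne : X - z ≠ 0 := fun h0 => by
      have h1 := inner_interior_neg hν hz hX
      rw [← neg_sub, h0, neg_zero, inner_zero_right] at h1
      exact h1.false
    have hpos := norm_pos_iff.2 hne
    have h1 : ‖‖X - z‖⁻¹ • (X - z)‖ = 1 := by
      rw [norm_smul, norm_inv, norm_norm, inv_mul_cancel₀ hpos.ne']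
    have h2 := (hΛ _ (mem_sphere_zero_iff_norm.2 h1)).1
    rw [radialFunction_smul (inv_pos.2 hpos), radialFunction_eq hν hz hpos.le
      (by rw [smul_inv_smul₀ hpos.ne']; simpa using hX)] at h2
    exact (Real.le_norm_self _).trans h2
  have hRΛ : R ≤ Λ := hdist X₁ hX₁
  obtain ⟨θ, hθ⟩ : ∃ θ : E, θ = R⁻¹ • (X₁ - z) := ⟨_, rfl⟩
  have hθ1 : ‖θ‖ = 1 := by
    rw [hθ, norm_smul, Real.norm_of_nonneg (inv_pos.2 hRpos).le, ← hR, inv_mul_cancel₀ hRpos.ne']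
  have hρθ : radialFunction M z θ = R := by
    refine radialFunction_eq hν hz hRpos.le ?_
    rw [hθ1, inv_one, one_smul, hθ, smul_inv_smul₀ hRpos.ne']
    simpa using hX₁
  have hΛ0 : 0 < Λ := hRpos.trans_le hRΛ
  -- The center lies a quarter of the way to the farthest point, well inside since ρ ≥ R/2 in all
  -- directions near θ.
  refine ⟨hΛ0, z + (R / 4) • θ, fun X hX => ⟨?_, ?_⟩⟩
  · set δ := R ^ 2 / (16 * Λ) with hδ
    have hδ0 : 0 < δ := by positivity
    have hδR : δ ≤ R / 16 := by
      rw [hδ, div_le_div_iff₀ (by positivity) (by norm_num)]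
      nlinarith
    have hδ' : (16 * Λ * max 1 F ^ 2)⁻¹ ≤ δ := by
      have h1 : (max 1 F)⁻¹ ≤ R := inv_le_of_inv_le₀ hRpos hRF
      have h2 : (0 : ℝ) < max 1 F := lt_of_lt_of_le one_pos (le_max_left _ _)
      rw [hδ, mul_inv, div_eq_mul_inv, mul_comm, ← inv_pow]
      gcongr
    refine hδ'.trans ?_
    set N : E := (ν X : E) with hN
    have hN1 : ‖N‖ = 1 := norm_eq_of_mem_sphere _
    set v : E := θ + (4 * δ / R) • N with hv
    have hvθ : ‖v - θ‖ = 4 * δ / R := by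
      rw [hv, add_sub_cancel_left, norm_smul, hN1, Real.norm_of_nonneg (by positivity), mul_one]
    have hvθ' : 4 * δ / R = R / (4 * Λ) := by rw [hδ]; field_simp; ring
    have hvθ4 : ‖v - θ‖ ≤ 1 / 4 := by
      rw [hvθ, div_le_div_iff₀ hRpos (by norm_num)]; linarith
    have hlip := abs_radialFunction_sub_le hM hν hz hΛ hray hθ1 (hvθ4.trans (by norm_num))
    have hlow : R / 2 ≤ radialFunction M z v := by
      rw [hρθ, hvθ, hvθ'] at hlip
      have : 2 * Λ * (R / (4 * Λ)) = R / 2 := by field_simp; ring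
      rw [this] at hlip
      linarith [(abs_le.1 hlip).1]
    have hv0 : 0 < ‖v‖ := by
      have := norm_sub_norm_le θ v
      rw [norm_sub_rev] at this
      linarith
    have hv2 : ‖v‖ ≤ 5 / 4 := by
      have := norm_sub_norm_le v θ
      linarith
    obtain ⟨t, ht, hmem⟩ := hray (‖v‖⁻¹ • v) (smul_ne_zero (inv_ne_zero hv0.ne')
      (norm_pos_iff.1 hv0))
    have hρv : radialFunction M z v = t := radialFunction_eq hν hz ht hmem
    rw [hρv] at hlow
    have h1 := hν X hX _ hmem
    have h2 := inner_interior_neg hν hz hX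
    rw [← hN] at h1 h2
    have h3 : z + t • (‖v‖⁻¹ • v) - X = (z - X) + (t * ‖v‖⁻¹) • v := by
      rw [smul_smul]; abel
    rw [h3, inner_add_right, inner_smul_right] at h1
    have h4 : ⟪N, v⟫ = ⟪N, θ⟫ + 4 * δ / R := by
      rw [hv, inner_add_right, inner_smul_right, real_inner_self_eq_norm_sq, hN1]; ring
    have h5 : ⟪X - (z + (R / 4) • θ), N⟫ = -⟪N, z - X⟫ - R / 4 * ⟪N, θ⟫ := by
      rw [real_inner_comm, ← sub_sub, inner_sub_right, inner_smul_right, ← neg_sub z X,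
        inner_neg_right]
    rw [h5]
    have h6 : R / 4 * ⟪N, v⟫ = R / 4 * ⟪N, θ⟫ + δ := by rw [h4]; field_simp
    have h7 : R / 4 ≤ t * ‖v‖⁻¹ := by
      rw [← div_eq_mul_inv, le_div_iff₀ hv0]
      nlinarith
    -- If ⟨N, v⟩ ≥ 0, the point of M on the ray through v lies beyond z + (R/4) v, so supporting it
    -- suffices. Otherwise ⟨N, X − z⟩ > 0 is already enough.
    by_cases h8 : 0 ≤ ⟪N, v⟫
    · nlinarith
    · nlinarith
  · have h1 : z + (R / 4) • θ - X = (R / 4) • θ - (X - z) := by abel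
    rw [h1]
    refine (norm_sub_le _ _).trans ?_
    rw [norm_smul, hθ1, Real.norm_of_nonneg (by positivity)]
    linarith [hdist X hX]

end Inradius

/-! ### The global curvature bound -/

section CurvatureEstimate

open Filter Topology

variable {E : Type*} [NormedAddCommGroup E] [InnerProductSpace ℝ E] [FiniteDimensional ℝ E]
  {M : Set E} {ν : E → sphere (0 : E) 1} {z : E}

omit [FiniteDimensional ℝ E] in
theorem IsClosedConvexHypersurface.isCompact (h : IsClosedConvexHypersurface M) : IsCompact M := by
  obtain ⟨-, K, -, hKc, -, rfl⟩ := h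
  exact hKc.of_isClosed_subset isClosed_frontier hKc.isClosed.frontier_subset

omit [FiniteDimensional ℝ E] in
theorem IsClosedConvexHypersurface.exists_ray_mem (h : IsClosedConvexHypersurface M)
    (hz : z ∈ interior (convexHull ℝ M)) {v : E} (hv : v ≠ 0) :
    ∃ t : ℝ, 0 ≤ t ∧ z + t • v ∈ M := by
  obtain ⟨-, K, hK, hKc, -, rfl⟩ := h
  exact exists_ray_mem_frontier hKc.isBounded
    (interior_mono (convexHull_min hKc.isClosed.frontier_subset hK) hz) hv

theorem exists_isPrincipalGraph_of_mem {n : ℕ} (hn : Module.finrank ℝ E = n + 1)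
    (hM : IsHypersurface 4 M) (hν : IsOuterUnitNormal M ν)
    (hz : z ∈ interior (convexHull ℝ M)) {X : E} (hX : X ∈ M) {c : ℝ}
    (hc : c ∈ principalCurvatures M ν X) :
    ∃ (e : Fin n → E) (w : (Fin n → ℝ) → ℝ) (κ : Fin n → ℝ) (i : Fin n),
      IsPrincipalGraph M ν X e w κ ∧ principalCurvatures M ν X = Finset.univ.val.map κ ∧
        κ i = c := by
  obtain ⟨e, w, κ, h, hpc⟩ := exists_isPrincipalGraph hn hM hν hz hX
  rw [hpc] at hc
  obtain ⟨i, -, hi⟩ := Multiset.mem_map.1 hc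
  exact ⟨e, w, κ, i, h, hpc, hi⟩

theorem principalCurvature_le_of_esymm_one {n : ℕ} (hn : Module.finrank ℝ E = n + 1)
    (hM : IsHypersurface 4 M) (hν : IsOuterUnitNormal M ν)
    (hz : z ∈ interior (convexHull ℝ M)) {X : E} (hX : X ∈ M) {F : ℝ}
    (hF : (principalCurvatures M ν X).esymm 1 ≤ F) {c : ℝ} (hc : c ∈ principalCurvatures M ν X) :
    c ≤ F := by
  obtain ⟨e, w, κ, i, h, hpc, rfl⟩ := exists_isPrincipalGraph_of_mem hn hM hν hz hX hc
  rw [hpc, esymm_map_univ, esymmOn, Finset.powersetCard_one, Finset.sum_map] at hF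
  refine le_trans ?_ hF
  simpa using Finset.single_le_sum (f := κ) (fun j _ => h.nonneg hν hX j) (Finset.mem_univ i)

/-- At the maximum point the largest curvature is at most C. Comparison of the test function at X
multiplies this by at most (2Λ/r)^N, where r and 2Λ bound the support function. -/
theorem principalCurvature_le {n k : ℕ} (hn : Module.finrank ℝ E = n + 1) (hk : k + 2 ≤ n)
    (hMc : IsClosedConvexHypersurface M) (hν : IsOuterUnitNormal M ν)
    (hz : z ∈ interior (convexHull ℝ M)) {Λ m F : ℝ} (hm : 0 < m) (hΛ : C1NormLE M z Λ)
    {Ψ : E × E → ℝ} (hΨ : ∀ X ∈ M, ContDiffAt ℝ 2 Ψ (X, (ν X : E)))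
    (heq : ∀ X ∈ M, (principalCurvatures M ν X).esymm (k + 2) = Ψ (X, (ν X : E)))
    (hmΨ : ∀ X ∈ M, m ≤ Ψ (X, (ν X : E)))
    (hF : ∀ X ∈ M, ∀ j ≤ 2, ‖iteratedFDeriv ℝ j Ψ (X, (ν X : E))‖ ≤ F) {N : ℕ}
    (hN : 2 * F + F ^ 2 / m + 1 ≤ (N - 1) * (m / 2)) {C : ℝ}
    (hC1 : 2 ^ n * max 1 F ≤ C) (hC2 : N * (2 * n * (2 ^ n * max 1 F)) ≤ C)
    (hC3 : N * ((k + 2) * F + F * (2 * Λ)) / (16 * Λ * max 1 F ^ 2)⁻¹ ≤ C)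
    {X : E} (hX : X ∈ M) {c : ℝ} (hc : c ∈ principalCurvatures M ν X) :
    c ≤ C * (2 * Λ / (16 * Λ * max 1 F ^ 2)⁻¹) ^ N := by
  have hM := hMc.1
  have hΨF : ∀ X ∈ M, Ψ (X, (ν X : E)) ≤ F := fun X hX => by
    have := hF X hX 0 (by norm_num)
    rw [norm_iteratedFDeriv_zero] at this
    exact (Real.le_norm_self _).trans this
  have hF0 : 0 < F := hm.trans_le ((hmΨ X hX).trans (hΨF X hX))
  obtain ⟨hΛ0, z₀, hz₀⟩ := exists_le_inner_normal hn (by omega) hk hM hMc.isCompact ⟨X, hX⟩ hν hz hΛ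
    (fun v hv => hMc.exists_ray_mem hz hv) fun X hX => (heq X hX).trans_le (hΨF X hX)
  have hτ : 0 < max 1 F := lt_max_of_lt_left one_pos
  set r := (16 * Λ * max 1 F ^ 2)⁻¹ with hr
  have hr0 : 0 < r := by positivity
  have hN0 : (0 : ℝ) < N := by
    have h1 : 0 < ((N : ℝ) - 1) * (m / 2) := lt_of_lt_of_le (by positivity) hN
    linarith [pos_of_mul_pos_left h1 (half_pos hm).le]
  obtain ⟨X₁, hX₁, e, w, κ, i₁, h, h₁, hmax⟩ := exists_isPrincipalGraph_isMax hn (by omega) hM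
    hMc.isCompact ⟨X, hX⟩ hν hz (fun X hX => hr0.trans_le (hz₀ X hX).1) N
  have hκ : κ i₁ ≤ C := by
    -- The pointwise estimate needs a large curvature; if κ i₁ exceeded C, its largeness assumptions
    -- would hold and its conclusion would contradict `hC3`.
    by_contra! hlt
    refine hlt.not_ge ((h.largest_le_of_isMax hX₁ hM hν hz (by simpa using hk) (hΨ X₁ hX₁) heq hm
      hr0 (hmΨ X₁ hX₁) (hF X₁ hX₁) (hz₀ X₁ hX₁).1 (hz₀ X₁ hX₁).2 hN h₁ ?_ ?_ hmax).trans hC3)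
    · simpa using hC1.trans hlt.le
    · rw [Fintype.card_fin, inv_mul_eq_div, le_div_iff₀' hN0]
      exact hC2.trans hlt.le
  obtain ⟨e', w', κ', i, h', -, rfl⟩ := exists_isPrincipalGraph_of_mem hn hM hν hz hX hc
  have hperp : ⟪(ν X : E), e' i⟫ = 0 := by
    rw [real_inner_comm]; exact h'.frame.inner_eq_zero i
  have h2 := hmax X hX (e' i) hperp
  have h3 : ∀ j, ⟪e' j, e' i⟫ = if j = i then 1 else 0 := fun j =>
    orthonormal_iff_ite.1 h'.frame.orthonormal j i
  rw [h'.inner_fderivWithin hX hperp, h'.frame.orthonormal.1] at h2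
  simp only [h3] at h2
  simp at h2
  have hu₁ := (hz₀ X₁ hX₁).1
  have hu := (hz₀ X hX).1
  have huΛ : ⟪X - z₀, (ν X : E)⟫ ≤ 2 * Λ := by
    refine (real_inner_le_norm _ _).trans ?_
    rw [norm_eq_of_mem_sphere, mul_one, norm_sub_rev]
    exact (hz₀ X hX).2
  have hκ0 := h'.nonneg hν hX i
  have hκ1 := h.nonneg hν hX₁ i₁
  have hC0 : 0 ≤ C := hκ1.trans hκ
  have hu0 : 0 ≤ ⟪X - z₀, (ν X : E)⟫ := hr0.le.trans hu
  have h4 : κ' i * r ^ N ≤ C * (2 * Λ) ^ N :=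
    calc κ' i * r ^ N ≤ κ' i * ⟪X₁ - z₀, (ν X₁ : E)⟫ ^ N := by gcongr
      _ ≤ κ i₁ * ⟪X - z₀, (ν X : E)⟫ ^ N := h2
      _ ≤ C * (2 * Λ) ^ N := by gcongr
  rwa [div_pow, ← mul_div_assoc, le_div_iff₀ (by positivity)]

end CurvatureEstimate
-- The theorem
theorem theorem1p1 (n k : ℕ) (hk : 1 ≤ k) (hkn : k ≤ n) (Λ m F : ℝ) (hm : 0 < m) :
    ∃ C : ℝ, ∀ (M : Set (EuclideanSpace ℝ (Fin (n + 1))))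
      (ν : EuclideanSpace ℝ (Fin (n + 1)) → sphere (0 : EuclideanSpace ℝ (Fin (n + 1))) 1)
      (z : EuclideanSpace ℝ (Fin (n + 1)))
      (Γ : Set (EuclideanSpace ℝ (Fin (n + 1)) × sphere (0 : EuclideanSpace ℝ (Fin (n + 1))) 1))
      (f : EuclideanSpace ℝ (Fin (n + 1)) × sphere (0 : EuclideanSpace ℝ (Fin (n + 1))) 1 → ℝ),
      IsClosedConvexHypersurface M →
      IsOuterUnitNormal M ν →
      z ∈ interior (convexHull ℝ M) →
      C1NormLE M z Λ →
      IsOpen Γ →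
      unitNormalBundle M ν ⊆ Γ →
      ContMDiffOn (𝓘(ℝ, EuclideanSpace ℝ (Fin (n + 1))).prod (𝓡 n)) 𝓘(ℝ, ℝ) 2 f Γ →
      (∀ p ∈ Γ, 0 < f p) →
      (∀ p ∈ unitNormalBundle M ν, m ≤ f p) →
      C2NormLE f (unitNormalBundle M ν) F →
      (∀ X ∈ M, (principalCurvatures M ν X).esymm k = f (X, ν X)) →
      ∀ X ∈ M, ∀ κ ∈ principalCurvatures M ν X, κ ≤ C := by
  -- (N − 1) m/2 has to exceed 2F, from the second derivatives of f, and F²/m, from (σ_k')²/σ_k, by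
  -- a margin of 1, which is what finally bounds κ₁.
  obtain ⟨N, hN⟩ : ∃ N : ℕ, 2 * F + F ^ 2 / m + 1 ≤ (N - 1) * (m / 2) := by
    obtain ⟨N, hN⟩ := exists_nat_ge ((2 * F + F ^ 2 / m + 1) / (m / 2) + 1)
    exact ⟨N, (div_le_iff₀ (half_pos hm)).1 (le_sub_iff_add_le.2 hN)⟩
  refine ⟨max F (max (max (2 ^ n * max 1 F) (N * (2 * n * (2 ^ n * max 1 F))))
    (N * (k * F + F * (2 * Λ)) / (16 * Λ * max 1 F ^ 2)⁻¹)
      * (2 * Λ / (16 * Λ * max 1 F ^ 2)⁻¹) ^ N), ?_⟩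
  intro M ν z Γ f hM hν hz hΛ hΓ hMΓ hf _ hmf hF heq X hX c hc
  have hn : Module.finrank ℝ (EuclideanSpace ℝ (Fin (n + 1))) = n + 1 := finrank_euclideanSpace_fin
  have : Fact (Module.finrank ℝ (EuclideanSpace ℝ (Fin (n + 1))) = n + 1) := ⟨hn⟩
  have hmem : ∀ X ∈ M, (X, ν X) ∈ unitNormalBundle M ν := fun X hX => ⟨X, hX, rfl⟩
  -- Degree 1 is separated because the concavity argument uses σ_{k−2}.
  obtain rfl | ⟨j, rfl⟩ : k = 1 ∨ ∃ j, k = j + 2 := by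
    obtain _ | _ | j := k
    · omega
    · exact Or.inl rfl
    · exact Or.inr ⟨j, rfl⟩
  · refine (principalCurvature_le_of_esymm_one hn hM.1 hν hz hX ?_ hc).trans (le_max_left _ _)
    have := hF _ (hmem X hX) 0 (by norm_num)
    rw [norm_iteratedFDeriv_zero, homogeneousExtension_coe] at this
    rw [heq X hX]
    exact (Real.le_norm_self _).trans this
  · refine (principalCurvature_le hn hkn hM hν hz hm hΛ (Ψ := homogeneousExtension f)
      (fun X hX => contDiffAt_homogeneousExtension hΓ hf (hMΓ (hmem X hX)))
      (fun X hX => (heq X hX).trans (homogeneousExtension_coe f X (ν X)).symm)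
      (fun X hX => (hmf _ (hmem X hX)).trans_eq (homogeneousExtension_coe f X (ν X)).symm)
      (fun X hX => hF _ (hmem X hX)) hN ((le_max_left _ _).trans (le_max_left _ _))
      ((le_max_right _ _).trans (le_max_left _ _)) ?_ hX hc).trans (le_max_right _ _)
    refine le_of_eq_of_le ?_ (le_max_right _ _)
    push_cast
    rfl
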